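/- Let $N\ge 1$, $0<s<1$, $2\le p<\infty$ with $N>sp$, and let $\Omega\subset\mathbb{R}^N$ be a bounded domain (nonempty, open, connected) with Lipschitz boundary. Let $$[u]_{s,p}=\Big(\int_{\mathbb{R}^N}\int_{\mathbb{R}^N}\frac{|u(x)-u(y)|^p}{|x-y|^{N+sp}}\,dy\,dx\Big)^{1/p},\qquad W_0^{s,p}(\Omega)=\{u\in L^p(\mathbb{R}^N):\ [u]_{s,p}<\infty,\ u=0 \text{ a.e. in } \mathbb{R}^N\setminus\Omega\},$$ the latter with the norm $[\cdot]_{s,p}$. For $u,v\in W_0^{s,p}(\Omega)$ put $$K^{s,p}(u,v)=\int_{\mathbb{R}^N}\int_{\mathbb{R}^N}\frac{|u(x)-u(y)|^{p-2}(u(x)-u(y))}{|x-y|^{N+sp}}(v(x)-v(y))\,dy\,dx,$$ $$E(u)=\frac1p[u]_{s,p}^p+\frac1p\int_\Omega|u|^p\,dx-\frac1p\int_\Omega|u|^p\log|u|\,dx+\frac1{p^2}\int_\Omega|u|^p\,dx,$$ where $|u|^p\log|u|$ and $|u|^{p-2}u\log|u|$ are read as $0$ where $u=0$. Consider the problem $$u_t+(-\Delta)_p^su+|u|^{p-2}u=|u|^{p-2}u\log|u|\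 \text{ in }\Omega,\ t>0;\qquad u=0\ \text{ in }\mathbb{R}^N\setminus\Omega,\ t>0;\qquad u(\cdot,0)=u_0\ \text{ in }\Omega. \tag{1}$$ A weak solution of (1) on $\Omega\times(0,T)$ is a function $u\in L^\infty(0,T;W_0^{s,p}(\Omega))$ with weak time derivative $u_t\in L^2(0,T;L^2(\Omega))$, whose representative in $C([0,T];L^2(\Omega))$ takes the value $u_0$ at $t=0$, and such that for every $v\in W_0^{s,p}(\Omega)$ and a.e. $t\in(0,T)$ $$\int_\Omega u_t v\,dx+K^{s,p}(u(t),v)+\int_\Omega|u|^{p-2}uv\,dx=\int_\Omega|u|^{p-2}u\log|u|\,v\,dx.$$ **Theorem.** For every $u_0\in W_0^{s,p}(\Omega)\setminus\{0\}$ there exist $T_*>0$ and a weak solution $u$ of (1) on $\Omega\times(0,T_*)$ such that $$\int_0^t\|u_\tau(\tau)\|_{L^2(\Omega)}^2\,d\tau+E(u(t))\le E(u_0)\qquad\text{for a.e. } t\in[0,T_*].$$ -/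

import Mathlib

open MeasureTheory Set Topology
open scoped ENNReal ContDiff

noncomputable section

namespace FracPLog

/-- The space `ℝ^N` with its Euclidean norm. -/
abbrev Space (N : ℕ) := EuclideanSpace ℝ (Fin N)

/-- `Ω` has Lipschitz boundary: near each boundary point `x`, in suitable orthonormal coordinates
(the last one in the direction `e`), the set `Ω` is exactly the region strictly above the graph of
a Lipschitz function of the coordinates orthogonal to `e`. -/
def HasLipschitzBoundary {N : ℕ} (Ω : Set (Space N)) : Prop :=
  ∀ x ∈ frontier Ω, ∃ (e : Space N) (γ : Space N → ℝ) (L : NNReal) (r : ℝ),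
    ‖e‖ = 1 ∧ LipschitzWith L γ ∧ 0 < r ∧
      ∀ y ∈ Metric.ball x r, y ∈ Ω ↔ γ (y - inner ℝ e y • e) < inner ℝ e y

/-- A bounded domain (nonempty connected open set) of `ℝ^N` with Lipschitz boundary. -/
structure BoundedLipschitzDomain (N : ℕ) where
  carrier : Set (Space N)
  isOpen : IsOpen carrier
  isConnected : IsConnected carrier
  isBounded : Bornology.IsBounded carrier
  lipschitz : HasLipschitzBoundary carrier

instance {p : ℝ} [hp : Fact (2 ≤ p)] : Fact (1 ≤ ENNReal.ofReal p) :=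
  ⟨by rw [ENNReal.one_le_ofReal]; linarith [hp.out]⟩

/-- The fractional difference quotient `(u(x) - u(y)) / |x - y|^(N/p + s)`. Its `L^p` norm over
`ℝ^N × ℝ^N` is the Gagliardo seminorm `[u]_{s,p}`. -/
def fracQuot {N : ℕ} (s p : ℝ) (u : Space N → ℝ) (z : Space N × Space N) : ℝ :=
  (u z.1 - u z.2) / ‖z.1 - z.2‖ ^ ((N : ℝ) / p + s)

theorem fracQuot_congr {N : ℕ} (s p : ℝ) {u v : Space N → ℝ} (h : u =ᵐ[volume] v) :
    fracQuot s p u =ᵐ[volume.prod volume] fracQuot s p v := by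
  have h1 := Measure.quasiMeasurePreserving_fst (μ := (volume : Measure (Space N)))
    (ν := (volume : Measure (Space N))) |>.ae h
  have h2 := Measure.quasiMeasurePreserving_snd (μ := (volume : Measure (Space N)))
    (ν := (volume : Measure (Space N))) |>.ae h
  filter_upwards [h1, h2] with z hz1 hz2
  simp only [fracQuot, hz1, hz2]

theorem fracQuot_add {N : ℕ} (s p : ℝ) (u v : Space N → ℝ) :
    fracQuot s p (u + v) = fracQuot s p u + fracQuot s p v := by
  ext z
  simp only [fracQuot, Pi.add_apply]
  ring

theorem fracQuot_smul {N : ℕ} (s p : ℝ) (c : ℝ) (u : Space N → ℝ) :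
    fracQuot s p (c • u) = c • fracQuot s p u := by
  ext z
  simp only [fracQuot, Pi.smul_apply, smul_eq_mul]
  ring

/-- The elements of `W_0^{s,p}(Ω)`, as a linear subspace of `L^p(ℝ^N)`: the functions with finite
Gagliardo seminorm that vanish almost everywhere outside `Ω`. -/
def W0Submodule {N : ℕ} (Ω : BoundedLipschitzDomain N) (s p : ℝ) :
    Submodule ℝ (Lp ℝ (ENNReal.ofReal p) (volume : Measure (Space N))) where
  carrier := {u | MemLp (fracQuot s p u) (ENNReal.ofReal p) (volume.prod volume) ∧
    ∀ᵐ x ∂(volume : Measure (Space N)), x ∉ Ω.carrier → u x = 0}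
  zero_mem' := by
    refine ⟨?_, ?_⟩
    · refine (memLp_congr_ae (fracQuot_congr s p (Lp.coeFn_zero _ _ _))).2 ?_
      have : fracQuot s p (0 : Space N → ℝ) = 0 := by
        ext z
        simp [fracQuot]
      rw [this]
      exact MemLp.zero
    · filter_upwards [Lp.coeFn_zero ℝ (ENNReal.ofReal p) (volume : Measure (Space N))] with x hx _
      exact hx
  add_mem' := by
    rintro u v ⟨hu, hu0⟩ ⟨hv, hv0⟩
    refine ⟨?_, ?_⟩
    · refine (memLp_congr_ae (fracQuot_congr s p (Lp.coeFn_add u v))).2 ?_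
      rw [fracQuot_add]
      exact hu.add hv
    · filter_upwards [Lp.coeFn_add u v, hu0, hv0] with x hx h1 h2 hxΩ
      have h3 : ((u + v : Lp ℝ (ENNReal.ofReal p) (volume : Measure (Space N))) : Space N → ℝ) x
          = u x + v x := hx
      exact h3.trans (by rw [h1 hxΩ, h2 hxΩ, add_zero])
  smul_mem' := by
    rintro c u ⟨hu, hu0⟩
    refine ⟨?_, ?_⟩
    · refine (memLp_congr_ae (fracQuot_congr s p (Lp.coeFn_smul c u))).2 ?_
      rw [fracQuot_smul]
      exact hu.const_smul c
    · filter_upwards [Lp.coeFn_smul c u, hu0] with x hx h1 hxΩ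
      simp [hx, h1 hxΩ]

/-- The space `W_0^{s,p}(Ω)`. It is not an abbreviation for the subspace of `L^p(ℝ^N)`, because it
carries the Gagliardo norm and not the `L^p` norm. -/
def W0 {N : ℕ} (Ω : BoundedLipschitzDomain N) (s p : ℝ) : Type := ↥(W0Submodule Ω s p)

namespace W0

instance {N : ℕ} (Ω : BoundedLipschitzDomain N) (s p : ℝ) : AddCommGroup (W0 Ω s p) :=
  inferInstanceAs (AddCommGroup ↥(W0Submodule Ω s p))

instance {N : ℕ} (Ω : BoundedLipschitzDomain N) (s p : ℝ) : Module ℝ (W0 Ω s p) :=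
  inferInstanceAs (Module ℝ ↥(W0Submodule Ω s p))

/-- The inclusion of `W_0^{s,p}(Ω)` in `L^p(ℝ^N)`. -/
def toLp {N : ℕ} (Ω : BoundedLipschitzDomain N) (s p : ℝ) :
    W0 Ω s p →ₗ[ℝ] Lp ℝ (ENNReal.ofReal p) (volume : Measure (Space N)) :=
  (W0Submodule Ω s p).subtype

/-- An element of `W_0^{s,p}(Ω)` used as a function on `ℝ^N` (through a representative). -/
instance {N : ℕ} (Ω : BoundedLipschitzDomain N) (s p : ℝ) :
    CoeFun (W0 Ω s p) (fun _ => Space N → ℝ) :=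
  ⟨fun u => toLp Ω s p u⟩

theorem memLp_fracQuot {N : ℕ} (Ω : BoundedLipschitzDomain N) (s p : ℝ) (u : W0 Ω s p) :
    MemLp (fracQuot s p u) (ENNReal.ofReal p) (volume.prod volume) :=
  u.2.1

theorem ae_eq_zero {N : ℕ} (Ω : BoundedLipschitzDomain N) (s p : ℝ) (u : W0 Ω s p) :
    ∀ᵐ x ∂(volume : Measure (Space N)), x ∉ Ω.carrier → u x = 0 :=
  u.2.2

/-- The map sending `u` to its fractional difference quotient in `L^p(ℝ^N × ℝ^N)`. -/
def quot {N : ℕ} (Ω : BoundedLipschitzDomain N) (s p : ℝ) :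
    W0 Ω s p →ₗ[ℝ]
      Lp ℝ (ENNReal.ofReal p) ((volume : Measure (Space N)).prod (volume : Measure (Space N))) where
  toFun u := (memLp_fracQuot Ω s p u).toLp _
  map_add' u v := by
    refine Eq.trans ?_ (MemLp.toLp_add (memLp_fracQuot Ω s p u) (memLp_fracQuot Ω s p v))
    refine MemLp.toLp_congr _ _ ?_
    rw [← fracQuot_add]
    exact fracQuot_congr s p (Lp.coeFn_add (toLp Ω s p u) (toLp Ω s p v))
  map_smul' c u := by
    refine Eq.trans ?_ (MemLp.toLp_const_smul c (memLp_fracQuot Ω s p u))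
    refine MemLp.toLp_congr _ _ ?_
    rw [← fracQuot_smul]
    exact fracQuot_congr s p (Lp.coeFn_smul c (toLp Ω s p u))

theorem quot_injective {N : ℕ} [NeZero N] (Ω : BoundedLipschitzDomain N) (s p : ℝ) :
    Function.Injective (quot Ω s p) := by
  rw [injective_iff_map_eq_zero]
  intro u hu
  have h0 : fracQuot s p u =ᵐ[volume.prod volume] 0 := by
    have h1 := MemLp.coeFn_toLp (memLp_fracQuot Ω s p u)
    have h2 : (quot Ω s p u : Space N × Space N → ℝ) =ᵐ[volume.prod volume] 0 := by
      rw [hu]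
      exact Lp.coeFn_zero _ _ _
    exact h1.symm.trans h2
  have h3 : ∀ᵐ x ∂(volume : Measure (Space N)), ∀ᵐ y ∂(volume : Measure (Space N)), u x = u y := by
    refine Measure.ae_ae_of_ae_prod (p := fun z : Space N × Space N => u z.1 = u z.2) ?_
    filter_upwards [h0] with z hz
    by_cases hzz : z.1 = z.2
    · rw [hzz]
    · have hpos : 0 < ‖z.1 - z.2‖ ^ ((N : ℝ) / p + s) :=
        Real.rpow_pos_of_pos (norm_pos_iff.2 (sub_ne_zero.2 hzz)) _
      have : (u z.1 - u z.2) / ‖z.1 - z.2‖ ^ ((N : ℝ) / p + s) = 0 := hz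
      rcases div_eq_zero_iff.1 this with h | h
      · linarith
      · exact absurd h hpos.ne'
  have hcompl : volume Ω.carrierᶜ ≠ 0 := by
    intro h
    have hfin : volume Ω.carrier < ⊤ := Ω.isBounded.measure_lt_top
    have : volume (univ : Set (Space N)) = ⊤ := measure_univ_of_isAddLeftInvariant _
    rw [← union_compl_self Ω.carrier] at this
    have h4 := measure_union_le (μ := (volume : Measure (Space N))) Ω.carrier Ω.carrierᶜ
    rw [this, h, add_zero] at h4
    exact absurd h4 (not_le.2 hfin)
  have hfreq : ∃ᵐ x ∂(volume : Measure (Space N)), x ∈ Ω.carrierᶜ :=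
    frequently_ae_mem_iff.2 hcompl
  apply Subtype.ext
  refine Lp.ext ?_
  refine Filter.EventuallyEq.trans ?_ (Lp.coeFn_zero _ _ _).symm
  filter_upwards [h3] with x hx
  obtain ⟨y, hy, hxy, hy0⟩ := (hfreq.and_eventually (hx.and (ae_eq_zero Ω s p u))).exists
  exact hxy.trans (hy0 hy)

/-- `W_0^{s,p}(Ω)` with the norm `‖u‖ = [u]_{s,p}`. -/
instance {N : ℕ} [NeZero N] (Ω : BoundedLipschitzDomain N) (s p : ℝ) [Fact (2 ≤ p)] :
    NormedAddCommGroup (W0 Ω s p) :=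
  NormedAddCommGroup.induced _ _ (quot Ω s p) (quot_injective Ω s p)

instance {N : ℕ} [NeZero N] (Ω : BoundedLipschitzDomain N) (s p : ℝ) [Fact (2 ≤ p)] :
    NormedSpace ℝ (W0 Ω s p) :=
  NormedSpace.induced ℝ _ _ (quot Ω s p)

/-- The norm of `W_0^{s,p}(Ω)` is the Gagliardo seminorm, written as a double integral. -/
theorem norm_rpow_eq {N : ℕ} [NeZero N] (Ω : BoundedLipschitzDomain N) (s p : ℝ)
    [hp : Fact (2 ≤ p)] (u : W0 Ω s p) :
    ‖u‖ ^ p = ∫ x, ∫ y, |u x - u y| ^ p / ‖x - y‖ ^ ((N : ℝ) + s * p) := by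
  have hp2 := hp.out
  have hp0 : 0 ≤ p := by linarith
  have hpp : 0 < p := by linarith
  have hpos : ENNReal.ofReal p ≠ 0 := by simpa using hpp
  have hm := W0.memLp_fracQuot Ω s p u
  have h : ‖u‖ = ‖hm.toLp _‖ := rfl
  have key : ∀ z : Space N × Space N, ‖fracQuot s p u z‖ ^ p
      = |u z.1 - u z.2| ^ p / ‖z.1 - z.2‖ ^ ((N : ℝ) + s * p) := by
    intro z
    rw [fracQuot, norm_div, Real.div_rpow (norm_nonneg _) (norm_nonneg _), Real.norm_eq_abs,
      Real.norm_eq_abs, abs_of_nonneg (Real.rpow_nonneg (norm_nonneg (z.1 - z.2)) _),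
      ← Real.rpow_mul (norm_nonneg _)]
    congr 2
    field_simp
  have hint := hm.integrable_norm_rpow hpos (by simp)
  rw [ENNReal.toReal_ofReal hp0] at hint
  have hnn : 0 ≤ ∫ z, ‖fracQuot s p u z‖ ^ p ∂(volume.prod volume) :=
    integral_nonneg fun z => Real.rpow_nonneg (norm_nonneg _) _
  rw [h, Lp.norm_toLp, hm.eLpNorm_eq_integral_rpow_norm hpos (by simp),
    ENNReal.toReal_ofReal hp0, ENNReal.toReal_ofReal (Real.rpow_nonneg hnn _),
    ← Real.rpow_mul hnn, inv_mul_cancel₀ hpp.ne', Real.rpow_one]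
  simp_rw [key] at hint ⊢
  exact integral_prod _ hint

theorem memLp_two {N : ℕ} (Ω : BoundedLipschitzDomain N) (s p : ℝ) [hp : Fact (2 ≤ p)]
    (u : W0 Ω s p) : MemLp (u : Space N → ℝ) 2 (volume.restrict Ω.carrier) := by
  have : IsFiniteMeasure ((volume : Measure (Space N)).restrict Ω.carrier) :=
    ⟨by simpa using Ω.isBounded.measure_lt_top⟩
  refine MemLp.mono_exponent ((Lp.memLp (toLp Ω s p u)).restrict _) ?_
  rw [ENNReal.le_ofReal_iff_toReal_le (by simp) (by linarith [hp.out])]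
  simpa using hp.out

end W0

/-- The space `L²(Ω)`. -/
abbrev L2 {N : ℕ} (Ω : BoundedLipschitzDomain N) := Lp ℝ 2 (volume.restrict Ω.carrier)

/-- The class in `L²(Ω)` of an element of `W_0^{s,p}(Ω)`; recall that `p ≥ 2` and that `Ω` is
bounded. -/
def W0.toL2 {N : ℕ} {Ω : BoundedLipschitzDomain N} {s p : ℝ} [Fact (2 ≤ p)] (u : W0 Ω s p) :
    L2 Ω :=
  (W0.memLp_two Ω s p u).toLp _

/-- The form `K^{s,p}(u, v)` of the fractional `p`-Laplacian. -/
def K {N : ℕ} (s p : ℝ) (u v : Space N → ℝ) : ℝ :=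
  ∫ x, ∫ y, |u x - u y| ^ (p - 2) * (u x - u y) / ‖x - y‖ ^ ((N : ℝ) + s * p) * (v x - v y)

/-- The energy functional `E`. -/
def energy {N : ℕ} {Ω : BoundedLipschitzDomain N} {s p : ℝ} (u : W0 Ω s p) : ℝ :=
  1 / p * (∫ x, ∫ y, |u x - u y| ^ p / ‖x - y‖ ^ ((N : ℝ) + s * p))
    + 1 / p * (∫ x in Ω.carrier, |u x| ^ p)
    - 1 / p * (∫ x in Ω.carrier, |u x| ^ p * Real.log |u x|)
    + 1 / p ^ 2 * (∫ x in Ω.carrier, |u x| ^ p)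

/-- `ut` is the weak (distributional) time derivative of the curve `u` on the interval `(0, T)`. -/
def HasWeakTimeDeriv {H : Type*} [NormedAddCommGroup H] [NormedSpace ℝ H] (T : ℝ)
    (u ut : ℝ → H) : Prop :=
  ∀ φ : ℝ → ℝ, ContDiff ℝ ∞ φ → HasCompactSupport φ → tsupport φ ⊆ Ioo 0 T →
    ∫ t in Ioo 0 T, deriv φ t • u t = -∫ t in Ioo 0 T, φ t • ut t

/-- `u` is a weak solution on `Ω × (0, T)`, with time derivative `ut`, of
`u_t + (-Δ)_p^s u + |u|^(p-2) u = |u|^(p-2) u log |u|`, `u = 0` outside `Ω`, `u(0) = u₀`. -/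
structure IsWeakSolution {N : ℕ} [NeZero N] {Ω : BoundedLipschitzDomain N} {s p : ℝ}
    [Fact (2 ≤ p)] (T : ℝ) (u₀ : W0 Ω s p) (u : ℝ → W0 Ω s p) (ut : ℝ → L2 Ω) : Prop where
  /-- `u ∈ L^∞(0, T; W_0^{s,p}(Ω))` -/
  memLp : MemLp u (⊤ : ℝ≥0∞) (volume.restrict (Ioo 0 T))
  /-- `u_t ∈ L²(0, T; L²(Ω))` -/
  memLp_deriv : MemLp ut 2 (volume.restrict (Ioo 0 T))
  /-- `ut = u_t` -/
  weakDeriv : HasWeakTimeDeriv T (fun t => (u t).toL2) ut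
  /-- `u(0) = u₀`, for the representative of `u` in `C([0, T]; L²(Ω))` -/
  initial : ∃ w : ℝ → L2 Ω, ContinuousOn w (Icc 0 T) ∧
    (∀ᵐ t ∂(volume.restrict (Ioo 0 T)), w t = (u t).toL2) ∧ w 0 = u₀.toL2
  /-- the weak form of the equation -/
  weakForm : ∀ v : W0 Ω s p, ∀ᵐ t ∂(volume.restrict (Ioo 0 T)),
    (∫ x in Ω.carrier, ut t x * v x) + K s p (u t) v
        + (∫ x in Ω.carrier, |u t x| ^ (p - 2) * u t x * v x)
      = ∫ x in Ω.carrier, |u t x| ^ (p - 2) * u t x * Real.log |u t x| * v x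

end FracPLog

end

noncomputable section

namespace FracPLog

/-! Write f for `logSource` and F for its primitive. The problem is the L² gradient flow of `‖u‖^p /
p - ∫ F(u)` (`W0.energy_eq`), a convex functional, lower semicontinuous for L² convergence, minus a
perturbation of lower order. Freezing f outside [-n, n] makes it bounded and one-sided Lipschitz
(`exists_truncSource_sub_le`). The primitive is then bounded above by its tangents plus a quadratic
(`integral_le_of_oneSided`), so for small time steps the minimizing movement scheme has solutions
(`W0.exists_minimizer`). They satisfy a variational inequality (`W0.inner_le_of_minimizer`), and
testing it with the previous iterate gives the dissipation of energy (`W0.truncEnergy_step_le`).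

The existence time must not depend on n. The key is a gain of integrability (`rpow_le_gagDensity`):
for functions bounded in L², the integral of `|u|^q` is at most a multiple of `‖u‖^p`, with q = p +
2sp/N > p. The logarithm costs only an arbitrarily small power, so F grows more slowly than `|t|^q`,
and the truncated energies are coercive on L² balls uniformly in n (`W0.exists_le_truncEnergy`). As
long as the scheme stays in such a ball, its total dissipation is at most a constant B. By
Cauchy–Schwarz a dissipation of B moves the curve by at most 1 in L² during a time 1/B, so up to
that time the scheme cannot leave the ball (`norm_sub_le_one_of_sum_le`,
`W0.exists_isDiscreteSolution`).

Compactness in space comes from averages on small balls: they are uniformly close in L¹ to the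
function on balls of `W0`, they turn weak convergence into strong convergence, and the gain of
integrability upgrades L¹ to L² (`W0.exists_subseq_tendsto_toL2`). Together with the Hölder bound in
time this gives strong L² convergence at every time and weak convergence of the difference
quotients, with the truncation level and the time step removed together (`W0.exists_isLimitCurve`).

The form K is not passed to the limit directly. The variational inequality tested with u(t) + v
survives by lower semicontinuity of the norm (`W0.IsLimitCurve.ae_integral_sub_inner_le`). Replacing
v by v / (j + 1) and letting j grow turns the increment of `‖·‖^p / p` into K
(`W0.le_K_of_forall_le`), and using both v and -v gives the equation. The energy inequality follows
from the discrete one, again by lower semicontinuity. -/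

/-! ### The reaction term, its truncations and their primitives -/

/-- The reaction term `|t|^(p-2) t log |t| - |t|^(p-2) t`. -/
def logSource (p t : ℝ) : ℝ := |t| ^ (p - 2) * (t * Real.log t - t)

/-- The reaction term frozen outside `[-n, n]`. -/
def truncSource (p : ℝ) (n : ℕ) (t : ℝ) : ℝ := logSource p (max (-n) (min n t))

/-- The primitive of the reaction term vanishing at `0`. -/
def logPotential (p t : ℝ) : ℝ := ∫ x in (0)..t, logSource p x

/-- The primitive of the truncated reaction term vanishing at `0`. -/
def truncPotential (p : ℝ) (n : ℕ) (t : ℝ) : ℝ := ∫ x in (0)..t, truncSource p n x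

theorem continuous_logSource {p : ℝ} (hp : 2 ≤ p) : Continuous (logSource p) := by
  unfold logSource
  exact (continuous_abs.rpow_const fun _ => Or.inr (by linarith)).mul
    (Real.continuous_mul_log.sub continuous_id)

theorem continuous_truncSource {p : ℝ} (hp : 2 ≤ p) (n : ℕ) : Continuous (truncSource p n) :=
  (continuous_logSource hp).comp (by fun_prop)

theorem logSource_neg (p t : ℝ) : logSource p (-t) = -logSource p t := by
  simp only [logSource, abs_neg, Real.log_neg_eq_log]
  ring

theorem logSource_zero (p : ℝ) : logSource p 0 = 0 := by simp [logSource]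

theorem truncSource_zero (p : ℝ) (n : ℕ) : truncSource p n 0 = 0 := by
  simp [truncSource, logSource_zero]

theorem truncSource_of_abs_le (p : ℝ) {n : ℕ} {t : ℝ} (h : |t| ≤ n) :
    truncSource p n t = logSource p t := by
  rw [abs_le] at h
  rw [truncSource, min_eq_right h.2, max_eq_right h.1]

theorem abs_clamp_le (n : ℕ) (t : ℝ) : |max (-(n : ℝ)) (min n t)| ≤ |t| := by
  have hn : (0 : ℝ) ≤ n := n.cast_nonneg
  rcases le_total t 0 with h | h
  · rw [min_eq_right (h.trans hn), abs_of_nonpos h, abs_of_nonpos (max_le (by linarith) h)]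
    linarith [le_max_right (-(n : ℝ)) t]
  · have : 0 ≤ min (n : ℝ) t := le_min hn h
    rw [max_eq_right (by linarith), abs_of_nonneg this, abs_of_nonneg h]
    exact min_le_right _ _

/-- On [-1, 1] continuity suffices. Outside, `log |t| ≤ |t|^(r-p) / (r-p)`, so the logarithm costs
only the power r - p, which may be as small as desired. -/
theorem abs_logSource_le {p r : ℝ} (hp : 2 ≤ p) (hr : p < r) :
    ∃ C, 0 < C ∧ ∀ t, |logSource p t| ≤ C * (1 + |t| ^ (r - 1)) := by
  obtain ⟨C₀, hC₀⟩ := (isCompact_Icc (a := (-1 : ℝ)) (b := 1)).exists_bound_of_continuousOn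
    (continuous_logSource hp).continuousOn
  have hC₀' : 0 ≤ C₀ := (norm_nonneg _).trans (hC₀ 0 (by simp))
  have hrp : 0 < r - p := by linarith
  refine ⟨C₀ + (1 / (r - p) + 1), by positivity, fun t => ?_⟩
  have h0 : 0 ≤ |t| ^ (r - 1) := Real.rpow_nonneg (abs_nonneg t) _
  have h1 : 0 < 1 / (r - p) := by positivity
  rcases le_total |t| 1 with h | h
  · have := hC₀ t (abs_le.1 h)
    rw [Real.norm_eq_abs] at this
    nlinarith
  · have ht : 0 < |t| := by linarith
    have e : |logSource p t| = |t| ^ (p - 1) * |Real.log |t| - 1| := by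
      rw [logSource, abs_mul, abs_of_nonneg (Real.rpow_nonneg (abs_nonneg t) _),
        show t * Real.log t - t = t * (Real.log |t| - 1) by rw [Real.log_abs]; ring, abs_mul,
        ← mul_assoc, ← Real.rpow_add_one ht.ne']
      ring_nf
    have h2 : |Real.log |t| - 1| ≤ |t| ^ (r - p) / (r - p) + 1 := by
      have := Real.log_le_rpow_div (abs_nonneg t) hrp
      have := Real.log_nonneg h
      rw [abs_le]
      constructor <;> linarith
    have h3 : |t| ^ (p - 1) * |t| ^ (r - p) = |t| ^ (r - 1) := by
      rw [← Real.rpow_add ht]; ring_nf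
    have h4 : |t| ^ (p - 1) ≤ |t| ^ (r - 1) := Real.rpow_le_rpow_of_exponent_le h (by linarith)
    calc |logSource p t| ≤ |t| ^ (p - 1) * (|t| ^ (r - p) / (r - p) + 1) := by
          rw [e]; gcongr
      _ = 1 / (r - p) * |t| ^ (r - 1) + |t| ^ (p - 1) := by rw [← h3]; ring
      _ ≤ (1 / (r - p) + 1) * |t| ^ (r - 1) := by linarith
      _ ≤ _ := by nlinarith

/-- Clamping does not increase the modulus, so the constant of `logSource` serves every truncation
level; all estimates uniform in n rest on this. -/
theorem abs_truncSource_le {p r C : ℝ} (hr : 1 ≤ r) (hC : 0 ≤ C)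
    (h : ∀ t, |logSource p t| ≤ C * (1 + |t| ^ (r - 1))) (n : ℕ) (t : ℝ) :
    |truncSource p n t| ≤ C * (1 + |t| ^ (r - 1)) := by
  refine (h _).trans ?_
  have := Real.rpow_le_rpow (abs_nonneg _) (abs_clamp_le n t) (by linarith : 0 ≤ r - 1)
  gcongr

theorem exists_abs_truncSource_le {p : ℝ} (hp : 2 ≤ p) (n : ℕ) :
    ∃ C, ∀ t, |truncSource p n t| ≤ C := by
  obtain ⟨C, hC⟩ := (isCompact_Icc (a := (-n : ℝ)) (b := n)).exists_bound_of_continuousOn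
    (continuous_logSource hp).continuousOn
  refine ⟨C, fun t => hC _ ⟨le_max_left _ _, max_le ?_ (min_le_left _ _)⟩⟩
  linarith [(Nat.cast_nonneg n : (0 : ℝ) ≤ n)]

theorem abs_integral_le_of_growth {f : ℝ → ℝ} {r C : ℝ} (hr : 1 ≤ r) (hC : 0 ≤ C)
    (h : ∀ t, |f t| ≤ C * (1 + |t| ^ (r - 1))) (t : ℝ) :
    |∫ x in (0)..t, f x| ≤ 2 * C * (1 + |t| ^ r) := by
  have h1 : ‖∫ x in (0)..t, f x‖ ≤ C * (1 + |t| ^ (r - 1)) * |t - 0| := by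
    refine intervalIntegral.norm_integral_le_of_norm_le_const fun x hx => (h x).trans ?_
    have hx' : |x| ≤ |t| := by
      rcases le_total 0 t with h0 | h0
      · rw [uIoc_of_le h0] at hx
        rw [abs_of_pos hx.1, abs_of_nonneg h0]; exact hx.2
      · rw [uIoc_of_ge h0] at hx
        rw [abs_of_nonpos hx.2, abs_of_nonpos h0]; linarith [hx.1]
    have := Real.rpow_le_rpow (abs_nonneg _) hx' (by linarith : 0 ≤ r - 1)
    gcongr
  rw [Real.norm_eq_abs, sub_zero] at h1
  refine h1.trans ?_
  have h0 : 0 ≤ |t| ^ r := Real.rpow_nonneg (abs_nonneg t) _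
  have h2 : |t| ^ (r - 1) * |t| = |t| ^ r := by
    rcases eq_or_lt_of_le (abs_nonneg t) with h3 | h3
    · rw [← h3, mul_zero, Real.zero_rpow (by linarith)]
    · rw [← Real.rpow_add_one h3.ne']; ring_nf
  have h4 : |t| ≤ 1 + |t| ^ r := by
    rcases le_total |t| 1 with h5 | h5
    · linarith
    · have := Real.rpow_le_rpow_of_exponent_le h5 hr
      rw [Real.rpow_one] at this
      linarith
  calc C * (1 + |t| ^ (r - 1)) * |t| = C * (|t| + |t| ^ r) := by rw [← h2]; ring
    _ ≤ C * (2 * (1 + |t| ^ r)) := by gcongr; linarith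
    _ = _ := by ring

theorem continuous_truncPotential {p : ℝ} (hp : 2 ≤ p) (n : ℕ) :
    Continuous (truncPotential p n) :=
  intervalIntegral.continuous_primitive
    (fun _ _ => (continuous_truncSource hp n).intervalIntegrable _ _) 0

theorem continuous_logPotential {p : ℝ} (hp : 2 ≤ p) : Continuous (logPotential p) :=
  intervalIntegral.continuous_primitive
    (fun _ _ => (continuous_logSource hp).intervalIntegrable _ _) 0

theorem truncPotential_of_abs_le (p : ℝ) {n : ℕ} {t : ℝ} (h : |t| ≤ n) :
    truncPotential p n t = logPotential p t := by
  refine intervalIntegral.integral_congr fun x hx => truncSource_of_abs_le p (le_trans ?_ h)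
  rcases le_total 0 t with h0 | h0
  · rw [uIcc_of_le h0] at hx
    rw [abs_of_nonneg hx.1, abs_of_nonneg h0]; exact hx.2
  · rw [uIcc_of_ge h0] at hx
    rw [abs_of_nonpos hx.2, abs_of_nonpos h0]; linarith [hx.1]

/-- A convergent sequence is bounded, so truncation at levels tending to infinity is eventually
inactive along it. -/
theorem eventually_abs_le_natCast {a : ℕ → ℝ} {b : ℝ} (ha : Filter.Tendsto a Filter.atTop (𝓝 b))
    {n : ℕ → ℕ} (hn : Filter.Tendsto n Filter.atTop Filter.atTop) :
    ∀ᶠ k in Filter.atTop, |a k| ≤ n k := by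
  have h1 := ha.abs.eventually_le_const (lt_add_one |b|)
  have h2 := (tendsto_natCast_atTop_atTop (R := ℝ)).comp hn |>.eventually_ge_atTop (|b| + 1)
  filter_upwards [h1, h2] with k hk1 hk2 using hk1.trans hk2

theorem tendsto_truncSource {p : ℝ} (hp : 2 ≤ p) {a : ℕ → ℝ} {b : ℝ}
    (ha : Filter.Tendsto a Filter.atTop (𝓝 b)) {n : ℕ → ℕ}
    (hn : Filter.Tendsto n Filter.atTop Filter.atTop) :
    Filter.Tendsto (fun k => truncSource p (n k) (a k)) Filter.atTop (𝓝 (logSource p b)) := by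
  refine (((continuous_logSource hp).tendsto b).comp ha).congr' ?_
  filter_upwards [eventually_abs_le_natCast ha hn] with k hk
  exact (truncSource_of_abs_le p hk).symm

theorem tendsto_truncPotential {p : ℝ} (hp : 2 ≤ p) {a : ℕ → ℝ} {b : ℝ}
    (ha : Filter.Tendsto a Filter.atTop (𝓝 b)) {n : ℕ → ℕ}
    (hn : Filter.Tendsto n Filter.atTop Filter.atTop) :
    Filter.Tendsto (fun k => truncPotential p (n k) (a k)) Filter.atTop
      (𝓝 (logPotential p b)) := by
  refine (((continuous_logPotential hp).tendsto b).comp ha).congr' ?_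
  filter_upwards [eventually_abs_le_natCast ha hn] with k hk
  exact (truncPotential_of_abs_le p hk).symm

theorem hasDerivAt_logSource {p t : ℝ} (ht : 0 < t) :
    HasDerivAt (logSource p) (t ^ (p - 2) * ((p - 1) * (Real.log t - 1) + 1)) t := by
  have h1 : HasDerivAt (fun x : ℝ => x ^ (p - 2) * (x * Real.log x - x))
      ((p - 2) * t ^ (p - 2 - 1) * (t * Real.log t - t)
        + t ^ (p - 2) * (1 * Real.log t + t * t⁻¹ - 1)) t :=
    (Real.hasDerivAt_rpow_const (Or.inl ht.ne')).mul
      (((hasDerivAt_id t).mul (Real.hasDerivAt_log ht.ne')).sub (hasDerivAt_id t))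
  have h2 : logSource p =ᶠ[𝓝 t] fun x : ℝ => x ^ (p - 2) * (x * Real.log x - x) := by
    filter_upwards [lt_mem_nhds ht] with x hx
    rw [logSource, abs_of_pos hx]
  refine (h1.congr_of_eventuallyEq h2).congr_deriv ?_
  rw [Real.rpow_sub_one ht.ne' (p - 2)]
  field_simp
  ring

/-- On (0, n) the derivative of `logSource` is bounded above; it need not be bounded below, since
for p = 2 it is log t. Hence only a one-sided estimate. Oddness carries it to [-n, 0], the point 0
joins the two halves, and the clamp is monotone and 1-Lipschitz. -/
theorem exists_truncSource_sub_le {p : ℝ} (hp : 2 ≤ p) (n : ℕ) :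
    ∃ L, 0 < L ∧ ∀ a b, a ≤ b → truncSource p n b - truncSource p n a ≤ L * (b - a) := by
  -- An upper bound of the derivative on (0, n), from log t ≤ t ≤ n; the last `+ 1` makes L positive
  -- even for n = 0.
  set L : ℝ := (n : ℝ) ^ (p - 2) * ((p - 1) * n + 1) + 1 with hL
  have hn : (0 : ℝ) ≤ n := n.cast_nonneg
  have hL0 : 0 < L := by
    have : 0 ≤ (n : ℝ) ^ (p - 2) := Real.rpow_nonneg hn _
    have : 0 ≤ (p - 1) * n := mul_nonneg (by linarith) hn
    positivity
  have hanti : AntitoneOn (fun t => logSource p t - L * t) (Icc 0 (n : ℝ)) := by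
    refine antitoneOn_of_hasDerivWithinAt_nonpos (convex_Icc _ _)
      (f' := fun t => t ^ (p - 2) * ((p - 1) * (Real.log t - 1) + 1) - L * 1)
      ((continuous_logSource hp).sub (by fun_prop)).continuousOn ?_ ?_
    · intro x hx
      rw [interior_Icc] at hx
      exact ((hasDerivAt_logSource hx.1).sub
        ((hasDerivAt_id x).const_mul L)).hasDerivWithinAt
    · intro x hx
      rw [interior_Icc] at hx
      have h1 : Real.log x ≤ n := (Real.log_le_self hx.1.le).trans hx.2.le
      have h2 : x ^ (p - 2) ≤ (n : ℝ) ^ (p - 2) :=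
        Real.rpow_le_rpow hx.1.le hx.2.le (by linarith)
      have h3 : 0 ≤ x ^ (p - 2) := Real.rpow_nonneg hx.1.le _
      have h4 : (p - 1) * (Real.log x - 1) + 1 ≤ (p - 1) * n + 1 := by
        have : (p - 1) * (Real.log x - 1) ≤ (p - 1) * n :=
          mul_le_mul_of_nonneg_left (by linarith) (by linarith)
        linarith
      have h5 : 0 ≤ (p - 1) * (n : ℝ) + 1 := by
        have : 0 ≤ (p - 1) * n := mul_nonneg (by linarith) hn
        linarith
      have h6 := (mul_le_mul_of_nonneg_left h4 h3).trans (mul_le_mul_of_nonneg_right h2 h5)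
      linarith
  have hpos : ∀ a b : ℝ, 0 ≤ a → a ≤ b → b ≤ n → logSource p b - logSource p a ≤ L * (b - a) := by
    intro a b ha hab hb
    have := hanti ⟨ha, hab.trans hb⟩ ⟨ha.trans hab, hb⟩ hab
    simp only at this
    linarith
  have hneg : ∀ a b : ℝ, -n ≤ a → a ≤ b → b ≤ 0 → logSource p b - logSource p a ≤ L * (b - a) := by
    intro a b ha hab hb
    have := hpos (-b) (-a) (by linarith) (by linarith) (by linarith)
    rw [logSource_neg, logSource_neg] at this
    linarith
  have hall : ∀ a b : ℝ, -n ≤ a → a ≤ b → b ≤ n →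
      logSource p b - logSource p a ≤ L * (b - a) := by
    intro a b ha hab hb
    rcases le_total 0 a with h | h
    · exact hpos a b h hab hb
    · rcases le_total b 0 with h' | h'
      · exact hneg a b ha hab h'
      · have h1 := hneg a 0 ha h le_rfl
        have h2 := hpos 0 b le_rfl h' hb
        linarith
  refine ⟨L, hL0, fun a b hab => ?_⟩
  have h1 : min (n : ℝ) a ≤ min (n : ℝ) b := min_le_min_left _ hab
  have h2 : min (n : ℝ) b ≤ min (n : ℝ) a + (b - a) := by
    rcases min_cases (n : ℝ) a with h | h <;> rcases min_cases (n : ℝ) b with h' | h' <;> linarith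
  have h3 : max (-(n : ℝ)) (min (n : ℝ) a) ≤ max (-(n : ℝ)) (min (n : ℝ) b) := max_le_max_left _ h1
  have h4 : max (-(n : ℝ)) (min (n : ℝ) b) - max (-(n : ℝ)) (min (n : ℝ) a) ≤ b - a := by
    rcases max_cases (-(n : ℝ)) (min (n : ℝ) a) with h | h <;>
      rcases max_cases (-(n : ℝ)) (min (n : ℝ) b) with h' | h' <;> linarith
  refine (hall _ _ (le_max_left _ _) h3 (max_le (by linarith) (min_le_left _ _))).trans ?_
  gcongr

/-- The primitive minus L x² / 2 is concave, so it lies below its tangents. For b < a both the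
orientation of the integral and the comparison of the integrands are reversed. -/
theorem integral_le_of_oneSided {f : ℝ → ℝ} (hf : Continuous f) {L : ℝ}
    (h : ∀ a b, a ≤ b → f b - f a ≤ L * (b - a)) (a b : ℝ) :
    (∫ x in (0)..b, f x) ≤ (∫ x in (0)..a, f x) + f a * (b - a) + L / 2 * (b - a) ^ 2 := by
  have hi : ∀ c d, IntervalIntegrable f volume c d := fun c d => hf.intervalIntegrable c d
  have h1 : (∫ x in (0)..b, f x) - ∫ x in (0)..a, f x = ∫ x in a..b, f x :=
    intervalIntegral.integral_interval_sub_left (hi _ _) (hi _ _)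
  have h2 : ∫ x in a..b, (f a + L * (x - a)) = f a * (b - a) + L / 2 * (b - a) ^ 2 := by
    rw [intervalIntegral.integral_add (by simp) (Continuous.intervalIntegrable (by fun_prop) _ _),
      intervalIntegral.integral_const_mul, intervalIntegral.integral_sub (by simp) (by simp)]
    simp
    ring
  have hg : ∀ c d, IntervalIntegrable (fun x => f a + L * (x - a)) volume c d :=
    fun c d => Continuous.intervalIntegrable (by fun_prop) _ _
  have h3 : ∫ x in a..b, f x ≤ ∫ x in a..b, (f a + L * (x - a)) := by
    rcases le_total a b with hab | hab
    · refine intervalIntegral.integral_mono_on hab (hi _ _) (hg _ _) fun x hx => ?_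
      linarith [h a x hx.1]
    · rw [intervalIntegral.integral_symm b a, intervalIntegral.integral_symm b a]
      refine neg_le_neg (intervalIntegral.integral_mono_on hab (hg _ _) (hi _ _) fun x hx => ?_)
      linarith [h x a hx.2]
  linarith

/-- This identifies the primitive with the lower-order integrands of `energy`. -/
theorem logPotential_eq {p : ℝ} (hp : 2 ≤ p) (t : ℝ) :
    logPotential p t = 1 / p * (|t| ^ p * Real.log |t|) - 1 / p ^ 2 * |t| ^ p - 1 / p * |t| ^ p := by
  have hp0 : p ≠ 0 := by linarith
  have hpos : ∀ t, 0 ≤ t → logPotential p t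
      = 1 / p * (t ^ p * Real.log t) - 1 / p ^ 2 * t ^ p - 1 / p * t ^ p := by
    intro t ht
    have h := intervalIntegral.integral_eq_sub_of_hasDerivAt_of_le (f' := logSource p)
      -- The antiderivative is written through `t * log t`, which is continuous at 0; the derivative
      -- is then needed only on the open interval.
      (f := fun t => 1 / p * (t ^ (p - 1) * (t * Real.log t)) - 1 / p ^ 2 * t ^ p - 1 / p * t ^ p)
      ht ?_ ?_ ((continuous_logSource hp).intervalIntegrable _ _)
    · rw [logPotential, h]
      have e : t ^ (p - 1) * (t * Real.log t) = t ^ p * Real.log t := by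
        rcases eq_or_lt_of_le ht with h0 | h0
        · simp [← h0]
        · rw [← mul_assoc, ← Real.rpow_add_one h0.ne']; ring_nf
      simp only [e, Real.zero_rpow hp0]
      simp
    · have h1 : Continuous fun t : ℝ => t ^ (p - 1) :=
        Real.continuous_rpow_const (by linarith)
      have h2 : Continuous fun t : ℝ => t ^ p := Real.continuous_rpow_const (by linarith)
      have h3 := Real.continuous_mul_log
      exact (((continuous_const.mul (h1.mul h3)).sub (continuous_const.mul h2)).sub
        (continuous_const.mul h2)).continuousOn
    · intro x hx
      have hx0 := hx.1.ne'
      have h1 := Real.hasDerivAt_rpow_const (x := x) (p := p - 1) (Or.inl hx0)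
      have h2 := Real.hasDerivAt_rpow_const (x := x) (p := p) (Or.inl hx0)
      have h3 := Real.hasDerivAt_mul_log hx0
      refine ((((h1.mul h3).const_mul (1 / p)).sub (h2.const_mul (1 / p ^ 2))).sub
        (h2.const_mul (1 / p))).congr_deriv ?_
      have e1 : x ^ (p - 1) = x ^ (p - 2) * x := by
        rw [← Real.rpow_add_one hx0]; ring_nf
      have e2 : x ^ (p - 1 - 1) = x ^ (p - 2) := by ring_nf
      rw [logSource, abs_of_pos hx.1, e2, e1]
      field_simp
      ring
  have heven : logPotential p (-t) = logPotential p t := by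
    unfold logPotential
    have := intervalIntegral.integral_comp_neg (a := 0) (b := t) (logSource p)
    simp only [logSource_neg, intervalIntegral.integral_neg, neg_zero] at this
    rw [intervalIntegral.integral_symm, ← this, neg_neg]
  have habs : logPotential p |t| = logPotential p t := by
    rcases abs_choice t with h | h <;> rw [h]
    exact heven
  rw [← habs, hpos _ (abs_nonneg t)]

/-- Absorption of a lower power: beyond some M the factor `ε t^(q-r)` exceeds 1, and below M the
constant `M^r` is enough. -/
theorem rpow_le_eps_mul_rpow_add {r q ε : ℝ} (hr : 0 < r) (hrq : r < q) (hε : 0 < ε) :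
    ∃ C, 0 ≤ C ∧ ∀ t : ℝ, 0 ≤ t → t ^ r ≤ ε * t ^ q + C := by
  obtain ⟨M, hM1, hM⟩ : ∃ M : ℝ, 1 ≤ M ∧ ∀ t, M ≤ t → 1 ≤ ε * t ^ (q - r) := by
    have h := (tendsto_rpow_atTop (by linarith : 0 < q - r)).const_mul_atTop hε
    obtain ⟨M, hM⟩ := Filter.eventually_atTop.1 (h.eventually_ge_atTop 1)
    exact ⟨max M 1, le_max_right _ _, fun t ht => hM t ((le_max_left _ _).trans ht)⟩
  refine ⟨M ^ r, Real.rpow_nonneg (by linarith) _, fun t ht => ?_⟩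
  rcases le_total t M with h | h
  · have := Real.rpow_le_rpow ht h hr.le
    have := mul_nonneg hε.le (Real.rpow_nonneg ht q)
    linarith
  · have ht0 : 0 < t := by linarith
    have e : t ^ q = t ^ (q - r) * t ^ r := by rw [← Real.rpow_add ht0]; ring_nf
    have h1 := mul_le_mul_of_nonneg_right (hM t h) (Real.rpow_nonneg ht r)
    have := Real.rpow_nonneg (by linarith : 0 ≤ M) r
    rw [e]
    linarith

/-! ### Pointwise estimates by the Gagliardo density -/

/-- The inner integral `∫ |f(x) - f(y)|^p / |x - y|^(N + sp) dy` of the Gagliardo seminorm. -/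
def gagDensity {N : ℕ} (s p : ℝ) (f : Space N → ℝ) (x : Space N) : ℝ≥0∞ :=
  ∫⁻ y, ‖fracQuot s p f (x, y)‖ₑ ^ p

/-- The volume of the unit ball. -/
def unitBallVol (N : ℕ) : ℝ := (volume : Measure (Space N)).real (Metric.ball 0 1)

theorem unitBallVol_pos (N : ℕ) : 0 < unitBallVol N :=
  ENNReal.toReal_pos (Metric.measure_ball_pos _ _ one_pos).ne' measure_ball_lt_top.ne

theorem volume_ball_eq {N : ℕ} [NeZero N] (x : Space N) {r : ℝ} (hr : 0 ≤ r) :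
    volume (Metric.ball x r) = ENNReal.ofReal (r ^ N * unitBallVol N) := by
  rw [Measure.addHaar_ball _ _ hr, finrank_euclideanSpace_fin, unitBallVol,
    ENNReal.ofReal_mul (by positivity), ofReal_measureReal measure_ball_lt_top.ne]

theorem enorm_rpow_eq (a : ℝ) {p : ℝ} (hp : 0 ≤ p) : ‖a‖ₑ ^ p = ENNReal.ofReal (|a| ^ p) := by
  rw [Real.enorm_eq_ofReal_abs, ENNReal.ofReal_rpow_of_nonneg (abs_nonneg a) hp]

theorem abs_fracQuot_rpow {N : ℕ} {s p : ℝ} (hp : 0 < p) (f : Space N → ℝ)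
    (z : Space N × Space N) :
    |fracQuot s p f z| ^ p = |f z.1 - f z.2| ^ p / ‖z.1 - z.2‖ ^ ((N : ℝ) + s * p) := by
  rw [fracQuot, abs_div, Real.div_rpow (abs_nonneg _) (abs_nonneg _),
    abs_of_nonneg (Real.rpow_nonneg (norm_nonneg (z.1 - z.2)) _), ← Real.rpow_mul (norm_nonneg _)]
  congr 2
  field_simp

theorem measurable_fracQuot {N : ℕ} (s p : ℝ) {f : Space N → ℝ} (hf : Measurable f) :
    Measurable (fracQuot s p f) := by
  unfold fracQuot
  fun_prop

theorem measurable_gagDensity {N : ℕ} (s p : ℝ) {f : Space N → ℝ} (hf : Measurable f) :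
    Measurable (gagDensity s p f) :=
  Measurable.lintegral_prod_right' (f := fun z => ‖fracQuot s p f z‖ₑ ^ p)
    ((measurable_fracQuot s p hf).enorm.pow_const p)

/-- The gain of integrability of the Gagliardo seminorm: a function with bounded `L²` norm is
pointwise controlled, with exponent larger than `p`, by its Gagliardo density. -/
theorem rpow_le_gagDensity {N : ℕ} [NeZero N] {s p M : ℝ} (hs : 0 < s) (hp : 0 < p) (hM : 0 < M) :
    ∃ C, 0 < C ∧ ∀ f : Space N → ℝ, Measurable f → ∫⁻ y, ‖f y‖ₑ ^ (2 : ℝ) ≤ ENNReal.ofReal (M ^ 2) →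
      ∀ x, ENNReal.ofReal (|f x| ^ (p + 2 * (s * p / N))) ≤ ENNReal.ofReal C * gagDensity s p f x := by
  have hN : (0 : ℝ) < N := Nat.cast_pos.2 (NeZero.pos N)
  set β := unitBallVol N with hb
  have hb0 : 0 < β := unitBallVol_pos N
  -- κ is chosen so that the ball of radius r has volume 8M²/a², twice the Chebyshev bound of the
  -- set where |f| ≥ a/2. At least half of the ball thus consists of points y with |f(x) - f(y)| ≥
  -- a/2.
  set κ : ℝ := 8 * M ^ 2 / β with hκ
  have hκ0 : 0 < κ := by positivity
  refine ⟨2 ^ p * (2 / β) * κ ^ (s * p / N), by positivity, fun f hf hfM x => ?_⟩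
  rcases eq_or_lt_of_le (abs_nonneg (f x)) with ha | ha
  · rw [← ha, Real.zero_rpow (by positivity)]
    simp
  set a := |f x| with hadef
  set r : ℝ := (κ / a ^ 2) ^ (1 / (N : ℝ)) with hr
  have hr0 : 0 < r := by positivity
  have hrN : r ^ (N : ℝ) = κ / a ^ 2 := by
    rw [hr, ← Real.rpow_mul (by positivity), one_div_mul_cancel hN.ne', Real.rpow_one]
  set A : Set (Space N) := {y | ENNReal.ofReal ((a / 2) ^ 2) ≤ ‖f y‖ₑ ^ (2 : ℝ)} with hA
  have hvA : volume A ≤ ENNReal.ofReal (4 * M ^ 2 / a ^ 2) := by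
    have h1 := (mul_meas_ge_le_lintegral (μ := volume) (hf.enorm.pow_const (2 : ℝ))
      (ENNReal.ofReal ((a / 2) ^ 2))).trans hfM
    have h2 : 0 < (a / 2) ^ 2 := by positivity
    rw [mul_comm, ← ENNReal.le_div_iff_mul_le (Or.inl (ENNReal.ofReal_pos.2 h2).ne')
      (Or.inl ENNReal.ofReal_ne_top), ← ENNReal.ofReal_div_of_pos h2] at h1
    refine h1.trans_eq ?_
    congr 1
    field_simp
    norm_num
  have hvB : volume (Metric.ball x r) = ENNReal.ofReal (8 * M ^ 2 / a ^ 2) := by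
    rw [volume_ball_eq x hr0.le, ← Real.rpow_natCast, hrN, ← hb, hκ]
    congr 1
    field_simp
  have hvS : ENNReal.ofReal (4 * M ^ 2 / a ^ 2) ≤ volume (Metric.ball x r \ A) := by
    refine le_trans ?_ le_measure_sdiff
    rw [hvB]
    refine le_trans ?_ (tsub_le_tsub_left hvA _)
    rw [← ENNReal.ofReal_sub _ (by positivity)]
    refine ENNReal.ofReal_le_ofReal (le_of_eq ?_)
    ring
  have hlow : ∀ y ∈ Metric.ball x r \ A,
      ENNReal.ofReal ((a / 2) ^ p / r ^ ((N : ℝ) + s * p)) ≤ ‖fracQuot s p f (x, y)‖ₑ ^ p := by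
    rintro y ⟨hyB, hyA⟩
    have hfy : |f y| < a / 2 := by
      rw [hA, mem_ofPred_eq, not_le, enorm_rpow_eq _ zero_le_two, Real.rpow_two,
        ENNReal.ofReal_lt_ofReal_iff (by positivity)] at hyA
      exact lt_of_pow_lt_pow_left₀ 2 (by positivity) hyA
    have hdiff : a / 2 ≤ |f x - f y| := by
      have := abs_sub_abs_le_abs_sub (f x) (f y)
      linarith
    have hxy : x ≠ y := by
      rintro rfl
      linarith
    have hpos : 0 < ‖x - y‖ := norm_pos_iff.2 (sub_ne_zero.2 hxy)
    have hlt : ‖x - y‖ ≤ r := by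
      rw [Metric.mem_ball', dist_eq_norm] at hyB
      exact hyB.le
    rw [enorm_rpow_eq _ hp.le, abs_fracQuot_rpow hp]
    refine ENNReal.ofReal_le_ofReal ?_
    have h1 : (a / 2) ^ p ≤ |f x - f y| ^ p := Real.rpow_le_rpow (by positivity) hdiff hp.le
    have h2 : ‖x - y‖ ^ ((N : ℝ) + s * p) ≤ r ^ ((N : ℝ) + s * p) :=
      Real.rpow_le_rpow hpos.le hlt (by positivity)
    have h3 : 0 < ‖x - y‖ ^ ((N : ℝ) + s * p) := Real.rpow_pos_of_pos hpos _
    exact div_le_div₀ (Real.rpow_nonneg (abs_nonneg _) _) h1 h3 h2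
  have hD : ENNReal.ofReal ((a / 2) ^ p / r ^ ((N : ℝ) + s * p)) * ENNReal.ofReal (4 * M ^ 2 / a ^ 2)
      ≤ gagDensity s p f x := by
    calc _ ≤ ENNReal.ofReal ((a / 2) ^ p / r ^ ((N : ℝ) + s * p)) * volume (Metric.ball x r \ A) := by
          gcongr
      _ = ∫⁻ _ in Metric.ball x r \ A, ENNReal.ofReal ((a / 2) ^ p / r ^ ((N : ℝ) + s * p)) := by
          rw [setLIntegral_const]
      _ ≤ ∫⁻ y in Metric.ball x r \ A, ‖fracQuot s p f (x, y)‖ₑ ^ p := by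
          refine setLIntegral_mono' (measurableSet_ball.diff ?_) hlow
          exact measurableSet_le measurable_const (hf.enorm.pow_const _)
      _ ≤ _ := setLIntegral_le_lintegral _ _
  refine le_trans ?_ (mul_le_mul_right hD _)
  rw [← ENNReal.ofReal_mul (by positivity), ← ENNReal.ofReal_mul (by positivity)]
  refine ENNReal.ofReal_le_ofReal (le_of_eq ?_)
  -- The radius is of order `a^(-2/N)`, so the factor `r^(-sp)` left over from the kernel supplies
  -- the extra power `a^(2sp/N)`.
  have hrs : r ^ (s * p) = κ ^ (s * p / N) / a ^ (2 * (s * p / N)) := by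
    rw [hr, ← Real.rpow_mul (by positivity), Real.div_rpow hκ0.le (by positivity),
      ← Real.rpow_two, ← Real.rpow_mul ha.le]
    congr 2
    · ring
    · ring
  have h2p : (0 : ℝ) < 2 ^ p := by positivity
  have hkp : 0 < κ ^ (s * p / N) := by positivity
  have hap : 0 < a ^ (2 * (s * p / N)) := by positivity
  have hap' : 0 < a ^ p := by positivity
  rw [Real.rpow_add hr0, hrN, hrs, Real.div_rpow ha.le zero_le_two, Real.rpow_add ha,
    show κ / a ^ 2 = 8 * M ^ 2 / β / a ^ 2 from rfl]
  field_simp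
  norm_num

/-- The average of `f` over the ball of radius `r` around `x`. -/
def ballAvg {N : ℕ} (r : ℝ) (f : Space N → ℝ) (x : Space N) : ℝ :=
  (r ^ N * unitBallVol N)⁻¹ * ∫ y in Metric.ball x r, f y

/-- The elementary bound `t ≤ η + η^(1-p) t^p` is applied to |f(x) - f(y)| and averaged over the
ball, where the kernel is at least `r^(-(N+sp))`; division by the volume leaves the small factor
`r^(sp)`. -/
theorem enorm_sub_ballAvg_le {N : ℕ} [NeZero N] {s p η r : ℝ} (hs : 0 < s) (hp : 1 ≤ p)
    (hη : 0 < η) (hr : 0 < r) {f : Space N → ℝ} (x : Space N)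
    (hf : IntegrableOn f (Metric.ball x r)) :
    ‖f x - ballAvg r f x‖ₑ ≤ ENNReal.ofReal η
      + ENNReal.ofReal (η ^ (1 - p) * r ^ (s * p) / unitBallVol N) * gagDensity s p f x := by
  have hN : (0 : ℝ) < N := Nat.cast_pos.2 (NeZero.pos N)
  have hp0 : 0 < p := by linarith
  set β := unitBallVol N with hb
  have hb0 : 0 < β := unitBallVol_pos N
  set V := r ^ N * β with hV
  have hV0 : 0 < V := by positivity
  have hvB : volume (Metric.ball x r) = ENNReal.ofReal V := volume_ball_eq x hr.le
  have h1 : f x - ballAvg r f x = V⁻¹ * ∫ y in Metric.ball x r, (f x - f y) := by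
    have hc : IntegrableOn (fun _ => f x) (Metric.ball x r) volume :=
      integrableOn_const measure_ball_lt_top.ne
    rw [integral_sub hc hf, setIntegral_const, measureReal_def, hvB,
      ENNReal.toReal_ofReal hV0.le, smul_eq_mul, mul_sub, ← mul_assoc, inv_mul_cancel₀ hV0.ne',
      one_mul]
    rfl
  have hpt : ∀ y ∈ Metric.ball x r, ‖f x - f y‖ₑ ≤ ENNReal.ofReal η
      + ENNReal.ofReal (η ^ (1 - p) * r ^ ((N : ℝ) + s * p)) * ‖fracQuot s p f (x, y)‖ₑ ^ p := by
    intro y hy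
    rw [enorm_rpow_eq _ hp0.le, Real.enorm_eq_ofReal_abs, ← ENNReal.ofReal_mul (by positivity),
      ← ENNReal.ofReal_add hη.le (by positivity), abs_fracQuot_rpow hp0]
    refine ENNReal.ofReal_le_ofReal ?_
    simp only
    rcases eq_or_ne x y with rfl | hxy
    · rw [sub_self, abs_zero]
      positivity
    have hpos : 0 < ‖x - y‖ := norm_pos_iff.2 (sub_ne_zero.2 hxy)
    have hlt : ‖x - y‖ ≤ r := by
      rw [Metric.mem_ball', dist_eq_norm] at hy
      exact hy.le
    have h3 : ‖x - y‖ ^ ((N : ℝ) + s * p) ≤ r ^ ((N : ℝ) + s * p) :=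
      Real.rpow_le_rpow hpos.le hlt (by positivity)
    have h4 : 0 < ‖x - y‖ ^ ((N : ℝ) + s * p) := Real.rpow_pos_of_pos hpos _
    set t := |f x - f y| with ht
    have ht0 : 0 ≤ t := abs_nonneg _
    have h5 : t ^ p ≤ r ^ ((N : ℝ) + s * p) * (t ^ p / ‖x - y‖ ^ ((N : ℝ) + s * p)) := by
      rw [← mul_div_assoc, le_div_iff₀ h4, mul_comm]
      gcongr
    have h6 : t ≤ η + η ^ (1 - p) * t ^ p := by
      rcases le_total t η with h | h
      · have : 0 ≤ η ^ (1 - p) * t ^ p := by positivity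
        linarith
      · have ht1 : 0 < t := by linarith
        have h7 : η ^ (p - 1) ≤ t ^ (p - 1) := Real.rpow_le_rpow hη.le h (by linarith)
        have h8 : t ^ p = t ^ (p - 1) * t := by
          rw [← Real.rpow_add_one ht1.ne']; ring_nf
        have h9 : η ^ (1 - p) = (η ^ (p - 1))⁻¹ := by
          rw [← Real.rpow_neg hη.le]; ring_nf
        have h10 : 0 < η ^ (p - 1) := by positivity
        have h11 : t ≤ (η ^ (p - 1))⁻¹ * (t ^ (p - 1) * t) := by
          rw [← mul_assoc, inv_mul_eq_div]
          exact le_mul_of_one_le_left ht0 ((one_le_div h10).2 h7)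
        rw [h8, h9]
        linarith
    have h7 : 0 ≤ η ^ (1 - p) := by positivity
    calc t ≤ η + η ^ (1 - p) * t ^ p := h6
      _ ≤ _ := by rw [mul_assoc]; gcongr
  have hVinv : ‖V⁻¹‖ₑ = (ENNReal.ofReal V)⁻¹ := by
    rw [Real.enorm_eq_ofReal_abs, abs_of_pos (by positivity), ENNReal.ofReal_inv_of_pos hV0]
  have hVne : ENNReal.ofReal V ≠ 0 := by simpa using hV0
  rw [h1, enorm_mul, hVinv]
  calc (ENNReal.ofReal V)⁻¹ * ‖∫ y in Metric.ball x r, (f x - f y)‖ₑ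
      ≤ (ENNReal.ofReal V)⁻¹ * ∫⁻ y in Metric.ball x r, ‖f x - f y‖ₑ := by
        gcongr
        exact enorm_integral_le_lintegral_enorm _
    _ ≤ (ENNReal.ofReal V)⁻¹ * ∫⁻ y in Metric.ball x r, (ENNReal.ofReal η
        + ENNReal.ofReal (η ^ (1 - p) * r ^ ((N : ℝ) + s * p)) * ‖fracQuot s p f (x, y)‖ₑ ^ p) := by
        exact mul_le_mul_right (setLIntegral_mono' measurableSet_ball hpt) _
    _ = (ENNReal.ofReal V)⁻¹ * (ENNReal.ofReal η * ENNReal.ofReal V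
        + ENNReal.ofReal (η ^ (1 - p) * r ^ ((N : ℝ) + s * p))
          * ∫⁻ y in Metric.ball x r, ‖fracQuot s p f (x, y)‖ₑ ^ p) := by
        rw [lintegral_add_left measurable_const, setLIntegral_const, hvB,
          lintegral_const_mul' _ _ ENNReal.ofReal_ne_top]
    _ ≤ (ENNReal.ofReal V)⁻¹ * (ENNReal.ofReal η * ENNReal.ofReal V
        + ENNReal.ofReal (η ^ (1 - p) * r ^ ((N : ℝ) + s * p)) * gagDensity s p f x) := by
        gcongr
        exact setLIntegral_le_lintegral _ _
    _ = ENNReal.ofReal η + ENNReal.ofReal (η ^ (1 - p) * r ^ (s * p) / β) * gagDensity s p f x := by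
        rw [mul_add, mul_comm (ENNReal.ofReal η), ← mul_assoc, ← mul_assoc,
          ENNReal.inv_mul_cancel hVne ENNReal.ofReal_ne_top, one_mul,
          ← ENNReal.ofReal_inv_of_pos hV0, ← ENNReal.ofReal_mul (by positivity)]
        congr 3
        rw [hV, Real.rpow_add hr, Real.rpow_natCast]
        field_simp

/-- Bounded sequences of a separable Hilbert space have weakly convergent subsequences. -/
theorem exists_subseq_tendsto_inner {H : Type*} [NormedAddCommGroup H] [InnerProductSpace ℝ H]
    [CompleteSpace H] [TopologicalSpace.SeparableSpace H] {x : ℕ → H} {C : ℝ}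
    (hx : ∀ k, ‖x k‖ ≤ C) :
    ∃ (y : H) (φ : ℕ → ℕ), StrictMono φ ∧
      ∀ z, Filter.Tendsto (fun k => inner ℝ (x (φ k)) z) Filter.atTop (𝓝 (inner ℝ y z)) := by
  obtain ⟨L, -, φ, hφ, hL⟩ := WeakDual.isSeqCompact_closedBall ℝ H 0 C
    (x := fun k => WeakDual.toStrongDual.symm (InnerProductSpace.toDual ℝ H (x k)))
    (fun k => by simpa using hx k)
  refine ⟨(InnerProductSpace.toDual ℝ H).symm (WeakDual.toStrongDual L), φ, hφ, fun z => ?_⟩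
  have h := ((WeakDual.eval_continuous z).tendsto L).comp hL
  rw [InnerProductSpace.toDual_symm_apply]
  exact h

/-! ### Integrability, closed balls and measurability in `W0` -/

/-- The exponent to which functions of `W_0^{s,p}(Ω)` are integrable. -/
def sobExp (N : ℕ) (s p : ℝ) : ℝ := p + 2 * (s * p / N)

theorem lt_sobExp {N : ℕ} [NeZero N] {s p : ℝ} (hs : 0 < s) (hp : 0 < p) : p < sobExp N s p := by
  have hN : (0 : ℝ) < N := Nat.cast_pos.2 (NeZero.pos N)
  have : 0 < 2 * (s * p / N) := by positivity
  unfold sobExp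
  linarith

theorem lintegral_gagDensity {N : ℕ} {s p : ℝ} (hp : 0 < p) {f : Space N → ℝ} (hf : Measurable f) :
    ∫⁻ x, gagDensity s p f x
      = eLpNorm (fracQuot s p f) (ENNReal.ofReal p) (volume.prod volume) ^ p := by
  have hp0 : ENNReal.ofReal p ≠ 0 := by simpa using hp
  rw [eLpNorm_eq_lintegral_rpow_enorm_toReal hp0 ENNReal.ofReal_ne_top, ENNReal.toReal_ofReal hp.le,
    ← ENNReal.rpow_mul, one_div_mul_cancel hp.ne', ENNReal.rpow_one,
    lintegral_prod _ ((measurable_fracQuot s p hf).enorm.pow_const p).aemeasurable]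
  rfl

namespace W0

variable {N : ℕ} {Ω : BoundedLipschitzDomain N} {s p : ℝ}

instance isFiniteMeasure_restrict (Ω : BoundedLipschitzDomain N) :
    IsFiniteMeasure ((volume : Measure (Space N)).restrict Ω.carrier) :=
  ⟨by simpa using Ω.isBounded.measure_lt_top⟩

theorem measurable_coe (u : W0 Ω s p) : Measurable (u : Space N → ℝ) :=
  (Lp.stronglyMeasurable (toLp Ω s p u)).measurable

theorem coe_add (u v : W0 Ω s p) : ((u + v : W0 Ω s p) : Space N → ℝ) =ᵐ[volume] u + v :=
  Lp.coeFn_add (toLp Ω s p u) (toLp Ω s p v)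

theorem coe_sub (u v : W0 Ω s p) : ((u - v : W0 Ω s p) : Space N → ℝ) =ᵐ[volume] u - v := by
  rw [map_sub]
  exact Lp.coeFn_sub (toLp Ω s p u) (toLp Ω s p v)

theorem coe_smul (c : ℝ) (u : W0 Ω s p) : ((c • u : W0 Ω s p) : Space N → ℝ) =ᵐ[volume] c • u :=
  Lp.coeFn_smul c (toLp Ω s p u)

theorem ext_ae {u v : W0 Ω s p} (h : (u : Space N → ℝ) =ᵐ[volume] v) : u = v :=
  Subtype.ext (Lp.ext h)

theorem setLIntegral_eq_lintegral (u : W0 Ω s p) {F : ℝ → ℝ≥0∞} (hF : F 0 = 0) :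
    ∫⁻ x in Ω.carrier, F (u x) = ∫⁻ x, F (u x) := by
  rw [← lintegral_indicator Ω.isOpen.measurableSet]
  refine lintegral_congr_ae ?_
  filter_upwards [ae_eq_zero Ω s p u] with x hx
  by_cases h : x ∈ Ω.carrier
  · rw [indicator_of_mem h]
  · rw [indicator_of_notMem h, hx h, hF]

variable [hp2 : Fact (2 ≤ p)]

theorem coe_toL2 (u : W0 Ω s p) : (u.toL2 : Space N → ℝ) =ᵐ[volume.restrict Ω.carrier] u :=
  MemLp.coeFn_toLp (memLp_two Ω s p u)

theorem toL2_add (u v : W0 Ω s p) : (u + v).toL2 = u.toL2 + v.toL2 := by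
  refine Lp.ext ?_
  filter_upwards [coe_toL2 (u + v), coe_toL2 u, coe_toL2 v, Lp.coeFn_add u.toL2 v.toL2,
    ae_restrict_of_ae (coe_add u v)] with x h1 h2 h3 h4 h5
  rw [h1, h4, h5, Pi.add_apply, Pi.add_apply, h2, h3]

theorem toL2_smul (c : ℝ) (u : W0 Ω s p) : (c • u).toL2 = c • u.toL2 := by
  refine Lp.ext ?_
  filter_upwards [coe_toL2 (c • u), coe_toL2 u, Lp.coeFn_smul c u.toL2,
    ae_restrict_of_ae (coe_smul c u)] with x h1 h2 h4 h5
  rw [h1, h4, h5, Pi.smul_apply, Pi.smul_apply, h2]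

theorem toL2_sub (u v : W0 Ω s p) : (u - v).toL2 = u.toL2 - v.toL2 := by
  rw [sub_eq_add_neg, ← neg_one_smul ℝ v, toL2_add, toL2_smul, neg_one_smul, sub_eq_add_neg]

theorem toL2_injective : Function.Injective (toL2 : W0 Ω s p → L2 Ω) := by
  intro u v h
  have h1 : (u : Space N → ℝ) =ᵐ[volume.restrict Ω.carrier] v :=
    (coe_toL2 u).symm.trans (h ▸ coe_toL2 v)
  refine ext_ae ?_
  filter_upwards [(ae_restrict_iff' Ω.isOpen.measurableSet).1 h1, ae_eq_zero Ω s p u,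
    ae_eq_zero Ω s p v] with x h1 h2 h3
  by_cases hx : x ∈ Ω.carrier
  · exact h1 hx
  · rw [h2 hx, h3 hx]

theorem norm_sq_toL2 (u : W0 Ω s p) : ‖u.toL2‖ ^ 2 = ∫ x in Ω.carrier, u x ^ 2 := by
  rw [← real_inner_self_eq_norm_sq, L2.inner_def]
  refine integral_congr_ae ?_
  filter_upwards [coe_toL2 u] with x hx
  rw [hx, real_inner_self_eq_norm_sq, Real.norm_eq_abs, sq_abs]

theorem integrable_sq (u : W0 Ω s p) :
    Integrable (fun x => u x ^ 2) (volume.restrict Ω.carrier) :=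
  (memLp_two Ω s p u).integrable_sq

theorem lintegral_rpow_two_restrict (u : W0 Ω s p) :
    ∫⁻ x in Ω.carrier, ‖u x‖ₑ ^ (2 : ℝ) = ENNReal.ofReal (‖u.toL2‖ ^ 2) := by
  rw [norm_sq_toL2, ofReal_integral_eq_lintegral_ofReal (integrable_sq u)
    (Filter.Eventually.of_forall fun x => sq_nonneg _)]
  refine lintegral_congr fun x => ?_
  rw [enorm_rpow_eq _ zero_le_two, Real.rpow_two, sq_abs]

theorem lintegral_rpow_two (u : W0 Ω s p) :
    ∫⁻ x, ‖u x‖ₑ ^ (2 : ℝ) = ENNReal.ofReal (‖u.toL2‖ ^ 2) := by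
  rw [← lintegral_rpow_two_restrict]
  exact (setLIntegral_eq_lintegral u (F := fun t => ‖t‖ₑ ^ (2 : ℝ)) (by simp)).symm

theorem integrable_toL2 (u : W0 Ω s p) : Integrable (u : Space N → ℝ) (volume.restrict Ω.carrier) :=
  (memLp_two Ω s p u).integrable (by norm_num)

theorem integrable_coe (u : W0 Ω s p) : Integrable (u : Space N → ℝ) := by
  refine ((integrable_indicator_iff Ω.isOpen.measurableSet).2 (integrable_toL2 u)).congr ?_
  filter_upwards [ae_eq_zero Ω s p u] with x hx
  by_cases h : x ∈ Ω.carrier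
  · rw [indicator_of_mem h]
  · rw [indicator_of_notMem h, hx h]

variable [NeZero N]

theorem eLpNorm_fracQuot (u : W0 Ω s p) :
    eLpNorm (fracQuot s p u) (ENNReal.ofReal p) (volume.prod volume) = ENNReal.ofReal ‖u‖ := by
  have h : ‖u‖ = ‖(memLp_fracQuot Ω s p u).toLp _‖ := rfl
  rw [h, Lp.norm_toLp, ENNReal.ofReal_toReal (memLp_fracQuot Ω s p u).2.ne]

theorem lintegral_gagDensity_coe (u : W0 Ω s p) :
    ∫⁻ x, gagDensity s p u x = ENNReal.ofReal (‖u‖ ^ p) := by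
  have := hp2.out
  rw [lintegral_gagDensity (by linarith) (measurable_coe u), eLpNorm_fracQuot,
    ENNReal.ofReal_rpow_of_nonneg (norm_nonneg _) (by linarith)]

/-- The constructor by which limits of sequences re-enter `W0` with a bound of the norm. -/
theorem exists_of_eLpNorm_le {f : Space N → ℝ} (hf : MemLp f (ENNReal.ofReal p) volume)
    (hf0 : ∀ᵐ x ∂(volume : Measure (Space N)), x ∉ Ω.carrier → f x = 0) {c : ℝ} (hc : 0 ≤ c)
    (hfm : Measurable f)
    (h : eLpNorm (fracQuot s p f) (ENNReal.ofReal p) (volume.prod volume) ≤ ENNReal.ofReal c) :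
    ∃ v : W0 Ω s p, (v : Space N → ℝ) =ᵐ[volume] f ∧ ‖v‖ ≤ c := by
  have hcongr := fracQuot_congr s p hf.coeFn_toLp
  have hm : MemLp (fracQuot s p f) (ENNReal.ofReal p) (volume.prod volume) :=
    ⟨(measurable_fracQuot s p hfm).aestronglyMeasurable, h.trans_lt ENNReal.ofReal_lt_top⟩
  have hz : ∀ᵐ x ∂(volume : Measure (Space N)), x ∉ Ω.carrier → hf.toLp f x = 0 := by
    filter_upwards [hf.coeFn_toLp, hf0] with x h1 h2 h3
    rw [h1, h2 h3]
  let v : W0 Ω s p := ⟨hf.toLp f, (memLp_congr_ae hcongr).2 hm, hz⟩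
  refine ⟨v, hf.coeFn_toLp, ?_⟩
  rw [← ENNReal.ofReal_le_ofReal_iff hc, ← eLpNorm_fracQuot]
  exact (eLpNorm_congr_ae hcongr).trans_le h

/-- A bound in `L^q(Ω)` with `q > p`, for functions bounded in `L²(Ω)`. -/
theorem exists_integral_rpow_sobExp_le (Ω : BoundedLipschitzDomain N) (hs : 0 < s) (M : ℝ) :
    ∃ C, 0 < C ∧ ∀ u : W0 Ω s p, ‖u.toL2‖ ≤ M →
      Integrable (fun x => |u x| ^ sobExp N s p) (volume.restrict Ω.carrier) ∧
      ∫ x in Ω.carrier, |u x| ^ sobExp N s p ≤ C * ‖u‖ ^ p := by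
  have hp := hp2.out
  have hq : 0 < sobExp N s p := (by linarith : 0 < p).trans (lt_sobExp hs (by linarith))
  obtain ⟨C, hC0, hC⟩ := rpow_le_gagDensity (N := N) (s := s) (p := p) (M := |M| + 1) hs
    (by linarith) (by positivity)
  refine ⟨C, hC0, fun u hu => ?_⟩
  have h1 : ∫⁻ x in Ω.carrier, ENNReal.ofReal (|u x| ^ sobExp N s p) ≤ ENNReal.ofReal (C * ‖u‖ ^ p) := by
    rw [ENNReal.ofReal_mul hC0.le, ← lintegral_gagDensity_coe,
      ← lintegral_const_mul _ (measurable_gagDensity s p (measurable_coe u))]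
    refine (setLIntegral_le_lintegral _ _).trans (lintegral_mono ?_)
    refine hC u (measurable_coe u) ?_
    rw [lintegral_rpow_two]
    have : ‖u.toL2‖ ≤ |M| + 1 := hu.trans ((le_abs_self M).trans (by linarith))
    exact ENNReal.ofReal_le_ofReal (pow_le_pow_left₀ (norm_nonneg _) this 2)
  have hmeas : Measurable fun x => |u x| ^ sobExp N s p := by
    have := measurable_coe u
    exact (continuous_abs.measurable.comp this).pow_const _
  have hnn : ∀ x, 0 ≤ |u x| ^ sobExp N s p := fun x => Real.rpow_nonneg (abs_nonneg _) _
  have hint : Integrable (fun x => |u x| ^ sobExp N s p) (volume.restrict Ω.carrier) :=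
    ⟨hmeas.aestronglyMeasurable, (hasFiniteIntegral_iff_ofReal
      (Filter.Eventually.of_forall hnn)).2 (h1.trans_lt ENNReal.ofReal_lt_top)⟩
  refine ⟨hint, ?_⟩
  rw [← ENNReal.ofReal_le_ofReal_iff (by positivity),
    ofReal_integral_eq_lintegral_ofReal hint (Filter.Eventually.of_forall hnn)]
  exact h1

/-- Closed balls of `W_0^{s,p}(Ω)` are sequentially closed for the `L²` convergence. -/
theorem exists_norm_le_of_tendsto (hs : 0 < s) {v : ℕ → W0 Ω s p} {c : ℝ} (hv : ∀ k, ‖v k‖ ≤ c)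
    {w : L2 Ω} (hw : Filter.Tendsto (fun k => (v k).toL2) Filter.atTop (𝓝 w)) :
    ∃ u : W0 Ω s p, u.toL2 = w ∧ ‖u‖ ≤ c := by
  have hp := hp2.out
  have hc : 0 ≤ c := (norm_nonneg _).trans (hv 0)
  have hΩ := Ω.isOpen.measurableSet
  obtain ⟨ns, -, hns⟩ := (tendstoInMeasure_of_tendsto_Lp hw).exists_seq_tendsto_ae
  set f : Space N → ℝ := Ω.carrier.indicator w with hf
  have hfm : Measurable f := (Lp.stronglyMeasurable w).measurable.indicator hΩ
  have hfw : f =ᵐ[volume.restrict Ω.carrier] w := by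
    filter_upwards [ae_restrict_mem hΩ] with x hx
    rw [hf, indicator_of_mem hx]
  have hconv : ∀ᵐ x ∂(volume : Measure (Space N)),
      Filter.Tendsto (fun k => v (ns k) x) Filter.atTop (𝓝 (f x)) := by
    have h1 : ∀ᵐ x ∂(volume.restrict Ω.carrier),
        Filter.Tendsto (fun k => v (ns k) x) Filter.atTop (𝓝 (f x)) := by
      filter_upwards [hns, hfw, ae_all_iff.2 fun k => coe_toL2 (v (ns k))] with x h1 h2 h3
      rw [h2]
      exact h1.congr h3
    filter_upwards [(ae_restrict_iff' hΩ).1 h1,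
      ae_all_iff.2 fun k => ae_eq_zero Ω s p (v (ns k))] with x h1 h2
    by_cases hx : x ∈ Ω.carrier
    · exact h1 hx
    · rw [hf, indicator_of_notMem hx]
      exact tendsto_const_nhds.congr fun k => (h2 k hx).symm
  have hconv2 : ∀ᵐ z ∂((volume : Measure (Space N)).prod (volume : Measure (Space N))),
      Filter.Tendsto (fun k => fracQuot s p (v (ns k)) z) Filter.atTop (𝓝 (fracQuot s p f z)) := by
    have h1 := Measure.quasiMeasurePreserving_fst (μ := (volume : Measure (Space N)))
      (ν := (volume : Measure (Space N))) |>.ae hconv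
    have h2 := Measure.quasiMeasurePreserving_snd (μ := (volume : Measure (Space N)))
      (ν := (volume : Measure (Space N))) |>.ae hconv
    filter_upwards [h1, h2] with z hz1 hz2
    exact (hz1.sub hz2).div_const _
  -- Fatou's lemma for the difference quotients, along a subsequence converging almost everywhere.
  have hfq : eLpNorm (fracQuot s p f) (ENNReal.ofReal p) (volume.prod volume)
      ≤ ENNReal.ofReal c := by
    refine (Lp.eLpNorm_lim_le_liminf_eLpNorm
      (fun k => (measurable_fracQuot s p (measurable_coe (v (ns k)))).aestronglyMeasurable)
      _ hconv2).trans ?_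
    refine Filter.liminf_le_of_le (by isBoundedDefault) fun b hb => ?_
    obtain ⟨k, hk⟩ := hb.exists
    refine hk.trans ?_
    rw [eLpNorm_fracQuot]
    exact ENNReal.ofReal_le_ofReal (hv _)
  have hf2 : ∫⁻ x, ‖f x‖ₑ ^ (2 : ℝ) = ENNReal.ofReal (‖w‖ ^ 2) := by
    have e : (fun x => ‖f x‖ₑ ^ (2 : ℝ)) = Ω.carrier.indicator fun x => ‖w x‖ₑ ^ (2 : ℝ) := by
      ext x
      by_cases hx : x ∈ Ω.carrier <;> simp [hf, hx]
    rw [e, lintegral_indicator hΩ, ← real_inner_self_eq_norm_sq, L2.inner_def,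
      ofReal_integral_eq_lintegral_ofReal]
    · refine lintegral_congr fun x => ?_
      rw [enorm_rpow_eq _ zero_le_two, Real.rpow_two, real_inner_self_eq_norm_sq, Real.norm_eq_abs]
    · exact L2.integrable_inner w w
    · exact Filter.Eventually.of_forall fun x => real_inner_self_nonneg
  have hq : 0 < sobExp N s p := (by linarith : 0 < p).trans (lt_sobExp hs (by linarith))
  -- Membership of the limit in L^p does not come from L² convergence, since p may exceed 2; the
  -- gain of integrability supplies it. The `+ 1` keeps the parameter positive when w = 0.
  obtain ⟨C, hC0, hC⟩ := rpow_le_gagDensity (N := N) (s := s) (p := p) (M := ‖w‖ + 1) hs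
    (by linarith) (by positivity)
  have hfLq : MemLp f (ENNReal.ofReal (sobExp N s p)) (volume.restrict Ω.carrier) := by
    refine ⟨hfm.aestronglyMeasurable, ?_⟩
    rw [eLpNorm_lt_top_iff_lintegral_rpow_enorm_lt_top (by simpa using hq) ENNReal.ofReal_ne_top,
      ENNReal.toReal_ofReal hq.le]
    calc ∫⁻ x in Ω.carrier, ‖f x‖ₑ ^ sobExp N s p
        ≤ ∫⁻ x, ENNReal.ofReal C * gagDensity s p f x := by
          refine (setLIntegral_le_lintegral _ _).trans (lintegral_mono fun x => ?_)
          rw [enorm_rpow_eq _ hq.le]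
          refine hC f hfm ?_ x
          rw [hf2]
          exact ENNReal.ofReal_le_ofReal (by gcongr; linarith)
      _ = ENNReal.ofReal C * eLpNorm (fracQuot s p f) (ENNReal.ofReal p) (volume.prod volume) ^ p := by
          rw [lintegral_const_mul _ (measurable_gagDensity s p hfm),
            lintegral_gagDensity (by linarith) hfm]
      _ < ⊤ := ENNReal.mul_lt_top ENNReal.ofReal_lt_top
          (ENNReal.rpow_lt_top_of_nonneg (by linarith) (hfq.trans_lt ENNReal.ofReal_lt_top).ne)
  have hfLp : MemLp f (ENNReal.ofReal p) volume := by
    have := hfLq.mono_exponent (ENNReal.ofReal_le_ofReal (lt_sobExp (N := N) hs (by linarith : 0 < p)).le)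
    have h2 := (memLp_indicator_iff_restrict hΩ).2 this
    rwa [hf, indicator_indicator, inter_self] at h2
  obtain ⟨u, hu, huc⟩ := exists_of_eLpNorm_le (Ω := Ω) hfLp
    (Filter.Eventually.of_forall fun x hx => by rw [hf, indicator_of_notMem hx]) hc hfm hfq
  refine ⟨u, Lp.ext ?_, huc⟩
  have hu' : (u : Space N → ℝ) =ᵐ[volume.restrict Ω.carrier] f := ae_restrict_of_ae hu
  exact (coe_toL2 u).trans (hu'.trans hfw)

/-- Lower semicontinuity of the norm: otherwise a subsequence would stay in the closed ball of
radius c, and so would its L² limit. -/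
theorem eventually_lt_norm (hs : 0 < s) {v : ℕ → W0 Ω s p} {u : W0 Ω s p}
    (hv : Filter.Tendsto (fun k => (v k).toL2) Filter.atTop (𝓝 u.toL2)) {c : ℝ} (hc : c < ‖u‖) :
    ∀ᶠ k in Filter.atTop, c < ‖v k‖ := by
  by_contra h
  obtain ⟨φ, hφ, hφ'⟩ := Filter.extraction_of_frequently_atTop (Filter.not_eventually.1 h)
  obtain ⟨u', hu', hc'⟩ := exists_norm_le_of_tendsto hs (fun k => not_lt.1 (hφ' k))
    (hv.comp hφ.tendsto_atTop)
  rw [toL2_injective hu'] at hc'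
  exact absurd hc (not_lt.2 hc')

/-- `quot` is an isometry into a separable L^p space. -/
instance : SecondCountableTopology (W0 Ω s p) := by
  have h : Isometry (quot Ω s p) := AddMonoidHomClass.isometry_of_norm _ fun _ => rfl
  have : Fact (ENNReal.ofReal p ≠ ⊤) := ⟨ENNReal.ofReal_ne_top⟩
  have : IsSeparable ((volume : Measure (Space N)).prod (volume : Measure (Space N))) :=
    isSeparable_of_sigmaFinite _
  exact h.isUniformInducing.isInducing.secondCountableTopology

theorem isClosed_image_toL2_closedBall (hs : 0 < s) (a : W0 Ω s p) (r : ℝ) :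
    IsClosed (toL2 '' Metric.closedBall a r : Set (L2 Ω)) := by
  refine IsSeqClosed.isClosed fun x w hx hw => ?_
  choose v hv hvx using hx
  obtain ⟨u, hu, hur⟩ := exists_norm_le_of_tendsto hs (v := fun k => v k - a) (c := r)
    (w := w - a.toL2) (fun k => by simpa [dist_eq_norm] using hv k)
    (by simpa only [toL2_sub, hvx] using hw.sub_const a.toL2)
  refine ⟨u + a, ?_, ?_⟩
  · simpa [dist_eq_norm] using hur
  · rw [toL2_add, hu, sub_add_cancel]

/-- Membership in L^∞(0, T; W0) requires strong measurability for the Gagliardo norm, while limits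
are taken in L². Closed balls of `W0` are preimages of L²-closed sets, and separability makes every
open set a countable union of closed balls. -/
theorem stronglyMeasurable_of_toL2 {α : Type*} [MeasurableSpace α] (hs : 0 < s)
    {u : α → W0 Ω s p} (hu : StronglyMeasurable fun t => (u t).toL2) : StronglyMeasurable u := by
  borelize (W0 Ω s p)
  let _ : MeasurableSpace (L2 Ω) := borel _
  have : BorelSpace (L2 Ω) := ⟨rfl⟩
  refine Measurable.stronglyMeasurable (measurable_of_isOpen fun U hU => ?_)
  have hball : ∀ a r, MeasurableSet (u ⁻¹' Metric.closedBall a r) := by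
    intro a r
    have : u ⁻¹' Metric.closedBall a r
        = (fun t => (u t).toL2) ⁻¹' (toL2 '' Metric.closedBall a r) := by
      ext t
      simp only [mem_preimage, mem_image]
      exact ⟨fun h => ⟨_, h, rfl⟩, fun ⟨v, hv, hvt⟩ => toL2_injective hvt ▸ hv⟩
    rw [this]
    exact hu.measurable (isClosed_image_toL2_closedBall hs a r).measurableSet
  obtain ⟨D, hDc, hD⟩ := TopologicalSpace.exists_countable_dense (W0 Ω s p)
  have hU' : U = ⋃ a ∈ D, ⋃ n : ℕ, ⋃ (_ : Metric.closedBall a (1 / ((n : ℝ) + 1)) ⊆ U),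
      Metric.closedBall a (1 / ((n : ℝ) + 1)) := by
    ext x
    simp only [mem_iUnion, exists_prop]
    refine ⟨fun hx => ?_, fun ⟨a, _, n, h, hx⟩ => h hx⟩
    obtain ⟨ε, hε, hεU⟩ := Metric.isOpen_iff.1 hU x hx
    obtain ⟨n, hn⟩ := exists_nat_one_div_lt (half_pos hε)
    obtain ⟨a, haD, ha⟩ := hD.exists_dist_lt x (ε := 1 / ((n : ℝ) + 1)) (by positivity)
    refine ⟨a, haD, n, fun y hy => hεU ?_, ha.le⟩
    rw [Metric.mem_closedBall] at hy
    rw [Metric.mem_ball]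
    have := dist_triangle_right y x a
    linarith
  rw [hU', preimage_iUnion₂]
  refine MeasurableSet.biUnion hDc fun a _ => ?_
  rw [preimage_iUnion]
  refine MeasurableSet.iUnion fun n => ?_
  rw [preimage_iUnion]
  exact MeasurableSet.iUnion fun _ => hball _ _

end W0

/-! ### Averages on balls and the compact embedding in L² -/

theorem measurable_ballAvg {N : ℕ} (r : ℝ) {f : Space N → ℝ} (hf : Measurable f) :
    Measurable (ballAvg r f) := by
  have h : StronglyMeasurable fun z : Space N × Space N =>
      {z : Space N × Space N | dist z.2 z.1 < r}.indicator (fun z => f z.2) z :=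
    ((hf.comp measurable_snd).indicator
      (measurableSet_lt (measurable_snd.dist measurable_fst) measurable_const)).stronglyMeasurable
  have h2 := (h.integral_prod_right' (ν := (volume : Measure (Space N)))).measurable
  have e : ballAvg r f = fun x => (r ^ N * unitBallVol N)⁻¹ * ∫ y,
      {z : Space N × Space N | dist z.2 z.1 < r}.indicator (fun z => f z.2) (x, y) := by
    ext x
    rw [ballAvg, ← integral_indicator measurableSet_ball]
    rfl
  rw [e]
  exact h2.const_mul _

namespace W0

variable {N : ℕ} {Ω : BoundedLipschitzDomain N} {s p : ℝ} [hp2 : Fact (2 ≤ p)]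

/-- Each average is an L² inner product with a fixed function, so weak convergence gives pointwise
convergence of averages. -/
theorem setIntegral_eq_inner (u : W0 Ω s p) {B : Set (Space N)} (hB : MeasurableSet B) :
    ∫ y in B, u y = inner ℝ (indicatorConstLp 2 (μ := volume.restrict Ω.carrier) hB
      (measure_ne_top _ _) (1 : ℝ)) u.toL2 := by
  have hΩ := Ω.isOpen.measurableSet
  rw [L2.inner_indicatorConstLp_one, Measure.restrict_restrict hB]
  have h1 : ∫ y in B ∩ Ω.carrier, u.toL2 y = ∫ y in B ∩ Ω.carrier, u y := by
    refine integral_congr_ae (ae_restrict_of_ae_restrict_of_subset inter_subset_right ?_)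
    exact coe_toL2 u
  rw [h1]
  refine setIntegral_eq_of_subset_of_ae_sdiff_eq_zero hB.nullMeasurableSet inter_subset_left ?_
  filter_upwards [ae_eq_zero Ω s p u] with x hx hxB
  exact hx fun h => hxB.2 ⟨hxB.1, h⟩

/-- The weak `L²` convergence of a sequence gives the strong `L¹` convergence of its averages. -/
theorem tendsto_lintegral_ballAvg_sub {v : ℕ → W0 Ω s p} {w : L2 Ω} {M : ℝ}
    (hM : ∀ k, ‖(v k).toL2‖ ≤ M)
    (hv : ∀ z, Filter.Tendsto (fun k => inner ℝ (v k).toL2 z) Filter.atTop (𝓝 (inner ℝ w z)))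
    {r : ℝ} (hr : 0 < r) :
    ∃ c : Space N → ℝ, Measurable c ∧
      Filter.Tendsto (fun k => ∫⁻ x in Ω.carrier, ‖ballAvg r (v k) x - c x‖ₑ) Filter.atTop (𝓝 0) := by
  have hM0 : 0 ≤ M := (norm_nonneg _).trans (hM 0)
  set a : ℝ := (r ^ N * unitBallVol N)⁻¹ with ha
  have ha0 : 0 < a := by
    have := unitBallVol_pos N
    positivity
  let χ : Space N → L2 Ω := fun x => indicatorConstLp 2 (μ := volume.restrict Ω.carrier)
      (measurableSet_ball (x := x) (ε := r)) (measure_ne_top _ _) (1 : ℝ)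
  have hE : ∀ k x, ballAvg r (v k) x = a * inner ℝ (χ x) (v k).toL2 := fun k x => by
    rw [ballAvg, setIntegral_eq_inner _ measurableSet_ball]
  have hlim : ∀ x, Filter.Tendsto (fun k => ballAvg r (v k) x) Filter.atTop
      (𝓝 (a * inner ℝ (χ x) w)) := by
    intro x
    simp only [hE, real_inner_comm]
    exact (hv (χ x)).const_mul a
  have hcm : Measurable fun x => a * inner ℝ (χ x) w :=
    measurable_of_tendsto_metrizable (fun k => measurable_ballAvg r (measurable_coe (v k)))
      (tendsto_pi_nhds.2 hlim)
  refine ⟨fun x => a * inner ℝ (χ x) w, hcm, ?_⟩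
  have hχ : ∀ x, ‖χ x‖ ≤ Real.sqrt ((volume.restrict Ω.carrier).real univ) := by
    intro x
    rw [norm_indicatorConstLp (by norm_num) (by norm_num), norm_one, one_mul, ENNReal.toReal_ofNat,
      ← Real.sqrt_eq_rpow]
    exact Real.sqrt_le_sqrt (measureReal_mono (subset_univ _) (measure_ne_top _ _))
  set B := a * (Real.sqrt ((volume.restrict Ω.carrier).real univ) * M) with hB
  have hbd : ∀ k x, ‖ballAvg r (v k) x‖ ≤ B := by
    intro k x
    rw [hE, norm_mul, Real.norm_of_nonneg ha0.le]
    refine mul_le_mul_of_nonneg_left ((norm_inner_le_norm _ _).trans ?_) ha0.le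
    exact mul_le_mul (hχ x) (hM k) (norm_nonneg _) (Real.sqrt_nonneg _)
  have h := tendsto_lintegral_of_dominated_convergence (μ := volume.restrict Ω.carrier)
    (F := fun k x => ‖ballAvg r (v k) x - a * inner ℝ (χ x) w‖ₑ) (f := fun _ => 0)
    (fun _ => ENNReal.ofReal (B + B))
    (fun k => ((measurable_ballAvg r (measurable_coe (v k))).sub hcm).enorm) ?_ ?_ ?_
  · simpa using h
  · refine fun k => Filter.Eventually.of_forall fun x => ?_
    simp only [← ofReal_norm]
    refine ENNReal.ofReal_le_ofReal ((norm_sub_le _ _).trans (add_le_add (hbd k x) ?_))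
    exact le_of_tendsto (hlim x).norm (Filter.Eventually.of_forall fun k => hbd k x)
  · rw [lintegral_const]
    exact ENNReal.mul_ne_top ENNReal.ofReal_ne_top (measure_ne_top _ _)
  · refine Filter.Eventually.of_forall fun x => ?_
    have := ((hlim x).sub_const (a * inner ℝ (χ x) w)).enorm
    simpa using this

variable [NeZero N]

/-- Balls of `W_0^{s,p}(Ω)` are uniformly close in `L¹` to their averages on small balls. -/
theorem exists_radius_lintegral_sub_ballAvg_le (Ω : BoundedLipschitzDomain N) (hs : 0 < s) (R : ℝ)
    {ε : ℝ} (hε : 0 < ε) :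
    ∃ r, 0 < r ∧ ∀ u : W0 Ω s p, ‖u‖ ≤ R →
      ∫⁻ x in Ω.carrier, ‖u x - ballAvg r u x‖ₑ ≤ ENNReal.ofReal ε := by
  have hp := hp2.out
  have hβ := unitBallVol_pos N
  set m := (volume.restrict Ω.carrier).real univ with hm
  have hm0 : 0 ≤ m := measureReal_nonneg
  set η := ε / 2 / (m + 1) with hη
  have hη0 : 0 < η := by positivity
  -- η is fixed before r: it handles the constant term, and the density term vanishes with `r^(sp)`.
  have hT : Filter.Tendsto (fun r : ℝ => η ^ (1 - p) * r ^ (s * p) / unitBallVol N * |R| ^ p)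
      (𝓝[>] 0) (𝓝 (η ^ (1 - p) * 0 ^ (s * p) / unitBallVol N * |R| ^ p)) := by
    have h1 : Filter.Tendsto (fun r : ℝ => r ^ (s * p)) (𝓝[>] 0) (𝓝 (0 ^ (s * p))) :=
      ((Real.continuousAt_rpow_const 0 (s * p) (Or.inr (by positivity))).tendsto).mono_left
        nhdsWithin_le_nhds
    exact ((h1.const_mul _).div_const _).mul_const _
  rw [Real.zero_rpow (by positivity), mul_zero, zero_div, zero_mul] at hT
  obtain ⟨r, hr, hr0⟩ := ((hT.eventually_le_const (half_pos hε)).and self_mem_nhdsWithin).exists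
  have hr0 : 0 < r := hr0
  refine ⟨r, hr0, fun u hu => ?_⟩
  have hRp : ‖u‖ ^ p ≤ |R| ^ p :=
    Real.rpow_le_rpow (norm_nonneg _) (hu.trans (le_abs_self R)) (by linarith)
  set κ := η ^ (1 - p) * r ^ (s * p) / unitBallVol N with hκ
  have hκ0 : 0 ≤ κ := by positivity
  calc ∫⁻ x in Ω.carrier, ‖u x - ballAvg r u x‖ₑ
      ≤ ∫⁻ x in Ω.carrier, (ENNReal.ofReal η + ENNReal.ofReal κ * gagDensity s p u x) :=
        lintegral_mono fun x => enorm_sub_ballAvg_le hs (by linarith) hη0 hr0 x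
          (integrable_coe u).integrableOn
    _ = ENNReal.ofReal η * ENNReal.ofReal m
        + ENNReal.ofReal κ * ∫⁻ x in Ω.carrier, gagDensity s p u x := by
        rw [lintegral_add_left measurable_const, lintegral_const,
          lintegral_const_mul _ (measurable_gagDensity s p (measurable_coe u)), hm,
          ofReal_measureReal]
    _ ≤ ENNReal.ofReal η * ENNReal.ofReal m + ENNReal.ofReal κ * ENNReal.ofReal (|R| ^ p) := by
        refine add_le_add le_rfl (mul_le_mul_right ?_ _)
        refine (setLIntegral_le_lintegral _ _).trans ?_
        rw [lintegral_gagDensity_coe]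
        exact ENNReal.ofReal_le_ofReal hRp
    _ = ENNReal.ofReal (η * m + κ * |R| ^ p) := by
        rw [ENNReal.ofReal_add (by positivity) (by positivity), ENNReal.ofReal_mul hη0.le,
          ENNReal.ofReal_mul hκ0]
    _ ≤ ENNReal.ofReal ε := by
        refine ENNReal.ofReal_le_ofReal ?_
        have : η * m ≤ ε / 2 := by
          rw [hη, div_mul_eq_mul_div, div_le_iff₀ (by positivity)]
          nlinarith
        linarith

/-- On balls of `W_0^{s,p}(Ω)` and `L²(Ω)`, the `L²` norm is controlled by the `L¹` norm. -/
theorem exists_norm_sq_toL2_le (Ω : BoundedLipschitzDomain N) (hs : 0 < s) (M R : ℝ) {ε : ℝ}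
    (hε : 0 < ε) :
    ∃ C, 0 ≤ C ∧ ∀ u : W0 Ω s p, ‖u.toL2‖ ≤ M → ‖u‖ ≤ R →
      ‖u.toL2‖ ^ 2 ≤ ε + C * ∫ x in Ω.carrier, |u x| := by
  have hp := hp2.out
  obtain ⟨A, hA0, hA⟩ := exists_integral_rpow_sobExp_le (p := p) Ω hs M
  have hq : p < sobExp N s p := lt_sobExp hs (by linarith)
  set q := sobExp N s p
  set ε' := ε / (A * |R| ^ p + 1) with hε'
  have hpos : 0 < A * |R| ^ p + 1 := by positivity
  have hε'0 : 0 < ε' := by positivity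
  -- Multiplied by t, the absorption `t ≤ ε' t^(q-1) + C` becomes `t² ≤ ε' t^q + C t`, which
  -- interpolates L² between L¹ and L^q.
  obtain ⟨C, hC0, hC⟩ := rpow_le_eps_mul_rpow_add (r := 1) (q := q - 1) one_pos (by linarith) hε'0
  refine ⟨C, hC0, fun u hu huR => ?_⟩
  obtain ⟨hi, hAu⟩ := hA u hu
  have hRp : ‖u‖ ^ p ≤ |R| ^ p :=
    Real.rpow_le_rpow (norm_nonneg _) (huR.trans (le_abs_self R)) (by linarith)
  have hpt : ∀ x, u x ^ 2 ≤ ε' * |u x| ^ q + C * |u x| := by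
    intro x
    have h1 := hC |u x| (abs_nonneg _)
    rw [Real.rpow_one] at h1
    have h2 := mul_le_mul_of_nonneg_right h1 (abs_nonneg (u x))
    have h3 : |u x| ^ (q - 1) * |u x| = |u x| ^ q := by
      rcases eq_or_lt_of_le (abs_nonneg (u x)) with h | h
      · rw [← h, mul_zero, Real.zero_rpow (by linarith)]
      · rw [← Real.rpow_add_one h.ne']; ring_nf
    rw [← sq_abs, sq]
    calc _ ≤ _ := h2
      _ = _ := by rw [add_mul, mul_assoc, h3]
  have hia : Integrable (fun x => |u x|) (volume.restrict Ω.carrier) := (integrable_toL2 u).abs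
  calc ‖u.toL2‖ ^ 2 = ∫ x in Ω.carrier, u x ^ 2 := norm_sq_toL2 u
    _ ≤ ∫ x in Ω.carrier, (ε' * |u x| ^ q + C * |u x|) :=
        integral_mono (integrable_sq u) ((hi.const_mul _).add (hia.const_mul _)) hpt
    _ = ε' * (∫ x in Ω.carrier, |u x| ^ q) + C * ∫ x in Ω.carrier, |u x| := by
        rw [integral_add (hi.const_mul _) (hia.const_mul _), integral_const_mul, integral_const_mul]
    _ ≤ ε + C * ∫ x in Ω.carrier, |u x| := by
        refine add_le_add ?_ le_rfl
        calc ε' * (∫ x in Ω.carrier, |u x| ^ q) ≤ ε' * (A * |R| ^ p + 1) := by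
              refine mul_le_mul_of_nonneg_left ?_ hε'0.le
              have := mul_le_mul_of_nonneg_left hRp hA0.le
              linarith
          _ = ε := div_mul_cancel₀ _ hpos.ne'

/-- The compactness of the embedding of `W_0^{s,p}(Ω)` in `L²(Ω)`, on `L²`-bounded sets. -/
theorem exists_subseq_tendsto_toL2 (hs : 0 < s) {v : ℕ → W0 Ω s p} {M R : ℝ}
    (hM : ∀ k, ‖(v k).toL2‖ ≤ M) (hR : ∀ k, ‖v k‖ ≤ R) :
    ∃ (w : L2 Ω) (φ : ℕ → ℕ), StrictMono φ ∧
      Filter.Tendsto (fun k => (v (φ k)).toL2) Filter.atTop (𝓝 w) := by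
  have : Fact ((2 : ℝ≥0∞) ≠ ⊤) := ⟨by simp⟩
  obtain ⟨w, φ, hφ, hw⟩ := exists_subseq_tendsto_inner hM
  suffices hC : CauchySeq fun k => (v (φ k)).toL2 by
    obtain ⟨w', hw'⟩ := cauchySeq_tendsto_of_complete hC
    exact ⟨w', φ, hφ, hw'⟩
  -- Cauchy in L¹: each function is compared with its average, and each average with the common
  -- limit c, at a cost of ε/4 for each of the four terms.
  have hL1 : ∀ ε > 0, ∃ K, ∀ k ≥ K, ∀ l ≥ K,
      ∫ x in Ω.carrier, |(v (φ k) - v (φ l)) x| ≤ ε := by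
    intro ε hε
    obtain ⟨r, hr, hrad⟩ := exists_radius_lintegral_sub_ballAvg_le (p := p) Ω hs R
      (by positivity : 0 < ε / 4)
    obtain ⟨c, hcm, hc⟩ := tendsto_lintegral_ballAvg_sub (v := fun k => v (φ k))
      (fun k => hM (φ k)) hw hr
    obtain ⟨K, hK⟩ := Filter.eventually_atTop.1
      (hc.eventually_le_const (ENNReal.ofReal_pos.2 (by positivity : 0 < ε / 4)))
    refine ⟨K, fun k hk l hl => ?_⟩
    have hmc := fun k => measurable_coe (v (φ k))
    have hma := fun k => measurable_ballAvg r (hmc k)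
    rw [← ENNReal.ofReal_le_ofReal_iff hε.le, ofReal_integral_eq_lintegral_ofReal
      (integrable_toL2 _).abs (Filter.Eventually.of_forall fun x => abs_nonneg _)]
    calc ∫⁻ x in Ω.carrier, ENNReal.ofReal |(v (φ k) - v (φ l)) x|
        = ∫⁻ x in Ω.carrier, ‖v (φ k) x - v (φ l) x‖ₑ := by
          refine lintegral_congr_ae ?_
          filter_upwards [ae_restrict_of_ae (coe_sub (v (φ k)) (v (φ l)))] with x hx
          rw [hx, Pi.sub_apply, Real.enorm_eq_ofReal_abs]
      _ ≤ ∫⁻ x in Ω.carrier, ((‖v (φ k) x - ballAvg r (v (φ k)) x‖ₑ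
            + ‖ballAvg r (v (φ k)) x - c x‖ₑ)
          + (‖v (φ l) x - ballAvg r (v (φ l)) x‖ₑ + ‖ballAvg r (v (φ l)) x - c x‖ₑ)) := by
          refine lintegral_mono fun x => ?_
          calc ‖v (φ k) x - v (φ l) x‖ₑ = ‖((v (φ k) x - ballAvg r (v (φ k)) x)
              + (ballAvg r (v (φ k)) x - c x))
              - ((v (φ l) x - ballAvg r (v (φ l)) x) + (ballAvg r (v (φ l)) x - c x))‖ₑ := by
                congr 1; ring
            _ ≤ _ := (enorm_sub_le).trans (add_le_add (enorm_add_le _ _) (enorm_add_le _ _))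
      _ = (∫⁻ x in Ω.carrier, ‖v (φ k) x - ballAvg r (v (φ k)) x‖ₑ)
          + (∫⁻ x in Ω.carrier, ‖ballAvg r (v (φ k)) x - c x‖ₑ)
          + ((∫⁻ x in Ω.carrier, ‖v (φ l) x - ballAvg r (v (φ l)) x‖ₑ)
          + ∫⁻ x in Ω.carrier, ‖ballAvg r (v (φ l)) x - c x‖ₑ) := by
          have h1 : ∀ k, Measurable fun x => ‖v (φ k) x - ballAvg r (v (φ k)) x‖ₑ :=
            fun k => ((hmc k).sub (hma k)).enorm
          have h2 : ∀ k, Measurable fun x => ‖ballAvg r (v (φ k)) x - c x‖ₑ :=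
            fun k => ((hma k).sub hcm).enorm
          refine (lintegral_add_left ((h1 k).add (h2 k)) _).trans ?_
          rw [← lintegral_add_left (h1 k), ← lintegral_add_left (h1 l)]
          rfl
      _ ≤ ENNReal.ofReal (ε / 4) + ENNReal.ofReal (ε / 4)
          + (ENNReal.ofReal (ε / 4) + ENNReal.ofReal (ε / 4)) :=
          add_le_add (add_le_add (hrad _ (hR _)) (hK k hk))
            (add_le_add (hrad _ (hR _)) (hK l hl))
      _ = ENNReal.ofReal ε := by
          rw [← ENNReal.ofReal_add (by positivity) (by positivity),
            ← ENNReal.ofReal_add (by positivity) (by positivity)]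
          congr 1; ring
  rw [Metric.cauchySeq_iff]
  intro ε hε
  -- Interpolation applied to differences, whose norms are at most M + M and R + R.
  obtain ⟨C, hC0, hC⟩ := exists_norm_sq_toL2_le (p := p) Ω hs (M + M) (R + R)
    (by positivity : 0 < ε ^ 2 / 4)
  obtain ⟨K, hK⟩ := hL1 (ε ^ 2 / 4 / (C + 1)) (by positivity)
  refine ⟨K, fun k hk l hl => ?_⟩
  have h1 := hC (v (φ k) - v (φ l))
    (by rw [toL2_sub]; exact (norm_sub_le _ _).trans (add_le_add (hM _) (hM _)))
    ((norm_sub_le _ _).trans (add_le_add (hR _) (hR _)))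
  have h2 := hK k hk l hl
  rw [dist_eq_norm, ← toL2_sub]
  refine lt_of_pow_lt_pow_left₀ 2 hε.le (h1.trans_lt ?_)
  have h3 : C * (ε ^ 2 / 4 / (C + 1)) ≤ ε ^ 2 / 4 := by
    rw [mul_div_assoc', div_le_iff₀ (by positivity)]
    nlinarith [sq_nonneg ε]
  have h4 := mul_le_mul_of_nonneg_left h2 hC0
  have : 0 < ε ^ 2 := by positivity
  linarith

theorem isCompact_image_toL2 (hs : 0 < s) (M R : ℝ) :
    IsCompact (toL2 '' {v : W0 Ω s p | ‖v.toL2‖ ≤ M ∧ ‖v‖ ≤ R} : Set (L2 Ω)) := by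
  refine IsSeqCompact.isCompact fun x hx => ?_
  choose v hv hvx using hx
  obtain ⟨w, φ, hφ, hw⟩ := exists_subseq_tendsto_toL2 hs (fun k => (hv k).1) (fun k => (hv k).2)
  obtain ⟨u, rfl, huR⟩ := exists_norm_le_of_tendsto hs (fun k => (hv (φ k)).2) hw
  refine ⟨_, ⟨u, ⟨?_, huR⟩, rfl⟩, φ, hφ, ?_⟩
  · exact le_of_tendsto hw.norm (Filter.Eventually.of_forall fun k => (hv (φ k)).1)
  · exact hw.congr fun k => hvx (φ k)

end W0

/-! ### Convergence of integrals of subcritical growth -/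

/-- Vitali's convergence theorem for sequences bounded in `L^θ`, `θ > 1`, on a finite measure
space. -/
theorem tendsto_integral_of_rpow_le {α : Type*} [MeasurableSpace α] {μ : Measure α}
    [IsFiniteMeasure μ] {θ C : ℝ} (hθ : 1 < θ) {f h : ℕ → α → ℝ} {g : α → ℝ}
    (hf : ∀ k, AEStronglyMeasurable (f k) μ) (hh : ∀ k, Integrable (h k) μ)
    (hhC : ∀ k, ∫ x, h k x ∂μ ≤ C) (hfh : ∀ k, ∀ᵐ x ∂μ, |f k x| ^ θ ≤ h k x)
    (hfg : ∀ᵐ x ∂μ, Filter.Tendsto (fun k => f k x) Filter.atTop (𝓝 (g x))) :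
    Filter.Tendsto (fun k => ∫ x, f k x ∂μ) Filter.atTop (𝓝 (∫ x, g x ∂μ)) := by
  have hh0 : ∀ k, 0 ≤ᵐ[μ] h k := fun k => by
    filter_upwards [hfh k] with x hx using (Real.rpow_nonneg (abs_nonneg _) _).trans hx
  have hC0 : 0 ≤ C := (integral_nonneg_of_ae (hh0 0)).trans (hhC 0)
  have hfi : ∀ k, Integrable (f k) μ := fun k => by
    refine Integrable.mono' ((integrable_const 1).add (hh k)) (hf k) ?_
    filter_upwards [hfh k, hh0 k] with x hx hx0
    rw [Pi.add_apply, Real.norm_eq_abs]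
    have h0 : (0 : ℝ) ≤ h k x := hx0
    rcases le_total |f k x| 1 with h1 | h1
    · linarith
    · have := Real.rpow_le_rpow_of_exponent_le h1 hθ.le
      rw [Real.rpow_one] at this
      linarith
  have hgm : AEStronglyMeasurable g μ := aestronglyMeasurable_of_tendsto_ae Filter.atTop hf hfg
  have hgi : MemLp g 1 μ := by
    refine ⟨hgm, ?_⟩
    refine (Lp.eLpNorm_lim_le_liminf_eLpNorm hf g hfg).trans_lt ?_
    refine lt_of_le_of_lt (b := ENNReal.ofReal (μ.real univ + C)) ?_ ENNReal.ofReal_lt_top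
    refine Filter.liminf_le_of_le (by isBoundedDefault) fun b hb => ?_
    obtain ⟨k, hk⟩ := hb.exists
    refine hk.trans ?_
    have h2 : Integrable (fun x => 1 + h k x) μ := (integrable_const 1).add (hh k)
    rw [eLpNorm_one_eq_lintegral_enorm]
    calc ∫⁻ x, ‖f k x‖ₑ ∂μ ≤ ∫⁻ x, ENNReal.ofReal (1 + h k x) ∂μ := by
          refine lintegral_mono_ae ?_
          filter_upwards [hfh k, hh0 k] with x hx hx0
          rw [Real.enorm_eq_ofReal_abs]
          refine ENNReal.ofReal_le_ofReal ?_
          have h0 : (0 : ℝ) ≤ h k x := hx0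
          rcases le_total |f k x| 1 with h1 | h1
          · linarith
          · have := Real.rpow_le_rpow_of_exponent_le h1 hθ.le
            rw [Real.rpow_one] at this
            linarith
      _ = ENNReal.ofReal (∫ x, (1 + h k x) ∂μ) := by
          rw [ofReal_integral_eq_lintegral_ofReal h2]
          filter_upwards [hh0 k] with x hx0
          have h0 : (0 : ℝ) ≤ h k x := hx0
          simp only [Pi.zero_apply]
          linarith
      _ ≤ ENNReal.ofReal (μ.real univ + C) := by
          refine ENNReal.ofReal_le_ofReal ?_
          rw [integral_add (integrable_const 1) (hh k)]
          simpa using hhC k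
  have hui : UnifIntegrable f 1 μ := by
    refine unifIntegrable_of le_rfl (by simp) hf fun ε hε => ?_
    -- On the set where |f_k| ≥ c one has `|f_k| ≤ c^(1-θ) |f_k|^θ`, so the tails are uniformly
    -- small because θ > 1.
    obtain ⟨c, hc1, hc⟩ : ∃ c : ℝ, 1 ≤ c ∧ c ^ (1 - θ) * C ≤ ε := by
      have hT : Filter.Tendsto (fun c : ℝ => c ^ (-(θ - 1)) * C) Filter.atTop (𝓝 (0 * C)) :=
        (tendsto_rpow_neg_atTop (by linarith : 0 < θ - 1)).mul_const C
      rw [zero_mul] at hT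
      obtain ⟨c, hc, hc1⟩ := ((hT.eventually_le_const hε).and (Filter.eventually_ge_atTop 1)).exists
      exact ⟨c, hc1, by rwa [neg_sub] at hc⟩
    refine ⟨c.toNNReal, fun k => ?_⟩
    rw [eLpNorm_one_eq_lintegral_enorm]
    have hc0 : 0 < c := by linarith
    calc ∫⁻ x, ‖{x | c.toNNReal ≤ ‖f k x‖₊}.indicator (f k) x‖ₑ ∂μ
        ≤ ∫⁻ x, ENNReal.ofReal (c ^ (1 - θ) * h k x) ∂μ := by
          refine lintegral_mono_ae ?_
          filter_upwards [hfh k, hh0 k] with x hx hx0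
          by_cases hxc : x ∈ {x | c.toNNReal ≤ ‖f k x‖₊}
          · rw [indicator_of_mem hxc, Real.enorm_eq_ofReal_abs]
            refine ENNReal.ofReal_le_ofReal ?_
            have h1 : c ≤ |f k x| := by
              have h2 : c.toNNReal ≤ ‖f k x‖₊ := hxc
              rw [Real.toNNReal_le_iff_le_coe, coe_nnnorm, Real.norm_eq_abs] at h2
              exact h2
            have h3 : 0 < |f k x| := hc0.trans_le h1
            have h4 : |f k x| = |f k x| ^ (1 - θ) * |f k x| ^ θ := by
              rw [← Real.rpow_add h3]; simp
            have h5 : |f k x| ^ (1 - θ) ≤ c ^ (1 - θ) :=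
              Real.rpow_le_rpow_of_nonpos hc0 h1 (by linarith)
            rw [h4]
            exact mul_le_mul h5 hx (by positivity) (by positivity)
          · rw [indicator_of_notMem hxc]
            simp
      _ = ENNReal.ofReal (c ^ (1 - θ) * ∫ x, h k x ∂μ) := by
          rw [← integral_const_mul, ofReal_integral_eq_lintegral_ofReal ((hh k).const_mul _)]
          filter_upwards [hh0 k] with x hx0
          exact mul_nonneg (by positivity) hx0
      _ ≤ ENNReal.ofReal ε := by
          refine ENNReal.ofReal_le_ofReal (le_trans ?_ hc)
          have := hhC k
          gcongr
  have h1 := tendsto_Lp_finite_of_tendsto_ae le_rfl (by simp) hf hgi hui hfg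
  exact tendsto_integral_of_L1' g (memLp_one_iff_integrable.1 hgi).1
    (Filter.Eventually.of_forall hfi) h1

theorem rpow_growth_le {D θ r x a b : ℝ} (hD : 0 ≤ D) (hθ : 0 ≤ θ)
    (hx : |x| ≤ D * (1 + |a| ^ r + |b| ^ r)) :
    |x| ^ θ ≤ (3 * D) ^ θ * (1 + |a| ^ (r * θ) + |b| ^ (r * θ)) := by
  have ha : 0 ≤ |a| ^ r := Real.rpow_nonneg (abs_nonneg a) r
  have hb : 0 ≤ |b| ^ r := Real.rpow_nonneg (abs_nonneg b) r
  have h1 : ∀ y z : ℝ, 0 ≤ y → 0 ≤ z → (1 + y + z) ^ θ ≤ 3 ^ θ * (1 + y ^ θ + z ^ θ) := by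
    intro y z hy hz
    have hy' := Real.rpow_nonneg hy θ
    have hz' := Real.rpow_nonneg hz θ
    have h3 : (0 : ℝ) ≤ 3 ^ θ := by positivity
    have key : ∀ w : ℝ, 0 ≤ w → 1 + y + z ≤ 3 * w → w ^ θ ≤ 1 + y ^ θ + z ^ θ →
        (1 + y + z) ^ θ ≤ 3 ^ θ * (1 + y ^ θ + z ^ θ) := by
      intro w hw h4 h5
      calc (1 + y + z) ^ θ ≤ (3 * w) ^ θ := Real.rpow_le_rpow (by positivity) h4 hθ
        _ = 3 ^ θ * w ^ θ := Real.mul_rpow (by norm_num) hw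
        _ ≤ _ := by gcongr
    rcases le_total y z with h | h
    · rcases le_total z 1 with h' | h'
      · exact key 1 zero_le_one (by linarith) (by rw [Real.one_rpow]; linarith)
      · exact key z hz (by linarith) (by linarith)
    · rcases le_total y 1 with h' | h'
      · exact key 1 zero_le_one (by linarith) (by rw [Real.one_rpow]; linarith)
      · exact key y hy (by linarith) (by linarith)
  calc |x| ^ θ ≤ (D * (1 + |a| ^ r + |b| ^ r)) ^ θ := Real.rpow_le_rpow (abs_nonneg x) hx hθ
    _ = D ^ θ * (1 + |a| ^ r + |b| ^ r) ^ θ := Real.mul_rpow hD (by positivity)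
    _ ≤ D ^ θ * (3 ^ θ * (1 + (|a| ^ r) ^ θ + (|b| ^ r) ^ θ)) := by
        gcongr
        exact h1 _ _ ha hb
    _ = _ := by
        rw [← Real.rpow_mul (abs_nonneg a), ← Real.rpow_mul (abs_nonneg b),
          Real.mul_rpow (by norm_num) hD]
        ring

theorem growth_mul_le {C r a b x : ℝ} (hC : 0 ≤ C) (hr : 1 < r)
    (hx : |x| ≤ C * (1 + |a| ^ (r - 1))) :
    |x * b| ≤ 2 * C * (1 + |a| ^ r + |b| ^ r) := by
  have ha : 0 ≤ |a| ^ r := Real.rpow_nonneg (abs_nonneg a) r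
  have hb : 0 ≤ |b| ^ r := Real.rpow_nonneg (abs_nonneg b) r
  have hself : ∀ t : ℝ, 0 ≤ t → t ^ (r - 1) * t = t ^ r := by
    intro t ht
    rcases eq_or_lt_of_le ht with h | h
    · rw [← h, mul_zero, Real.zero_rpow (by linarith)]
    · rw [← Real.rpow_add_one h.ne']; ring_nf
  have h1 : |b| ≤ 1 + |b| ^ r := by
    rcases le_total |b| 1 with h | h
    · linarith
    · have := Real.rpow_le_rpow_of_exponent_le h hr.le
      rw [Real.rpow_one] at this
      linarith
  have h2 : |a| ^ (r - 1) * |b| ≤ |a| ^ r + |b| ^ r := by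
    rcases le_total |a| |b| with h | h
    · have := Real.rpow_le_rpow (abs_nonneg a) h (by linarith : 0 ≤ r - 1)
      have h3 := mul_le_mul_of_nonneg_right this (abs_nonneg b)
      rw [hself _ (abs_nonneg b)] at h3
      linarith
    · have h3 := mul_le_mul_of_nonneg_left h (Real.rpow_nonneg (abs_nonneg a) (r - 1))
      rw [hself _ (abs_nonneg a)] at h3
      linarith
  calc |x * b| = |x| * |b| := abs_mul _ _
    _ ≤ C * (1 + |a| ^ (r - 1)) * |b| := by gcongr
    _ = C * (|b| + |a| ^ (r - 1) * |b|) := by ring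
    _ ≤ C * (2 * (1 + |a| ^ r + |b| ^ r)) := by
        gcongr
        linarith
    _ = _ := by ring

namespace W0

variable {N : ℕ} [NeZero N] {Ω : BoundedLipschitzDomain N} {s p : ℝ} [hp2 : Fact (2 ≤ p)]

/-- The exponent θ raises growth r exactly to `sobExp`, where integrals are controlled by M and R
alone. The function h is the dominating function that Vitali's theorem asks for. -/
theorem exists_growth_bound (Ω : BoundedLipschitzDomain N) (hs : 0 < s) (M R : ℝ) {θ : ℝ} {D r : ℝ}
    (hD : 0 ≤ D) (hθ : 0 ≤ θ) (hr : r * θ = sobExp N s p) :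
    ∃ B, ∀ u v : W0 Ω s p, ‖u.toL2‖ ≤ M → ‖v.toL2‖ ≤ M → ‖u‖ ≤ R → ‖v‖ ≤ R →
      ∃ h : Space N → ℝ, Integrable h (volume.restrict Ω.carrier) ∧ ∫ x in Ω.carrier, h x ≤ B ∧
        ∀ x y, |y| ≤ D * (1 + |u x| ^ r + |v x| ^ r) → |y| ^ θ ≤ h x := by
  have hp := hp2.out
  obtain ⟨A, hA0, hA⟩ := exists_integral_rpow_sobExp_le (p := p) Ω hs M
  refine ⟨(3 * D) ^ θ * (volume.real Ω.carrier + A * |R| ^ p + A * |R| ^ p), ?_⟩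
  intro u v hu hv huR hvR
  have hR : ∀ w : W0 Ω s p, ‖w‖ ≤ R → A * ‖w‖ ^ p ≤ A * |R| ^ p := fun w hw =>
    mul_le_mul_of_nonneg_left (Real.rpow_le_rpow (norm_nonneg _) (hw.trans (le_abs_self R))
      (by linarith)) hA0.le
  have h1 := (hA u hu).2.trans (hR u huR)
  have h2 := (hA v hv).2.trans (hR v hvR)
  have hi1 := (hA u hu).1
  have hi2 := (hA v hv).1
  have hc : Integrable (fun _ : Space N => (1 : ℝ)) (volume.restrict Ω.carrier) :=
    integrable_const 1
  refine ⟨fun x => (3 * D) ^ θ * (1 + |u x| ^ sobExp N s p + |v x| ^ sobExp N s p),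
    ((hc.add hi1).add hi2).const_mul _, ?_, ?_⟩
  · rw [integral_const_mul]
    refine mul_le_mul_of_nonneg_left ?_ (by positivity)
    have e1 : ∫ x in Ω.carrier, (1 + |u x| ^ sobExp N s p + |v x| ^ sobExp N s p)
        = (∫ x in Ω.carrier, (1 + |u x| ^ sobExp N s p)) + ∫ x in Ω.carrier, |v x| ^ sobExp N s p :=
      integral_add (hc.add hi1) hi2
    rw [e1, integral_add hc hi1]
    simp only [integral_const, MeasurableSet.univ, measureReal_restrict_apply, univ_inter,
      smul_eq_mul, mul_one]
    linarith
  · intro x y hy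
    rw [← hr]
    exact rpow_growth_le hD hθ hy

theorem exists_integral_growth_bound (Ω : BoundedLipschitzDomain N) (hs : 0 < s) (M R : ℝ)
    {D r : ℝ} (hD : 0 ≤ D) (hr : 0 < r) (hrq : r < sobExp N s p) :
    ∃ B, ∀ u v : W0 Ω s p, ‖u.toL2‖ ≤ M → ‖v.toL2‖ ≤ M → ‖u‖ ≤ R → ‖v‖ ≤ R →
      ∀ F : Space N → ℝ, AEStronglyMeasurable F (volume.restrict Ω.carrier) →
        (∀ x, |F x| ≤ D * (1 + |u x| ^ r + |v x| ^ r)) →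
        Integrable F (volume.restrict Ω.carrier) ∧ |∫ x in Ω.carrier, F x| ≤ B := by
  have hθ : 1 ≤ sobExp N s p / r := (one_le_div hr).2 hrq.le
  obtain ⟨B, hB⟩ := exists_growth_bound (p := p) (r := r) Ω hs M R hD (by linarith)
    (mul_div_cancel₀ (sobExp N s p) hr.ne')
  refine ⟨volume.real Ω.carrier + B, fun u v hu hv huR hvR F hF hFb => ?_⟩
  obtain ⟨h, hi, hib, hh⟩ := hB u v hu hv huR hvR
  have hpt : ∀ x, |F x| ≤ 1 + h x := by
    intro x
    have h1 := hh x (F x) (hFb x)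
    have h0 : 0 ≤ h x := (Real.rpow_nonneg (abs_nonneg _) _).trans h1
    rcases le_total |F x| 1 with h2 | h2
    · linarith
    · have := Real.rpow_le_rpow_of_exponent_le h2 hθ
      rw [Real.rpow_one] at this
      linarith
  have hi1 : Integrable (fun x => 1 + h x) (volume.restrict Ω.carrier) :=
    (integrable_const 1).add hi
  refine ⟨hi1.mono' hF (Filter.Eventually.of_forall hpt), ?_⟩
  refine (norm_integral_le_of_norm_le (f := F) hi1 (Filter.Eventually.of_forall hpt)).trans ?_
  rw [integral_add (integrable_const 1) hi]
  simpa using hib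

/-- Convergence of integrals of superposition operators of subcritical growth. -/
theorem tendsto_integral_comp (hs : 0 < s) {M R D r : ℝ} (hD : 0 ≤ D) (hr : 0 < r)
    (hrq : r < sobExp N s p) {u v : ℕ → W0 Ω s p} {u' v' : W0 Ω s p}
    (huM : ∀ k, ‖(u k).toL2‖ ≤ M) (hvM : ∀ k, ‖(v k).toL2‖ ≤ M)
    (huR : ∀ k, ‖u k‖ ≤ R) (hvR : ∀ k, ‖v k‖ ≤ R)
    (hu : Filter.Tendsto (fun k => (u k).toL2) Filter.atTop (𝓝 u'.toL2))
    (hv : Filter.Tendsto (fun k => (v k).toL2) Filter.atTop (𝓝 v'.toL2))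
    {F : ℕ → ℝ → ℝ → ℝ} {F' : ℝ → ℝ → ℝ} (hFm : ∀ k, Continuous (Function.uncurry (F k)))
    (hF : ∀ k a b, |F k a b| ≤ D * (1 + |a| ^ r + |b| ^ r))
    (hconv : ∀ ns : ℕ → ℕ, Filter.Tendsto ns Filter.atTop Filter.atTop → ∀ (a b : ℕ → ℝ) (a' b' : ℝ),
      Filter.Tendsto a Filter.atTop (𝓝 a') → Filter.Tendsto b Filter.atTop (𝓝 b') →
      Filter.Tendsto (fun k => F (ns k) (a k) (b k)) Filter.atTop (𝓝 (F' a' b'))) :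
    Filter.Tendsto (fun k => ∫ x in Ω.carrier, F k (u k x) (v k x)) Filter.atTop
      (𝓝 (∫ x in Ω.carrier, F' (u' x) (v' x))) := by
  have hθ : 1 < sobExp N s p / r := (one_lt_div hr).2 hrq
  obtain ⟨B, hB⟩ := exists_growth_bound (p := p) (r := r) Ω hs M R hD (by linarith)
    (mul_div_cancel₀ (sobExp N s p) hr.ne')
  -- L² convergence gives almost everywhere convergence only along further subsequences. For this
  -- reason `hconv` admits arbitrary index maps ns tending to infinity.
  refine Filter.tendsto_of_subseq_tendsto fun ns hns => ?_
  obtain ⟨ms, hms, hms'⟩ := (tendstoInMeasure_of_tendsto_Lp (hu.comp hns)).exists_seq_tendsto_ae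
  obtain ⟨ls, hls, hls'⟩ := (tendstoInMeasure_of_tendsto_Lp
    ((hv.comp hns).comp hms.tendsto_atTop)).exists_seq_tendsto_ae
  refine ⟨fun k => ms (ls k), ?_⟩
  choose h hi hib hh using fun k => hB (u k) (v k) (huM k) (hvM k) (huR k) (hvR k)
  refine tendsto_integral_of_rpow_le hθ (h := fun k => h (ns (ms (ls k)))) (C := B) ?_
    (fun k => hi _) (fun k => hib _) ?_ ?_
  · intro k
    exact ((hFm _).measurable.comp
      ((measurable_coe (u _)).prodMk (measurable_coe (v _)))).aestronglyMeasurable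
  · exact fun k => Filter.Eventually.of_forall fun x => hh _ x _ (hF _ _ _)
  · filter_upwards [hms', hls', coe_toL2 u', coe_toL2 v', ae_all_iff.2 fun k => coe_toL2 (u k),
      ae_all_iff.2 fun k => coe_toL2 (v k)] with x h1 h2 h3 h4 h5 h6
    refine hconv (fun k => ns (ms (ls k)))
      ((hns.comp hms.tendsto_atTop).comp hls.tendsto_atTop) _ _ _ _ ?_ ?_
    · rw [← h3]
      exact (h1.comp hls.tendsto_atTop).congr fun k => h5 _
    · rw [← h4]
      exact h2.congr fun k => h6 _

end W0

/-! ### The form K as derivative of the Gagliardo energy -/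

theorem continuous_rpow_abs_mul {p : ℝ} (hp : 2 ≤ p) : Continuous fun t : ℝ => |t| ^ (p - 2) * t :=
  (continuous_abs.rpow_const fun _ => Or.inr (by linarith)).mul continuous_id

theorem abs_rpow_abs_mul {p : ℝ} (hp : 2 ≤ p) (t : ℝ) : |(|t| ^ (p - 2) * t)| = |t| ^ (p - 1) := by
  rw [abs_mul, abs_of_nonneg (Real.rpow_nonneg (abs_nonneg t) _)]
  rcases eq_or_lt_of_le (abs_nonneg t) with h | h
  · rw [← h, mul_zero, Real.zero_rpow (by linarith)]
  · rw [← Real.rpow_add_one h.ne']; ring_nf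

theorem rpow_sub_one_mul_le {p a b : ℝ} (hp : 1 ≤ p) (ha : 0 ≤ a) (hb : 0 ≤ b) :
    a ^ (p - 1) * b ≤ (a + b) ^ p := by
  have h1 : a ^ (p - 1) ≤ (a + b) ^ (p - 1) := Real.rpow_le_rpow ha (by linarith) (by linarith)
  have h2 : (a + b) ^ (p - 1) * (a + b) = (a + b) ^ p := by
    rcases eq_or_lt_of_le (add_nonneg ha hb) with h | h
    · rw [← h, mul_zero, Real.zero_rpow (by linarith)]
    · rw [← Real.rpow_add_one h.ne']; ring_nf
  rw [← h2]
  exact mul_le_mul h1 (by linarith) hb (by positivity)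

/-- The convexity inequality for `|t|^p / p`. -/
theorem rpow_abs_div_sub_le {p : ℝ} (hp : 2 ≤ p) (a b : ℝ) :
    |b| ^ p / p - |a| ^ p / p ≤ |b| ^ (p - 2) * b * (b - a) := by
  have hp0 : 0 < p := by linarith
  have hp1 : 0 < p - 1 := by linarith
  have hq : p.HolderConjugate (p / (p - 1)) := Real.HolderConjugate.conjExponent (by linarith)
  have h1 := Real.young_inequality_of_nonneg (abs_nonneg a)
    (Real.rpow_nonneg (abs_nonneg b) (p - 1)) hq
  rw [← Real.rpow_mul (abs_nonneg b), mul_div_cancel₀ _ hp1.ne'] at h1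
  have h2 : |b| ^ (p - 2) * b * b = |b| ^ p := by
    rw [mul_assoc, ← sq, ← sq_abs, ← Real.rpow_two]
    rcases eq_or_lt_of_le (abs_nonneg b) with h | h
    · rw [← h, Real.zero_rpow two_ne_zero, mul_zero, Real.zero_rpow hp0.ne']
    · rw [← Real.rpow_add h]; ring_nf
  have h3 : |b| ^ (p - 2) * b * a ≤ |a| * |b| ^ (p - 1) := by
    rw [← abs_rpow_abs_mul hp b, ← abs_mul, mul_comm a]
    exact le_abs_self _
  have h4 : |b| ^ p / (p / (p - 1)) = |b| ^ p - |b| ^ p / p := by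
    field_simp
  rw [h4] at h1
  rw [mul_sub, h2]
  linarith

namespace W0

variable {N : ℕ} {Ω : BoundedLipschitzDomain N} {s p : ℝ}

theorem fracQuot_add_smul_ae (u v : W0 Ω s p) (ε : ℝ) :
    ∀ᵐ z ∂((volume : Measure (Space N)).prod (volume : Measure (Space N))),
      fracQuot s p (u + ε • v : W0 Ω s p) z = fracQuot s p u z + ε * fracQuot s p v z := by
  have h : ((u + ε • v : W0 Ω s p) : Space N → ℝ) =ᵐ[volume] (u : Space N → ℝ) + ε • (v : Space N → ℝ) := by
    filter_upwards [coe_add u (ε • v), coe_smul ε v] with x h1 h2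
    rw [h1, Pi.add_apply, Pi.add_apply, h2]
  filter_upwards [fracQuot_congr s p h] with z hz
  rw [hz, fracQuot_add, fracQuot_smul]
  rfl

variable [hp2 : Fact (2 ≤ p)]

theorem integrable_fracQuot_rpow (u : W0 Ω s p) :
    Integrable (fun z => |fracQuot s p u z| ^ p) (volume.prod volume) := by
  have hp := hp2.out
  have h := (memLp_fracQuot Ω s p u).integrable_norm_rpow
    (by simpa using (by linarith : 0 < p)) ENNReal.ofReal_ne_top
  rwa [ENNReal.toReal_ofReal (by linarith)] at h

theorem integrable_kernel_bound (u v : W0 Ω s p) :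
    Integrable (fun z => (|fracQuot s p u z| + |fracQuot s p v z|) ^ p) (volume.prod volume) := by
  have hp := hp2.out
  have h := ((memLp_fracQuot Ω s p u).norm.add (memLp_fracQuot Ω s p v).norm).integrable_norm_rpow
    (by simpa using (by linarith : 0 < p)) ENNReal.ofReal_ne_top
  rw [ENNReal.toReal_ofReal (by linarith)] at h
  refine h.congr (Filter.Eventually.of_forall fun z => ?_)
  simp only [Pi.add_apply, Real.norm_eq_abs]
  rw [abs_of_nonneg (add_nonneg (abs_nonneg _) (abs_nonneg _))]

theorem measurable_kernel (u v : W0 Ω s p) :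
    Measurable fun z => |fracQuot s p u z| ^ (p - 2) * fracQuot s p u z * fracQuot s p v z :=
  ((continuous_rpow_abs_mul hp2.out).measurable.comp
    (measurable_fracQuot s p (measurable_coe u))).mul (measurable_fracQuot s p (measurable_coe v))

theorem integrable_kernel (u v : W0 Ω s p) :
    Integrable (fun z => |fracQuot s p u z| ^ (p - 2) * fracQuot s p u z * fracQuot s p v z)
      (volume.prod volume) := by
  have hp := hp2.out
  refine (integrable_kernel_bound u v).mono' (measurable_kernel u v).aestronglyMeasurable
    (Filter.Eventually.of_forall fun z => ?_)
  rw [Real.norm_eq_abs, abs_mul, abs_rpow_abs_mul hp]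
  exact rpow_sub_one_mul_le (by linarith) (abs_nonneg _) (abs_nonneg _)

/-- With d = `|x - y|^(N/p + s)` the kernel weight is `d^(p-2) * d * d`, one factor for each
quotient. Integrability on the product space then permits Fubini. -/
theorem K_eq_integral (u v : W0 Ω s p) :
    K s p u v = ∫ z, |fracQuot s p u z| ^ (p - 2) * fracQuot s p u z * fracQuot s p v z
      ∂(volume.prod volume) := by
  have hp := hp2.out
  rw [integral_prod _ (integrable_kernel u v), K]
  refine integral_congr_ae (Filter.Eventually.of_forall fun x => ?_)
  refine integral_congr_ae (Filter.Eventually.of_forall fun y => ?_)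
  simp only [fracQuot]
  rcases eq_or_ne x y with rfl | hxy
  · simp
  have hpos : 0 < ‖x - y‖ := norm_pos_iff.2 (sub_ne_zero.2 hxy)
  set d := ‖x - y‖ ^ ((N : ℝ) / p + s) with hd
  have hd0 : 0 < d := Real.rpow_pos_of_pos hpos _
  have h1 : ‖x - y‖ ^ ((N : ℝ) + s * p) = d ^ (p - 2) * d * d := by
    rw [mul_assoc, ← sq, ← Real.rpow_two, ← Real.rpow_add hd0, hd, ← Real.rpow_mul hpos.le]
    congr 1
    have : p ≠ 0 := by linarith
    field_simp
    ring
  have h2 : 0 < d ^ (p - 2) := by positivity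
  rw [h1, abs_div, abs_of_pos hd0, Real.div_rpow (abs_nonneg _) hd0.le]
  field_simp

theorem K_neg (u v : W0 Ω s p) : K s p u (-v : W0 Ω s p) = -K s p u v := by
  rw [K_eq_integral, K_eq_integral, ← integral_neg]
  refine integral_congr_ae ?_
  filter_upwards [fracQuot_add_smul_ae (0 : W0 Ω s p) v (-1),
    fracQuot_add_smul_ae (0 : W0 Ω s p) (0 : W0 Ω s p) (-1)] with z h1 h2
  simp only [neg_smul, one_smul, zero_add, neg_zero] at h1 h2
  rw [h1]
  have : fracQuot s p (0 : W0 Ω s p) z = 0 := by linarith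
  rw [this]
  ring

variable [NeZero N]

theorem norm_rpow_eq_integral (u : W0 Ω s p) :
    ‖u‖ ^ p = ∫ z, |fracQuot s p u z| ^ p ∂(volume.prod volume) := by
  have hp := hp2.out
  have hint := integrable_fracQuot_rpow u
  rw [norm_rpow_eq, integral_prod _ hint]
  simp_rw [abs_fracQuot_rpow (by linarith : 0 < p)]

/-- The derivative of `[u]^p / p` in the direction `v` is `K(u, v)`. -/
theorem le_K_of_forall_le {u v : W0 Ω s p} {L : ℝ}
    (h : ∀ n : ℕ, 1 / ((n : ℝ) + 1) * L ≤ ‖u + (1 / ((n : ℝ) + 1)) • v‖ ^ p / p - ‖u‖ ^ p / p) :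
    L ≤ K s p u v := by
  have hp := hp2.out
  set ε : ℕ → ℝ := fun n => 1 / ((n : ℝ) + 1) with hε
  have hε0 : ∀ n, 0 < ε n := fun n => by rw [hε]; positivity
  have hε1 : ∀ n, ε n ≤ 1 := fun n => by
    rw [hε]
    simp only
    rw [div_le_one (by positivity)]
    linarith [(Nat.cast_nonneg n : (0 : ℝ) ≤ n)]
  have hεlim : Filter.Tendsto ε Filter.atTop (𝓝 0) := tendsto_one_div_add_atTop_nhds_zero_nat
  have hle : ∀ n, L ≤ ∫ z, |fracQuot s p (u + ε n • v : W0 Ω s p) z| ^ (p - 2)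
      * fracQuot s p (u + ε n • v : W0 Ω s p) z * fracQuot s p v z ∂(volume.prod volume) := by
    intro n
    have h1 := h n
    rw [norm_rpow_eq_integral, norm_rpow_eq_integral, ← integral_div, ← integral_div,
      ← integral_sub ((integrable_fracQuot_rpow _).div_const _)
        ((integrable_fracQuot_rpow _).div_const _)] at h1
    refine le_of_mul_le_mul_left (h1.trans ?_) (hε0 n)
    rw [← integral_const_mul]
    refine integral_mono_ae (((integrable_fracQuot_rpow _).div_const _).sub
        ((integrable_fracQuot_rpow _).div_const _)) ((integrable_kernel _ _).const_mul _) ?_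
    filter_upwards [fracQuot_add_smul_ae u v (ε n)] with z hz
    -- Convexity bounds the increment by ε times the integrand of K at the shifted point u + εv;
    -- dominated convergence then moves that point back to u.
    have h2 := rpow_abs_div_sub_le hp (fracQuot s p u z)
      (fracQuot s p (u + ε n • v : W0 Ω s p) z)
    have h3 : fracQuot s p (u + ε n • v : W0 Ω s p) z - fracQuot s p u z
        = ε n * fracQuot s p v z := by rw [hz]; ring
    rw [h3] at h2
    linarith
  refine ge_of_tendsto' (x := Filter.atTop) (f := fun n => ∫ z,
    |fracQuot s p (u + ε n • v : W0 Ω s p) z| ^ (p - 2)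
      * fracQuot s p (u + ε n • v : W0 Ω s p) z * fracQuot s p v z ∂(volume.prod volume)) ?_ hle
  rw [K_eq_integral]
  refine tendsto_integral_of_dominated_convergence
    (fun z => (|fracQuot s p u z| + |fracQuot s p v z| + |fracQuot s p v z|) ^ p)
    (fun n => (measurable_kernel _ _).aestronglyMeasurable) ?_ ?_ ?_
  · have h := (((memLp_fracQuot Ω s p u).norm.add (memLp_fracQuot Ω s p v).norm).add
      (memLp_fracQuot Ω s p v).norm).integrable_norm_rpow
      (by simpa using (by linarith : 0 < p)) ENNReal.ofReal_ne_top
    rw [ENNReal.toReal_ofReal (by linarith)] at h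
    refine h.congr (Filter.Eventually.of_forall fun z => ?_)
    simp only [Pi.add_apply, Real.norm_eq_abs]
    rw [abs_of_nonneg (by positivity)]
  · intro n
    filter_upwards [fracQuot_add_smul_ae u v (ε n)] with z hz
    rw [Real.norm_eq_abs, abs_mul, abs_rpow_abs_mul hp]
    refine le_trans ?_ (rpow_sub_one_mul_le (by linarith) (by positivity) (abs_nonneg _))
    refine mul_le_mul_of_nonneg_right (Real.rpow_le_rpow (abs_nonneg _) ?_ (by linarith))
      (abs_nonneg _)
    rw [hz]
    refine (abs_add_le _ _).trans (add_le_add le_rfl ?_)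
    rw [abs_mul, abs_of_pos (hε0 n)]
    exact mul_le_of_le_one_left (abs_nonneg _) (hε1 n)
  · have hall := ae_all_iff.2 fun n => fracQuot_add_smul_ae u v (ε n)
    filter_upwards [hall] with z hz
    have h1 : Filter.Tendsto (fun n => fracQuot s p (u + ε n • v : W0 Ω s p) z) Filter.atTop
        (𝓝 (fracQuot s p u z)) := by
      simp only [hz]
      simpa using (hεlim.mul_const (fracQuot s p v z)).const_add (fracQuot s p u z)
    exact (((continuous_rpow_abs_mul hp).tendsto _).comp h1).mul_const _

end W0

/-! ### The truncated energy and one step of the minimizing movement scheme -/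

namespace W0

variable {N : ℕ} {Ω : BoundedLipschitzDomain N} {s p : ℝ} [hp2 : Fact (2 ≤ p)]

theorem memLp_truncSource (n : ℕ) (u : W0 Ω s p) :
    MemLp (fun x => truncSource p n (u x)) 2 (volume.restrict Ω.carrier) := by
  obtain ⟨C, hC⟩ := exists_abs_truncSource_le hp2.out n
  exact MemLp.of_bound ((continuous_truncSource hp2.out n).measurable.comp
    (measurable_coe u)).aestronglyMeasurable C (Filter.Eventually.of_forall fun x => hC _)

/-- The truncated reaction term as an element of `L²(Ω)`. -/
def truncSourceL2 (n : ℕ) (u : W0 Ω s p) : L2 Ω := (memLp_truncSource n u).toLp _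

theorem inner_truncSourceL2 (n : ℕ) (u z : W0 Ω s p) :
    inner ℝ (truncSourceL2 n u) z.toL2 = ∫ x in Ω.carrier, truncSource p n (u x) * z x := by
  rw [L2.inner_def]
  refine integral_congr_ae ?_
  filter_upwards [coe_toL2 z, (memLp_truncSource n u).coeFn_toLp] with x h1 h2
  rw [h1, truncSourceL2, h2]
  simp [mul_comm]

theorem integrable_truncSource_mul (n : ℕ) (u z : W0 Ω s p) :
    Integrable (fun x => truncSource p n (u x) * z x) (volume.restrict Ω.carrier) :=
  (memLp_truncSource n u).integrable_mul (memLp_two Ω s p z)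

theorem integrable_truncPotential (n : ℕ) (u : W0 Ω s p) :
    Integrable (fun x => truncPotential p n (u x)) (volume.restrict Ω.carrier) := by
  obtain ⟨C, hC⟩ := exists_abs_truncSource_le hp2.out n
  refine ((integrable_toL2 u).abs.const_mul C).mono'
    ((continuous_truncPotential hp2.out n).measurable.comp
      (measurable_coe u)).aestronglyMeasurable (Filter.Eventually.of_forall fun x => ?_)
  have := intervalIntegral.norm_integral_le_of_norm_le_const (a := 0) (b := u x)
    (f := truncSource p n) (C := C) fun y _ => hC y
  rwa [sub_zero] at this

/-- The tangent-plus-quadratic bound integrated over Ω. It replaces a derivative of the potential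
term in every comparison of energies below. -/
theorem integral_truncPotential_le {n : ℕ} {L : ℝ}
    (hL : ∀ a b, a ≤ b → truncSource p n b - truncSource p n a ≤ L * (b - a)) (u v : W0 Ω s p) :
    ∫ x in Ω.carrier, truncPotential p n (v x) ≤ (∫ x in Ω.carrier, truncPotential p n (u x))
      + inner ℝ (truncSourceL2 n u) (v.toL2 - u.toL2) + L / 2 * ‖v.toL2 - u.toL2‖ ^ 2 := by
  have hi : Integrable (fun x => truncPotential p n (u x) + truncSource p n (u x) * (v - u) x)
      (volume.restrict Ω.carrier) :=
    (integrable_truncPotential n u).add (integrable_truncSource_mul n u _)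
  rw [← toL2_sub, inner_truncSourceL2, norm_sq_toL2, ← integral_const_mul,
    ← integral_add (integrable_truncPotential n u) (integrable_truncSource_mul n u _),
    ← integral_add hi ((integrable_sq _).const_mul _)]
  refine integral_mono_ae (integrable_truncPotential n v)
    (hi.add ((integrable_sq _).const_mul _)) ?_
  filter_upwards [ae_restrict_of_ae (coe_sub v u)] with x hx
  rw [hx, Pi.sub_apply]
  exact integral_le_of_oneSided (continuous_truncSource hp2.out n) hL (u x) (v x)

theorem integral_truncPotential_le_sq {n : ℕ} {L : ℝ}
    (hL : ∀ a b, a ≤ b → truncSource p n b - truncSource p n a ≤ L * (b - a)) (v : W0 Ω s p) :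
    ∫ x in Ω.carrier, truncPotential p n (v x) ≤ L / 2 * ‖v.toL2‖ ^ 2 := by
  rw [norm_sq_toL2, ← integral_const_mul]
  refine integral_mono (integrable_truncPotential n v) ((integrable_sq _).const_mul _) fun x => ?_
  have := integral_le_of_oneSided (continuous_truncSource hp2.out n) hL 0 (v x)
  rw [truncSource_zero] at this
  simpa [truncPotential] using this

variable [NeZero N]

/-- The energy of the problem with truncated reaction term. -/
def truncEnergy (n : ℕ) (u : W0 Ω s p) : ℝ :=
  ‖u‖ ^ p / p - ∫ x in Ω.carrier, truncPotential p n (u x)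

/-- Lower semicontinuity of `[u]^p / p` for the `L²` convergence. -/
theorem norm_rpow_div_le_of_tendsto (hs : 0 < s) {v : ℕ → W0 Ω s p} {u : W0 Ω s p}
    (hv : Filter.Tendsto (fun k => (v k).toL2) Filter.atTop (𝓝 u.toL2)) {a : ℕ → ℝ} {b : ℝ}
    (hva : ∀ᶠ k in Filter.atTop, ‖v k‖ ^ p / p ≤ a k)
    (ha : Filter.Tendsto a Filter.atTop (𝓝 b)) : ‖u‖ ^ p / p ≤ b := by
  have hp := hp2.out
  have hp0 : 0 < p := by linarith
  by_contra! h
  obtain ⟨c, hbc, hcu⟩ := exists_between h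
  have hb0 : 0 ≤ b := by
    refine ge_of_tendsto ha ?_
    filter_upwards [hva] with k hk
    exact (div_nonneg (Real.rpow_nonneg (norm_nonneg _) _) hp0.le).trans hk
  have hc0 : 0 ≤ p * c := by nlinarith
  have h1 : (p * c) ^ p⁻¹ < ‖u‖ := by
    rw [Real.rpow_inv_lt_iff_of_pos hc0 (norm_nonneg _) hp0]
    rwa [lt_div_iff₀ hp0, mul_comm] at hcu
  obtain ⟨k, hk1, hk2, hk3⟩ := ((eventually_lt_norm hs hv h1).and
    (hva.and (ha.eventually_lt_const hbc))).exists
  have h2 : p * c < ‖v k‖ ^ p := by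
    have := Real.rpow_lt_rpow (by positivity) hk1 hp0
    rwa [← Real.rpow_mul hc0, inv_mul_cancel₀ hp0.ne', Real.rpow_one] at this
  have h3 : c < ‖v k‖ ^ p / p := by rwa [lt_div_iff₀ hp0, mul_comm]
  linarith

/-- An exponent strictly between p and `sobExp` leaves room for the logarithm and stays subcritical.
One constant covers all truncation levels and the limit. -/
theorem exists_exponent_and_bounds (N : ℕ) [NeZero N] {s p : ℝ} (hs : 0 < s) (hp : 2 ≤ p) :
    ∃ r C, p < r ∧ r < sobExp N s p ∧ 0 < C ∧
      (∀ t, |logSource p t| ≤ C * (1 + |t| ^ (r - 1))) ∧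
      (∀ n t, |truncSource p n t| ≤ C * (1 + |t| ^ (r - 1))) ∧
      (∀ n t, |truncPotential p n t| ≤ 2 * C * (1 + |t| ^ r)) ∧
      (∀ t, |logPotential p t| ≤ 2 * C * (1 + |t| ^ r)) := by
  obtain ⟨r, hr1, hr2⟩ := exists_between (lt_sobExp (N := N) hs (by linarith : 0 < p))
  obtain ⟨C, hC0, hC⟩ := abs_logSource_le hp hr1
  have hr : 1 ≤ r := by linarith
  have hCn := fun n => abs_truncSource_le hr hC0.le hC n
  exact ⟨r, C, hr1, hr2, hC0, hC, hCn, fun n => abs_integral_le_of_growth hr hC0.le (hCn n),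
    abs_integral_le_of_growth hr hC0.le hC⟩

theorem tendsto_integral_truncPotential_fixed (hs : 0 < s) (n : ℕ) {M R : ℝ} {v : ℕ → W0 Ω s p}
    {u : W0 Ω s p} (hM : ∀ k, ‖(v k).toL2‖ ≤ M) (hR : ∀ k, ‖v k‖ ≤ R)
    (hv : Filter.Tendsto (fun k => (v k).toL2) Filter.atTop (𝓝 u.toL2)) :
    Filter.Tendsto (fun k => ∫ x in Ω.carrier, truncPotential p n (v k x)) Filter.atTop
      (𝓝 (∫ x in Ω.carrier, truncPotential p n (u x))) := by
  have hp := hp2.out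
  obtain ⟨r, C, hr1, hr2, hC0, -, -, hC, -⟩ := exists_exponent_and_bounds N hs hp
  refine tendsto_integral_comp hs (D := 2 * C) (r := r) (by positivity) (by linarith) hr2 hM hM hR hR
    hv hv (F := fun _ a _ => truncPotential p n a) (F' := fun a _ => truncPotential p n a)
    (fun _ => (continuous_truncPotential hp n).comp continuous_fst) ?_ ?_
  · intro k a b
    refine (hC n a).trans ?_
    have : 0 ≤ |b| ^ r := by positivity
    exact mul_le_mul_of_nonneg_left (by linarith) (by positivity)
  · intro ns hns a b a' b' ha hb
    exact ((continuous_truncPotential hp n).tendsto _).comp ha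

theorem tendsto_inner_truncSourceL2_fixed (hs : 0 < s) (n : ℕ) {M R : ℝ} {v : ℕ → W0 Ω s p}
    {u : W0 Ω s p} (hM : ∀ k, ‖(v k).toL2‖ ≤ M) (hR : ∀ k, ‖v k‖ ≤ R)
    (hv : Filter.Tendsto (fun k => (v k).toL2) Filter.atTop (𝓝 u.toL2)) (z : W0 Ω s p) :
    Filter.Tendsto (fun k => inner ℝ (truncSourceL2 n (v k)) z.toL2) Filter.atTop
      (𝓝 (inner ℝ (truncSourceL2 n u) z.toL2)) := by
  have hp := hp2.out
  obtain ⟨r, C, hr1, hr2, hC0, -, hC, -, -⟩ := exists_exponent_and_bounds N hs hp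
  simp only [inner_truncSourceL2]
  refine tendsto_integral_comp hs (D := 2 * C) (r := r) (M := max M ‖z.toL2‖) (R := max R ‖z‖)
    (by positivity) (by linarith) hr2 (fun k => (hM k).trans (le_max_left _ _))
    (v := fun _ => z) (v' := z) (fun _ => le_max_right _ _) (fun k => (hR k).trans (le_max_left _ _))
    (fun _ => le_max_right _ _) hv tendsto_const_nhds
    (F := fun _ a b => truncSource p n a * b) (F' := fun a b => truncSource p n a * b)
    (fun _ => ((continuous_truncSource hp n).comp continuous_fst).mul continuous_snd) ?_ ?_
  · exact fun k a b => growth_mul_le hC0.le (by linarith) (hC n a)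
  · intro ns hns a b a' b' ha hb
    exact (((continuous_truncSource hp n).tendsto _).comp ha).mul hb

/-- One step of the minimizing movement scheme. -/
theorem exists_minimizer (hs : 0 < s) {n : ℕ} {L τ : ℝ} (hL0 : 0 < L) (hτ : 0 < τ)
    (hLτ : L * τ ≤ 1 / 4)
    (hL : ∀ a b, a ≤ b → truncSource p n b - truncSource p n a ≤ L * (b - a)) (g : L2 Ω) :
    ∃ v : W0 Ω s p, ∀ w : W0 Ω s p,
      truncEnergy n v + ‖v.toL2 - g‖ ^ 2 / (2 * τ) ≤ truncEnergy n w + ‖w.toL2 - g‖ ^ 2 / (2 * τ) := by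
  have hp := hp2.out
  have hp0 : 0 < p := by linarith
  set J : W0 Ω s p → ℝ := fun w => truncEnergy n w + ‖w.toL2 - g‖ ^ 2 / (2 * τ) with hJ
  -- The loss `L/2 ‖w‖²` is at most `L ‖w - g‖² + L ‖g‖²`, and Lτ ≤ 1/4 lets half of the penalty
  -- absorb the first term.
  have hcoer : ∀ w, ‖w‖ ^ p / p + ‖w.toL2 - g‖ ^ 2 / (4 * τ) - L * ‖g‖ ^ 2 ≤ J w := by
    intro w
    have h1 := integral_truncPotential_le_sq hL w
    have h2 : ‖w.toL2‖ ≤ ‖w.toL2 - g‖ + ‖g‖ := by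
      simpa using norm_add_le (w.toL2 - g) g
    have h3 : ‖w.toL2‖ ^ 2 ≤ 2 * ‖w.toL2 - g‖ ^ 2 + 2 * ‖g‖ ^ 2 := by
      nlinarith [norm_nonneg w.toL2, sq_nonneg (‖w.toL2 - g‖ - ‖g‖)]
    have h4 : L ≤ 1 / (4 * τ) := by
      rw [le_div_iff₀ (by positivity)]
      linarith
    have h5 : ‖w.toL2 - g‖ ^ 2 / (2 * τ) = 2 * (‖w.toL2 - g‖ ^ 2 * (1 / (4 * τ))) := by
      field_simp
      norm_num
    have h6 : ‖w.toL2 - g‖ ^ 2 / (4 * τ) = ‖w.toL2 - g‖ ^ 2 * (1 / (4 * τ)) := by ring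
    have h7 := mul_le_mul_of_nonneg_left h4 (sq_nonneg ‖w.toL2 - g‖)
    have h8 := mul_le_mul_of_nonneg_left h3 (by positivity : 0 ≤ L / 2)
    rw [hJ]
    simp only [truncEnergy]
    rw [h5, h6]
    linarith
  have hbdd : BddBelow (range J) := by
    refine ⟨-(L * ‖g‖ ^ 2), ?_⟩
    rintro _ ⟨w, rfl⟩
    have h1 := hcoer w
    have h2 : 0 ≤ ‖w‖ ^ p / p := by positivity
    have h3 : 0 ≤ ‖w.toL2 - g‖ ^ 2 / (4 * τ) := by positivity
    linarith
  obtain ⟨y, -, hy, hyJ⟩ := exists_seq_tendsto_sInf (range_nonempty J) hbdd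
  choose v hv using hyJ
  obtain ⟨c, hc⟩ := hy.bddAbove_range
  have hJc : ∀ k, J (v k) ≤ c := fun k => (hv k).trans_le (hc ⟨k, rfl⟩)
  set Q := c + L * ‖g‖ ^ 2 with hQ
  have hR : ∀ k, ‖v k‖ ≤ 1 + p * Q := by
    intro k
    have h1 := (hcoer (v k)).trans (hJc k)
    have h2 : 0 ≤ ‖(v k).toL2 - g‖ ^ 2 / (4 * τ) := by positivity
    have h3 : ‖v k‖ ^ p ≤ p * Q := by
      have : ‖v k‖ ^ p / p ≤ Q := by linarith
      rwa [div_le_iff₀ hp0, mul_comm] at this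
    have h4 : 0 ≤ ‖v k‖ ^ p := by positivity
    rcases le_total ‖v k‖ 1 with h | h
    · linarith
    · have := Real.rpow_le_rpow_of_exponent_le h (by linarith : 1 ≤ p)
      rw [Real.rpow_one] at this
      linarith
  have hM : ∀ k, ‖(v k).toL2‖ ≤ 1 + 4 * τ * Q + ‖g‖ := by
    intro k
    have h1 := (hcoer (v k)).trans (hJc k)
    have h2 : 0 ≤ ‖v k‖ ^ p / p := by positivity
    have h3 : ‖(v k).toL2 - g‖ ^ 2 ≤ 4 * τ * Q := by
      have : ‖(v k).toL2 - g‖ ^ 2 / (4 * τ) ≤ Q := by linarith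
      rwa [div_le_iff₀ (by positivity), mul_comm] at this
    have h4 : ‖(v k).toL2‖ ≤ ‖(v k).toL2 - g‖ + ‖g‖ := by
      simpa using norm_add_le ((v k).toL2 - g) g
    nlinarith [sq_nonneg (‖(v k).toL2 - g‖ - 1)]
  obtain ⟨w, φ, hφ, hw⟩ := exists_subseq_tendsto_toL2 hs hM hR
  obtain ⟨u, rfl, -⟩ := exists_norm_le_of_tendsto hs (fun k => hR (φ k)) hw
  refine ⟨u, fun w' => ?_⟩
  have hlim := tendsto_integral_truncPotential_fixed hs n (fun k => hM (φ k)) (fun k => hR (φ k)) hw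
  have hnorm : Filter.Tendsto (fun k => ‖(v (φ k)).toL2 - g‖ ^ 2 / (2 * τ)) Filter.atTop
      (𝓝 (‖u.toL2 - g‖ ^ 2 / (2 * τ))) := ((hw.sub_const g).norm.pow 2).div_const _
  have hJlim : Filter.Tendsto (fun k => J (v (φ k))) Filter.atTop (𝓝 (sInf (range J))) :=
    (hy.comp hφ.tendsto_atTop).congr fun k => (hv (φ k)).symm
  -- The convex part is isolated: it equals J plus the potential minus the penalty, and these three
  -- all converge along the subsequence.
  have h1 := norm_rpow_div_le_of_tendsto hs hw
    (a := fun k => J (v (φ k)) + (∫ x in Ω.carrier, truncPotential p n (v (φ k) x))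
      - ‖(v (φ k)).toL2 - g‖ ^ 2 / (2 * τ))
    (Filter.Eventually.of_forall fun k => le_of_eq (by rw [hJ]; simp only [truncEnergy]; ring))
    ((hJlim.add hlim).sub hnorm)
  have h2 : sInf (range J) ≤ J w' := csInf_le hbdd ⟨w', rfl⟩
  have h3 : J w' = ‖w'‖ ^ p / p - (∫ x in Ω.carrier, truncPotential p n (w' x))
      + ‖w'.toL2 - g‖ ^ 2 / (2 * τ) := rfl
  rw [h3] at h2
  simp only [truncEnergy]
  linarith

/-- The variational inequality satisfied by a minimizer. -/
theorem inner_le_of_minimizer (hs : 0 < s) {n : ℕ} {L τ : ℝ} (hτ : 0 < τ)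
    (hL : ∀ a b, a ≤ b → truncSource p n b - truncSource p n a ≤ L * (b - a)) {g : L2 Ω}
    {v : W0 Ω s p} (hv : ∀ w : W0 Ω s p,
      truncEnergy n v + ‖v.toL2 - g‖ ^ 2 / (2 * τ) ≤ truncEnergy n w + ‖w.toL2 - g‖ ^ 2 / (2 * τ))
    (w : W0 Ω s p) :
    inner ℝ (truncSourceL2 n v - τ⁻¹ • (v.toL2 - g)) (w.toL2 - v.toL2)
      ≤ ‖w‖ ^ p / p - ‖v‖ ^ p / p := by
  have hp := hp2.out
  have hp0 : 0 < p := by linarith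
  set ε : ℕ → ℝ := fun k => 1 / ((k : ℝ) + 1) with hε
  have hε0 : ∀ k, 0 < ε k := fun k => by rw [hε]; positivity
  have hε1 : ∀ k, ε k ≤ 1 := fun k => by
    rw [hε]
    simp only
    rw [div_le_one (by positivity)]
    linarith [(Nat.cast_nonneg k : (0 : ℝ) ≤ k)]
  have hεlim : Filter.Tendsto ε Filter.atTop (𝓝 0) := tendsto_one_div_add_atTop_nhds_zero_nat
  set z := w - v with hz
  set y : ℕ → W0 Ω s p := fun k => v + ε k • z with hy
  have hyL : ∀ k, (y k).toL2 = v.toL2 + ε k • z.toL2 := fun k => by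
    rw [hy]
    simp only [toL2_add, toL2_smul]
  have hstep : ∀ k, inner ℝ (truncSourceL2 n (y k)) z.toL2 - τ⁻¹ * inner ℝ (v.toL2 - g) z.toL2
      ≤ ‖w‖ ^ p / p - ‖v‖ ^ p / p + ε k * ((L / 2 + 1 / (2 * τ)) * ‖z.toL2‖ ^ 2) := by
    intro k
    have h1 := hv (y k)
    -- The quadratic bound is based at the competitor `y k`, not at v. This is the direction in
    -- which a one-sided Lipschitz bound helps; the source at `y k` tends to the source at v
    -- afterwards.
    have h2 := integral_truncPotential_le hL (y k) v
    have e2 : v.toL2 - (y k).toL2 = -(ε k • z.toL2) := by rw [hyL]; abel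
    rw [e2, inner_neg_right, inner_smul_right, norm_neg, norm_smul, mul_pow, Real.norm_eq_abs,
      sq_abs] at h2
    have h3 : ‖y k‖ ^ p ≤ (1 - ε k) * ‖v‖ ^ p + ε k * ‖w‖ ^ p := by
      have e3 : y k = (1 - ε k) • v + ε k • w := by
        rw [hy, hz]
        simp only [smul_sub, sub_smul, one_smul]
        abel
      have h4 : ‖y k‖ ≤ (1 - ε k) * ‖v‖ + ε k * ‖w‖ := by
        rw [e3]
        refine (norm_add_le _ _).trans ?_
        rw [norm_smul, norm_smul, Real.norm_of_nonneg (by linarith [hε1 k]),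
          Real.norm_of_nonneg (hε0 k).le]
      refine (Real.rpow_le_rpow (norm_nonneg _) h4 hp0.le).trans ?_
      have := (convexOn_rpow (by linarith : 1 ≤ p)).2 (norm_nonneg v) (norm_nonneg w)
        (by linarith [hε1 k] : 0 ≤ 1 - ε k) (hε0 k).le (by ring)
      simpa using this
    have h5 : ‖(y k).toL2 - g‖ ^ 2 = ‖v.toL2 - g‖ ^ 2 + 2 * (ε k * inner ℝ (v.toL2 - g) z.toL2)
        + ε k ^ 2 * ‖z.toL2‖ ^ 2 := by
      have : (y k).toL2 - g = (v.toL2 - g) + ε k • z.toL2 := by rw [hyL]; abel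
      rw [this, norm_add_sq_real, inner_smul_right, norm_smul, mul_pow, Real.norm_eq_abs, sq_abs]
    rw [h5] at h1
    simp only [truncEnergy] at h1
    have h6 : ‖y k‖ ^ p / p ≤ ‖v‖ ^ p / p + ε k * (‖w‖ ^ p / p - ‖v‖ ^ p / p) := by
      have := div_le_div_of_nonneg_right h3 hp0.le
      refine this.trans_eq ?_
      ring
    have e7 : (‖v.toL2 - g‖ ^ 2 + 2 * (ε k * inner ℝ (v.toL2 - g) z.toL2)
        + ε k ^ 2 * ‖z.toL2‖ ^ 2) / (2 * τ) = ‖v.toL2 - g‖ ^ 2 / (2 * τ)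
        + ε k * (τ⁻¹ * inner ℝ (v.toL2 - g) z.toL2)
        + ε k * (ε k * (1 / (2 * τ) * ‖z.toL2‖ ^ 2)) := by
      field_simp
    rw [e7] at h1
    refine le_of_mul_le_mul_left ?_ (hε0 k)
    linarith
  have hzL : z.toL2 = w.toL2 - v.toL2 := toL2_sub w v
  have hyv : Filter.Tendsto (fun k => (y k).toL2) Filter.atTop (𝓝 v.toL2) := by
    simp only [hyL]
    simpa using (hεlim.smul_const z.toL2).const_add v.toL2
  have hlim := tendsto_inner_truncSourceL2_fixed hs n (M := ‖v.toL2‖ + ‖z.toL2‖)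
    (R := ‖v‖ + ‖z‖) (v := y) (u := v) (fun k => by
      rw [hyL]
      refine (norm_add_le _ _).trans (add_le_add le_rfl ?_)
      rw [norm_smul, Real.norm_of_nonneg (hε0 k).le]
      exact mul_le_of_le_one_left (norm_nonneg _) (hε1 k))
    (fun k => by
      refine (norm_add_le _ _).trans (add_le_add le_rfl ?_)
      rw [norm_smul, Real.norm_of_nonneg (hε0 k).le]
      exact mul_le_of_le_one_left (norm_nonneg _) (hε1 k)) hyv z
  have hfin := le_of_tendsto_of_tendsto' (hlim.sub_const (τ⁻¹ * inner ℝ (v.toL2 - g) z.toL2))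
    ((hεlim.mul_const ((L / 2 + 1 / (2 * τ)) * ‖z.toL2‖ ^ 2)).const_add
      (‖w‖ ^ p / p - ‖v‖ ^ p / p)) hstep
  rw [zero_mul, add_zero] at hfin
  rw [← hzL, inner_sub_left, real_inner_smul_left]
  exact hfin

/-- The dissipation of energy in one step of the scheme. -/
theorem truncEnergy_step_le {n : ℕ} {L τ : ℝ}
    (hL : ∀ a b, a ≤ b → truncSource p n b - truncSource p n a ≤ L * (b - a))
    {u v : W0 Ω s p}
    (hv : inner ℝ (truncSourceL2 n v - τ⁻¹ • (v.toL2 - u.toL2)) (u.toL2 - v.toL2)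
      ≤ ‖u‖ ^ p / p - ‖v‖ ^ p / p) :
    (τ⁻¹ - L / 2) * ‖v.toL2 - u.toL2‖ ^ 2 + truncEnergy n v ≤ truncEnergy n u := by
  have h1 := integral_truncPotential_le hL v u
  rw [inner_sub_left, real_inner_smul_left, ← neg_sub v.toL2 u.toL2, inner_neg_right,
    inner_neg_right, real_inner_self_eq_norm_sq] at hv
  rw [← neg_sub v.toL2 u.toL2, inner_neg_right, norm_neg] at h1
  simp only [truncEnergy]
  linarith

end W0

/-! ### A priori bounds and existence of discrete solutions -/

/-- Triangle inequality and Cauchy–Schwarz: the discrete form of the Hölder-1/2 estimate in time. -/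
theorem norm_sub_sq_le_sum {H : Type*} [NormedAddCommGroup H] (x : ℕ → H) {a b : ℕ} (hab : a ≤ b) :
    ‖x b - x a‖ ^ 2 ≤ ((b : ℝ) - a) * ∑ j ∈ Finset.Ico a b, ‖x (j + 1) - x j‖ ^ 2 := by
  have h1 : ‖x b - x a‖ ≤ ∑ j ∈ Finset.Ico a b, ‖x (j + 1) - x j‖ := by
    have := dist_le_Ico_sum_dist x hab
    rw [dist_comm, dist_eq_norm] at this
    refine this.trans_eq (Finset.sum_congr rfl fun j _ => ?_)
    rw [dist_comm, dist_eq_norm]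
  have h2 := sq_sum_le_card_mul_sum_sq (s := Finset.Ico a b) (f := fun j => ‖x (j + 1) - x j‖)
  rw [Nat.card_Ico, Nat.cast_sub hab] at h2
  exact (pow_le_pow_left₀ (norm_nonneg _) h1 2).trans h2

/-- A discrete curve with controlled increments and dissipation stays close to its initial
point. -/
theorem norm_sub_le_one_of_sum_le {H : Type*} [NormedAddCommGroup H] {x : ℕ → H} {τ B M : ℝ}
    {m : ℕ} (hτ : 0 < τ) (hm : (m : ℝ) * (τ * B) ≤ 1) (hM : ‖x 0‖ + 2 ≤ M)
    (hone : ∀ k, ‖x k‖ ≤ M - 1 → ‖x (k + 1) - x k‖ ≤ 1)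
    (hsum : ∀ k, ‖x k‖ ≤ M → ∑ j ∈ Finset.range k, τ⁻¹ * ‖x (j + 1) - x j‖ ^ 2 ≤ B) :
    ∀ k ≤ m, ‖x k - x 0‖ ≤ 1 := by
  intro k
  induction k with
  | zero => intro _; simp
  | succ k ih =>
    intro hk
    have h1 := ih (by omega)
    -- Bootstrap: distance at most 1 leaves a margin of 1 inside the ball of radius M. The crude
    -- bound on one step keeps the next point in that ball, so `hsum` applies there and restores
    -- distance at most 1.
    have h2 : ‖x k‖ ≤ M - 1 := by
      have := norm_add_le (x k - x 0) (x 0)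
      rw [sub_add_cancel] at this
      linarith
    have h3 : ‖x (k + 1)‖ ≤ M := by
      have := norm_add_le (x (k + 1) - x k) (x k)
      rw [sub_add_cancel] at this
      linarith [hone k h2]
    have h6 := hsum (k + 1) h3
    have h7 := norm_sub_sq_le_sum x (Nat.zero_le (k + 1))
    rw [Nat.cast_zero, sub_zero, ← Finset.range_eq_Ico] at h7
    rw [← Finset.mul_sum, inv_mul_le_iff₀ hτ] at h6
    have h9 : ((k + 1 : ℕ) : ℝ) ≤ m := Nat.cast_le.2 hk
    have h10 : ‖x (k + 1) - x 0‖ ^ 2 ≤ 1 :=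
      h7.trans ((mul_le_mul h9 h6 (Finset.sum_nonneg fun _ _ => sq_nonneg _)
        (Nat.cast_nonneg m)).trans hm)
    exact (sq_le_one_iff₀ (norm_nonneg _)).1 h10

namespace W0

variable {N : ℕ} [NeZero N] {Ω : BoundedLipschitzDomain N} {s p : ℝ} [hp2 : Fact (2 ≤ p)]

/-- The truncated energies are coercive on bounded sets of `L²(Ω)`, uniformly in the truncation. -/
theorem exists_le_truncEnergy (Ω : BoundedLipschitzDomain N) (hs : 0 < s) (M : ℝ) :
    ∃ C, ∀ (n : ℕ) (u : W0 Ω s p), ‖u.toL2‖ ≤ M → ‖u‖ ^ p / (2 * p) - C ≤ truncEnergy n u := by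
  have hp := hp2.out
  have hp0 : 0 < p := by linarith
  obtain ⟨r, C, hr1, hr2, hC0, -, -, hC, -⟩ := exists_exponent_and_bounds N hs hp
  obtain ⟨A, hA0, hA⟩ := exists_integral_rpow_sobExp_le (p := p) Ω hs M
  -- Chosen so that the potential absorbs exactly half of `‖u‖^p / p`.
  set η := 1 / (2 * p) / (2 * C * A) with hη
  have hη0 : 0 < η := by positivity
  obtain ⟨D, hD0, hD⟩ := rpow_le_eps_mul_rpow_add (by linarith : 0 < r) hr2 hη0
  refine ⟨2 * C * (1 + D) * volume.real Ω.carrier, fun n u hu => ?_⟩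
  obtain ⟨hi, hAu⟩ := hA u hu
  have hc : Integrable (fun _ : Space N => 2 * C * (1 + D)) (volume.restrict Ω.carrier) :=
    integrable_const _
  have h1 : ∫ x in Ω.carrier, truncPotential p n (u x)
      ≤ ∫ x in Ω.carrier, (2 * C * (1 + D) + 2 * C * η * |u x| ^ sobExp N s p) := by
    refine integral_mono (integrable_truncPotential n u) (hc.add (hi.const_mul _)) fun x => ?_
    refine (le_abs_self _).trans ((hC n (u x)).trans ?_)
    have := mul_le_mul_of_nonneg_left (hD |u x| (abs_nonneg _)) (by positivity : 0 ≤ 2 * C)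
    linarith
  rw [integral_add hc (hi.const_mul _), integral_const_mul (2 * C * η)] at h1
  simp only [integral_const, MeasurableSet.univ, measureReal_restrict_apply, univ_inter,
    smul_eq_mul] at h1
  have h2 : 2 * C * η * (∫ x in Ω.carrier, |u x| ^ sobExp N s p) ≤ ‖u‖ ^ p / (2 * p) := by
    calc _ ≤ 2 * C * η * (A * ‖u‖ ^ p) := by gcongr
      _ = _ := by
        rw [hη]
        field_simp
  have h3 : ‖u‖ ^ p / p = ‖u‖ ^ p / (2 * p) + ‖u‖ ^ p / (2 * p) := by
    field_simp
    norm_num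
  rw [truncEnergy, h3]
  linarith

theorem exists_truncEnergy_le (hs : 0 < s) (u : W0 Ω s p) : ∃ E, ∀ n, truncEnergy n u ≤ E := by
  have hp := hp2.out
  obtain ⟨r, C, hr1, hr2, hC0, -, -, hC, -⟩ := exists_exponent_and_bounds N hs hp
  obtain ⟨B, hB⟩ := exists_integral_growth_bound (p := p) (D := 2 * C) (r := r) Ω hs ‖u.toL2‖ ‖u‖
    (by positivity) (by linarith) hr2
  refine ⟨‖u‖ ^ p / p + B, fun n => ?_⟩
  have h := (hB u u le_rfl le_rfl le_rfl le_rfl (fun x => truncPotential p n (u x))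
    (integrable_truncPotential n u).1 fun x => (hC n (u x)).trans
      (mul_le_mul_of_nonneg_left (by linarith [Real.rpow_nonneg (abs_nonneg (u x)) r])
        (by positivity))).2
  rw [truncEnergy]
  linarith [neg_abs_le (∫ x in Ω.carrier, truncPotential p n (u x))]

/-- A crude bound of the increment of one step of the scheme. -/
theorem norm_sub_le_one_of_step {n : ℕ} {L τ E M : ℝ} (hL0 : 0 < L) (hτ : 0 < τ)
    (hLτ : L * τ ≤ 1 / 4) (hEτ : 4 * τ * (E + L * M ^ 2) ≤ 1)
    (hL : ∀ a b, a ≤ b → truncSource p n b - truncSource p n a ≤ L * (b - a)) {u v : W0 Ω s p}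
    (hu : ‖u.toL2‖ ≤ M) (hE : truncEnergy n u ≤ E)
    (hv : (τ⁻¹ - L / 2) * ‖v.toL2 - u.toL2‖ ^ 2 + truncEnergy n v ≤ truncEnergy n u) :
    ‖v.toL2 - u.toL2‖ ≤ 1 := by
  have hp0 : 0 < p := by linarith [hp2.out]
  have hvu : ‖v.toL2‖ ≤ ‖v.toL2 - u.toL2‖ + ‖u.toL2‖ := by
    have := norm_add_le (v.toL2 - u.toL2) u.toL2
    rwa [sub_add_cancel] at this
  set δ := ‖v.toL2 - u.toL2‖ with hδ
  have h7 := integral_truncPotential_le_sq hL v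
  have h8 : -(L / 2 * ‖v.toL2‖ ^ 2) ≤ truncEnergy n v := by
    have : 0 ≤ ‖v‖ ^ p / p := by positivity
    rw [truncEnergy]
    linarith
  have h9 : ‖v.toL2‖ ^ 2 ≤ 2 * δ ^ 2 + 2 * M ^ 2 := by
    have h1 : ‖v.toL2‖ ≤ δ + M := by linarith
    have h2 := pow_le_pow_left₀ (norm_nonneg _) h1 2
    have h3 := sq_nonneg (δ - M)
    have e1 : (δ + M) ^ 2 = δ ^ 2 + 2 * (δ * M) + M ^ 2 := by ring
    have e2 : (δ - M) ^ 2 = δ ^ 2 - 2 * (δ * M) + M ^ 2 := by ring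
    linarith
  have h10 := mul_le_mul_of_nonneg_left h9 (by positivity : 0 ≤ L / 2)
  have h11 : (τ⁻¹ - L / 2 - L) * δ ^ 2 ≤ E + L * M ^ 2 := by linarith
  have h12 : τ⁻¹ / 4 ≤ τ⁻¹ - L / 2 - L := by
    have h1 : L ≤ τ⁻¹ / 4 := by
      rw [inv_eq_one_div, div_div, le_div_iff₀ (by positivity)]
      linarith
    have : 0 < τ⁻¹ := by positivity
    linarith
  have h13 := (mul_le_mul_of_nonneg_right h12 (sq_nonneg δ)).trans h11
  have h14 := mul_le_mul_of_nonneg_left h13 (by positivity : 0 ≤ 4 * τ)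
  have h15 : 4 * τ * (τ⁻¹ / 4 * δ ^ 2) = δ ^ 2 := by field_simp
  exact (sq_le_one_iff₀ (norm_nonneg _)).1 (by linarith)

/-- The time-discrete solutions, with step `T / m`, of the problem truncated at level `n`. -/
structure IsDiscreteSolution (T M R B : ℝ) (u₀ : W0 Ω s p) (n m : ℕ) (U : ℕ → W0 Ω s p) :
    Prop where
  pos : 0 < m
  -- Forces the time step T / m to vanish as the truncation level grows.
  le : n ≤ m
  zero : U 0 = u₀
  norm_toL2_le : ∀ k ≤ m, ‖(U k).toL2‖ ≤ M
  norm_le : ∀ k ≤ m, ‖U k‖ ≤ R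
  inner_le : ∀ k < m, ∀ w : W0 Ω s p,
    inner ℝ (truncSourceL2 n (U (k + 1)) - (T / m)⁻¹ • ((U (k + 1)).toL2 - (U k).toL2))
      (w.toL2 - (U (k + 1)).toL2) ≤ ‖w‖ ^ p / p - ‖U (k + 1)‖ ^ p / p
  -- The factor stands for 1 - Lτ/2, the loss caused by the non-convex term. It tends to 1, which
  -- yields the sharp constant in the limit.
  energy_le : ∀ k ≤ m, (1 - 1 / ((n : ℝ) + 1)) *
    (∑ j ∈ Finset.range k, (T / m)⁻¹ * ‖(U (j + 1)).toL2 - (U j).toL2‖ ^ 2) + truncEnergy n (U k)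
      ≤ truncEnergy n u₀
  sum_le : ∑ j ∈ Finset.range m, (T / m)⁻¹ * ‖(U (j + 1)).toL2 - (U j).toL2‖ ^ 2 ≤ B

/-- B, hence T = 1/B, comes from energy and coercivity bounds uniform in n. The Lipschitz constant L
depends on n, but it restricts only the time step. -/
theorem exists_isDiscreteSolution (hs : 0 < s) (u₀ : W0 Ω s p) :
    ∃ T M R B : ℝ, 0 < T ∧ 0 < B ∧ ∀ n, ∃ m U, IsDiscreteSolution T M R B u₀ n m U := by
  have hp := hp2.out
  have hp0 : 0 < p := by linarith
  set M := ‖u₀.toL2‖ + 2 with hM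
  obtain ⟨C, hC⟩ := exists_le_truncEnergy (p := p) Ω hs M
  obtain ⟨E, hE⟩ := exists_truncEnergy_le hs u₀
  have hEC : 0 ≤ E + C := by
    have h1 := hC 0 u₀ (by rw [hM]; linarith)
    have h2 : 0 ≤ ‖u₀‖ ^ p / (2 * p) := by positivity
    linarith [hE 0]
  -- At least half of the dissipation is retained, so it sums to at most 2(E + C); the `+ 1` ensures
  -- B > 0.
  set B := 2 * (E + C) + 1 with hB
  have hB0 : 0 < B := by linarith
  set T := 1 / B with hT
  have hT0 : 0 < T := by positivity
  refine ⟨T, M, 1 + 2 * p * (E + C), B, hT0, hB0, fun n => ?_⟩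
  obtain ⟨L, hL0, hL⟩ := exists_truncSource_sub_le hp n
  -- The single condition τX ≤ 1 contains all the smallness needed: Lτ ≤ 1/4 for minimizers, Lτ(n +
  -- 1) ≤ 1 for the dissipation factor, and the bound for the crude increment.
  set X := 4 * L + L * ((n : ℝ) + 1) + 4 * (|E| + L * M ^ 2) with hX
  have hX0 : 0 ≤ X := by positivity
  set m := ⌈T * X⌉₊ + n + 1 with hm
  have hm0 : (0 : ℝ) < m := by rw [hm]; positivity
  set τ := T / m with hτ
  have hτ0 : 0 < τ := by positivity
  have hτX : τ * X ≤ 1 := by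
    rw [hτ, div_mul_eq_mul_div, div_le_one hm0, hm]
    push_cast
    linarith [Nat.le_ceil (T * X), (Nat.cast_nonneg n : (0 : ℝ) ≤ n)]
  have hmτ : (m : ℝ) * τ = T := mul_div_cancel₀ T hm0.ne'
  have hn1 : (0 : ℝ) < (n : ℝ) + 1 := by positivity
  have hp1 : 0 ≤ τ * L := by positivity
  have hp2' : 0 ≤ τ * (L * ((n : ℝ) + 1)) := by positivity
  have hp3 : 0 ≤ τ * (|E| + L * M ^ 2) := by positivity
  have hsplit : 4 * (τ * L) + τ * (L * ((n : ℝ) + 1)) + 4 * (τ * (|E| + L * M ^ 2)) ≤ 1 := by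
    refine le_trans (le_of_eq ?_) hτX
    rw [hX]
    ring
  have hLτ : L * τ ≤ 1 / 4 := by linarith
  have hLn : L * τ / 2 ≤ 1 / ((n : ℝ) + 1) := by
    rw [le_div_iff₀ hn1]
    linarith
  have hEτ : 4 * τ * (E + L * M ^ 2) ≤ 1 := by
    have := mul_le_mul_of_nonneg_left (le_abs_self E) hτ0.le
    linarith
  choose step hstep using fun u : W0 Ω s p => exists_minimizer hs hL0 hτ0 hLτ hL u.toL2
  set U : ℕ → W0 Ω s p := fun k => step^[k] u₀ with hU
  have hU0 : U 0 = u₀ := rfl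
  have hUs : ∀ k, U (k + 1) = step (U k) := fun k => Function.iterate_succ_apply' step k u₀
  have hVI : ∀ k (w : W0 Ω s p), inner ℝ (truncSourceL2 n (U (k + 1)) - τ⁻¹ • ((U (k + 1)).toL2 - (U k).toL2))
      (w.toL2 - (U (k + 1)).toL2) ≤ ‖w‖ ^ p / p - ‖U (k + 1)‖ ^ p / p := by
    intro k w
    refine inner_le_of_minimizer hs hτ0 hL ?_ w
    rw [hUs]
    exact hstep (U k)
  have hdis : ∀ k, (τ⁻¹ - L / 2) * ‖(U (k + 1)).toL2 - (U k).toL2‖ ^ 2 + truncEnergy n (U (k + 1))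
      ≤ truncEnergy n (U k) := fun k => truncEnergy_step_le hL (hVI k (U k))
  -- Used with c = 0 for decay of energy, c = 1/2 for the bound of the dissipation, and c = 1 - 1/(n
  -- + 1) for `energy_le`.
  have hen : ∀ c, c ≤ 1 - L * τ / 2 → ∀ k,
      c * (∑ j ∈ Finset.range k, τ⁻¹ * ‖(U (j + 1)).toL2 - (U j).toL2‖ ^ 2) + truncEnergy n (U k)
        ≤ truncEnergy n u₀ := by
    intro c hc k
    induction k with
    | zero => simp [hU0]
    | succ k ih =>
      rw [Finset.sum_range_succ, mul_add]
      have h1 := hdis k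
      have h2 : c * (τ⁻¹ * ‖(U (k + 1)).toL2 - (U k).toL2‖ ^ 2)
          ≤ (τ⁻¹ - L / 2) * ‖(U (k + 1)).toL2 - (U k).toL2‖ ^ 2 := by
        rw [← mul_assoc]
        refine mul_le_mul_of_nonneg_right ?_ (sq_nonneg _)
        have := mul_le_mul_of_nonneg_right hc (inv_nonneg.2 hτ0.le)
        refine this.trans_eq ?_
        field_simp
      linarith
  have hsum : ∀ k, ‖(U k).toL2‖ ≤ M →
      ∑ j ∈ Finset.range k, τ⁻¹ * ‖(U (j + 1)).toL2 - (U j).toL2‖ ^ 2 ≤ B := by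
    intro k hk
    have h1 := hen (1 / 2) (by linarith) k
    have h2 := hC n (U k) hk
    have h3 : 0 ≤ ‖U k‖ ^ p / (2 * p) := by positivity
    linarith [hE n]
  have hclose : ∀ k ≤ m, ‖(U k).toL2 - u₀.toL2‖ ≤ 1 := by
    refine norm_sub_le_one_of_sum_le (x := fun k => (U k).toL2) hτ0 ?_ (M := M) le_rfl ?_ hsum
    · rw [← mul_assoc, hmτ, hT, one_div_mul_cancel hB0.ne']
    · intro k hk
      refine norm_sub_le_one_of_step hL0 hτ0 hLτ hEτ hL (by linarith) ?_ (hdis k)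
      have := hen 0 (by linarith) k
      rw [zero_mul, zero_add] at this
      exact this.trans (hE n)
  have hMk : ∀ k ≤ m, ‖(U k).toL2‖ ≤ M := by
    intro k hk
    have := norm_add_le ((U k).toL2 - u₀.toL2) u₀.toL2
    rw [sub_add_cancel] at this
    linarith [hclose k hk]
  refine ⟨m, U, by omega, by omega, hU0, hMk, ?_, fun k _ => hVI k, fun k _ => hen _ (by linarith) k,
    hsum m (hMk m le_rfl)⟩
  intro k hk
  have h1 := hen 0 (by linarith) k
  have h2 := hC n (U k) (hMk k hk)
  rw [zero_mul, zero_add] at h1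
  have h3 : ‖U k‖ ^ p ≤ 2 * p * (E + C) := by
    have : ‖U k‖ ^ p / (2 * p) ≤ E + C := by linarith [hE n]
    rwa [div_le_iff₀ (by positivity), mul_comm] at this
  have h4 : 0 ≤ ‖U k‖ ^ p := by positivity
  rcases le_total ‖U k‖ 1 with h | h
  · linarith
  · have := Real.rpow_le_rpow_of_exponent_le h (by linarith : 1 ≤ p)
    rw [Real.rpow_one] at this
    linarith

end W0

/-! ### Piecewise constant interpolation in time -/

/-- The index of the interval `((k - 1) τ, k τ]` that contains `t`. -/
def stepIndex (τ t : ℝ) : ℕ := ⌈t / τ⌉₊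

theorem measurable_stepIndex (τ : ℝ) : Measurable (stepIndex τ) :=
  Nat.measurable_ceil.comp (measurable_id.div_const τ)

theorem stepIndex_zero (τ : ℝ) : stepIndex τ 0 = 0 := by simp [stepIndex]

theorem stepIndex_pos {τ t : ℝ} (hτ : 0 < τ) (ht : 0 < t) : 0 < stepIndex τ t :=
  Nat.ceil_pos.2 (div_pos ht hτ)

theorem le_stepIndex_mul {τ : ℝ} (hτ : 0 < τ) (t : ℝ) : t ≤ stepIndex τ t * τ :=
  (div_le_iff₀ hτ).1 (Nat.le_ceil _)

theorem stepIndex_mul_lt {τ t : ℝ} (hτ : 0 < τ) (ht : 0 ≤ t) : stepIndex τ t * τ < t + τ := by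
  have := mul_lt_mul_of_pos_right (Nat.ceil_lt_add_one (div_nonneg ht hτ.le)) hτ
  rwa [add_mul, one_mul, div_mul_cancel₀ _ hτ.ne'] at this

theorem stepIndex_mono {τ a b : ℝ} (hτ : 0 < τ) (hab : a ≤ b) : stepIndex τ a ≤ stepIndex τ b :=
  Nat.ceil_mono (div_le_div_of_nonneg_right hab hτ.le)

theorem stepIndex_le {T t : ℝ} {m : ℕ} (hT : 0 < T) (hm : 0 < m) (ht : t ≤ T) :
    stepIndex (T / m) t ≤ m := by
  have hm' : (0 : ℝ) < m := Nat.cast_pos.2 hm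
  refine Nat.ceil_le.2 ?_
  rw [div_le_iff₀ (by positivity), mul_div_cancel₀ _ hm'.ne']
  exact ht

theorem stepIndex_eq {τ t : ℝ} {k : ℕ} (hτ : 0 < τ) (h1 : k * τ < t) (h2 : t ≤ ((k + 1 : ℕ) : ℝ) * τ) :
    stepIndex τ t = k + 1 := by
  refine le_antisymm (Nat.ceil_le.2 ((div_le_iff₀ hτ).2 h2)) ?_
  exact Nat.lt_ceil.2 ((lt_div_iff₀ hτ).2 h1)

section StepIntegral

variable {E : Type*} [NormedAddCommGroup E]

theorem stronglyMeasurable_comp_stepIndex {β : Type*} [TopologicalSpace β] (τ : ℝ) (a : ℕ → β) :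
    StronglyMeasurable fun t => a (stepIndex τ t) :=
  (StronglyMeasurable.of_discrete (f := a)).comp_measurable (measurable_stepIndex τ)

theorem intervalIntegrable_comp_stepIndex (τ : ℝ) (a : ℕ → E) (b c : ℝ) :
    IntervalIntegrable (fun t => a (stepIndex τ t)) volume b c := by
  wlog hbc : b ≤ c generalizing b c
  · exact (this c b (le_of_not_ge hbc)).symm
  rw [intervalIntegrable_iff_integrableOn_Ioc_of_le hbc]
  obtain ⟨C, hC⟩ : ∃ C, ∀ t ∈ Ioc b c, ‖a (stepIndex τ t)‖ ≤ C := by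
    obtain ⟨K, hK⟩ : ∃ K, ∀ t ∈ Ioc b c, stepIndex τ t ≤ K := by
      refine ⟨⌈max (b / τ) (c / τ)⌉₊, fun t ht => Nat.ceil_mono ?_⟩
      rcases le_total 0 τ with h | h
      · exact (div_le_div_of_nonneg_right ht.2 h).trans (le_max_right _ _)
      · exact (div_le_div_of_nonpos_of_le h ht.1.le).trans (le_max_left _ _)
    refine ⟨∑ j ∈ Finset.range (K + 1), ‖a j‖, fun t ht => ?_⟩
    exact Finset.single_le_sum (f := fun j => ‖a j‖) (fun _ _ => norm_nonneg _)
      (Finset.mem_range.2 (Nat.lt_succ_of_le (hK t ht)))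
  refine Integrable.mono' (g := fun _ => C) (integrableOn_const (by simp))
    (stronglyMeasurable_comp_stepIndex τ a).aestronglyMeasurable ?_
  exact (ae_restrict_iff' measurableSet_Ioc).2 (Filter.Eventually.of_forall hC)

variable [NormedSpace ℝ E] [CompleteSpace E]

theorem integral_comp_stepIndex_of_mem {τ : ℝ} (hτ : 0 < τ) (a : ℕ → E) {k : ℕ} {b c : ℝ}
    (hb : k * τ ≤ b) (hbc : b ≤ c) (hc : c ≤ ((k + 1 : ℕ) : ℝ) * τ) :
    ∫ t in b..c, a (stepIndex τ t) = (c - b) • a (k + 1) := by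
  rw [← intervalIntegral.integral_const]
  refine intervalIntegral.integral_congr_ae (Filter.Eventually.of_forall fun t ht => ?_)
  rw [uIoc_of_le hbc] at ht
  rw [stepIndex_eq hτ (hb.trans_lt ht.1) (ht.2.trans hc)]

theorem integral_comp_stepIndex {τ : ℝ} (hτ : 0 < τ) (a : ℕ → E) (k : ℕ) :
    ∫ t in (0)..(k * τ), a (stepIndex τ t) = τ • ∑ j ∈ Finset.range k, a (j + 1) := by
  induction k with
  | zero => simp
  | succ k ih =>
    rw [← intervalIntegral.integral_add_adjacent_intervals
      (intervalIntegrable_comp_stepIndex τ a 0 (k * τ))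
      (intervalIntegrable_comp_stepIndex τ a (k * τ) (((k + 1 : ℕ) : ℝ) * τ)), ih,
      integral_comp_stepIndex_of_mem hτ a le_rfl (by push_cast; linarith) le_rfl,
      Finset.sum_range_succ, smul_add]
    congr 2
    push_cast
    ring

end StepIntegral

namespace W0

variable {N : ℕ} {Ω : BoundedLipschitzDomain N} {s p : ℝ} [hp2 : Fact (2 ≤ p)]

/-- The difference quotients of a discrete curve. -/
def diffQuot (τ : ℝ) (U : ℕ → W0 Ω s p) (k : ℕ) : L2 Ω :=
  -- At k = 0 natural subtraction makes the quotient zero.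
  τ⁻¹ • ((U k).toL2 - (U (k - 1)).toL2)

theorem diffQuot_succ (τ : ℝ) (U : ℕ → W0 Ω s p) (k : ℕ) :
    diffQuot τ U (k + 1) = τ⁻¹ • ((U (k + 1)).toL2 - (U k).toL2) := rfl

theorem memLp_diffQuot (U : ℕ → W0 Ω s p) (τ T : ℝ) :
    MemLp (fun t => diffQuot τ U (stepIndex τ t)) 2 (volume.restrict (Ioo 0 T)) := by
  rw [memLp_two_iff_integrable_sq_norm
    (stronglyMeasurable_comp_stepIndex τ (diffQuot τ U)).aestronglyMeasurable]
  rcases le_total 0 T with hT | hT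
  · exact ((intervalIntegrable_iff_integrableOn_Ioo_of_le hT).1
      (intervalIntegrable_comp_stepIndex τ (fun k => ‖diffQuot τ U k‖ ^ 2) 0 T))
  · rw [Ioo_eq_empty (not_lt.2 hT)]
    simp

namespace IsDiscreteSolution

variable [NeZero N] {T M R B : ℝ} {u₀ : W0 Ω s p} {n m : ℕ} {U : ℕ → W0 Ω s p}

theorem step_pos (h : IsDiscreteSolution T M R B u₀ n m U) (hT : 0 < T) : 0 < T / m :=
  div_pos hT (Nat.cast_pos.2 h.pos)

theorem integral_norm_sq_diffQuot (h : IsDiscreteSolution T M R B u₀ n m U) (hT : 0 < T) (k : ℕ) :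
    ∫ t in (0)..(k * (T / m)), ‖diffQuot (T / m) U (stepIndex (T / m) t)‖ ^ 2
      = ∑ j ∈ Finset.range k, (T / m)⁻¹ * ‖(U (j + 1)).toL2 - (U j).toL2‖ ^ 2 := by
  have hτ := h.step_pos hT
  rw [integral_comp_stepIndex hτ (fun k => ‖diffQuot (T / m) U k‖ ^ 2), smul_eq_mul, Finset.mul_sum]
  refine Finset.sum_congr rfl fun j _ => ?_
  rw [diffQuot_succ, norm_smul, mul_pow, Real.norm_of_nonneg (inv_nonneg.2 hτ.le)]
  field_simp

theorem integral_norm_sq_le (h : IsDiscreteSolution T M R B u₀ n m U) (hT : 0 < T) :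
    ∫ t in (0)..T, ‖diffQuot (T / m) U (stepIndex (T / m) t)‖ ^ 2 ≤ B := by
  have h1 := h.integral_norm_sq_diffQuot hT m
  rw [mul_div_cancel₀ _ (Nat.cast_pos.2 h.pos).ne'] at h1
  rw [h1]
  exact h.sum_le

theorem norm_toL2_step_le (h : IsDiscreteSolution T M R B u₀ n m U) (hT : 0 < T) {t : ℝ}
    (ht : t ≤ T) : ‖(U (stepIndex (T / m) t)).toL2‖ ≤ M :=
  h.norm_toL2_le _ (stepIndex_le hT h.pos ht)

theorem norm_step_le (h : IsDiscreteSolution T M R B u₀ n m U) (hT : 0 < T) {t : ℝ}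
    (ht : t ≤ T) : ‖U (stepIndex (T / m) t)‖ ≤ R :=
  h.norm_le _ (stepIndex_le hT h.pos ht)

/-- Rounding up to the grid lengthens the interval by at most one step, whence the error T / m in an
otherwise Hölder-1/2 estimate. -/
theorem norm_sub_sq_step_le (h : IsDiscreteSolution T M R B u₀ n m U) (hT : 0 < T) (hB : 0 ≤ B)
    {a b : ℝ} (ha : 0 ≤ a) (hab : a ≤ b) (hb : b ≤ T) :
    ‖(U (stepIndex (T / m) b)).toL2 - (U (stepIndex (T / m) a)).toL2‖ ^ 2
      ≤ B * (b - a + T / m) := by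
  have hτ := h.step_pos hT
  set τ := T / m with hτdef
  have h1 := norm_sub_sq_le_sum (fun k => (U k).toL2) (stepIndex_mono hτ hab)
  have h2 : ∑ j ∈ Finset.Ico (stepIndex τ a) (stepIndex τ b), ‖(U (j + 1)).toL2 - (U j).toL2‖ ^ 2
      ≤ τ * B := by
    rw [← inv_mul_le_iff₀ hτ, Finset.mul_sum]
    refine le_trans (Finset.sum_le_sum_of_subset_of_nonneg ?_ fun _ _ _ => by positivity) h.sum_le
    intro j hj
    rw [Finset.mem_Ico] at hj
    exact Finset.mem_range.2 (hj.2.trans_le (stepIndex_le hT h.pos hb))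
  have h3 : (stepIndex τ b : ℝ) * τ - stepIndex τ a * τ ≤ b - a + τ := by
    have := stepIndex_mul_lt hτ (ha.trans hab)
    have := le_stepIndex_mul hτ a
    linarith
  have h4 : (0 : ℝ) ≤ (stepIndex τ b : ℝ) - stepIndex τ a :=
    sub_nonneg.2 (Nat.cast_le.2 (stepIndex_mono hτ hab))
  refine h1.trans ((mul_le_mul_of_nonneg_left h2 h4).trans ?_)
  have := mul_le_mul_of_nonneg_left h3 hB
  refine le_trans (le_of_eq ?_) this
  ring

/-- The integral of the difference quotients is the piecewise affine interpolant. It differs from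
the piecewise constant one by at most one increment, whose square is at most τB. -/
theorem norm_sub_integral_sq_le (h : IsDiscreteSolution T M R B u₀ n m U) (hT : 0 < T)
    {t : ℝ} (ht0 : 0 ≤ t) (ht : t ≤ T) :
    ‖(U (stepIndex (T / m) t)).toL2 - u₀.toL2
      - ∫ x in (0)..t, diffQuot (T / m) U (stepIndex (T / m) x)‖ ^ 2 ≤ T / m * B := by
  have hτ := h.step_pos hT
  set τ := T / m with hτdef
  rcases eq_or_lt_of_le ht0 with rfl | htpos
  · rw [stepIndex_zero, h.zero]
    have : 0 ≤ B := le_trans (Finset.sum_nonneg fun _ _ => by positivity) h.sum_le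
    simp
    positivity
  obtain ⟨k, hk⟩ : ∃ k, stepIndex τ t = k + 1 :=
    Nat.exists_eq_succ_of_ne_zero (stepIndex_pos hτ htpos).ne'
  have hkm : k < m := by
    have := stepIndex_le hT h.pos ht
    rw [← hτdef, hk] at this
    omega
  have h1 := integral_comp_stepIndex hτ (diffQuot τ U) (k + 1)
  have h2 : τ • ∑ j ∈ Finset.range (k + 1), diffQuot τ U (j + 1) = (U (k + 1)).toL2 - u₀.toL2 := by
    simp only [diffQuot_succ]
    rw [← Finset.smul_sum, smul_smul, mul_inv_cancel₀ hτ.ne', one_smul,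
      Finset.sum_range_sub (fun k => (U k).toL2), h.zero]
  have h3 := intervalIntegral.integral_add_adjacent_intervals
    (intervalIntegrable_comp_stepIndex τ (diffQuot τ U) 0 t)
    (intervalIntegrable_comp_stepIndex τ (diffQuot τ U) t (((k + 1 : ℕ) : ℝ) * τ))
  have hle := le_stepIndex_mul hτ t
  have hlt := stepIndex_mul_lt hτ ht0
  rw [hk] at hle hlt
  have hkt : (k : ℝ) * τ ≤ t := by
    push_cast at hlt
    linarith
  have h4 := integral_comp_stepIndex_of_mem hτ (diffQuot τ U) hkt hle le_rfl
  have h5 : (U (k + 1)).toL2 - u₀.toL2 - ∫ x in (0)..t, diffQuot τ U (stepIndex τ x)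
      = (((k + 1 : ℕ) : ℝ) * τ - t) • diffQuot τ U (k + 1) := by
    rw [← h2, ← h1, ← h3, h4]
    abel
  rw [hk, h5, norm_smul, diffQuot_succ, norm_smul, mul_pow, mul_pow,
    Real.norm_of_nonneg (by linarith), Real.norm_of_nonneg (inv_nonneg.2 hτ.le)]
  have h6 : (τ)⁻¹ * ‖(U (k + 1)).toL2 - (U k).toL2‖ ^ 2 ≤ B := by
    refine le_trans ?_ h.sum_le
    exact Finset.single_le_sum (f := fun j => τ⁻¹ * ‖(U (j + 1)).toL2 - (U j).toL2‖ ^ 2)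
      (fun _ _ => by positivity) (Finset.mem_range.2 hkm)
  have h7 : (((k + 1 : ℕ) : ℝ) * τ - t) ^ 2 ≤ τ ^ 2 :=
    pow_le_pow_left₀ (by linarith) (by linarith) 2
  calc _ ≤ τ ^ 2 * (τ⁻¹ ^ 2 * ‖(U (k + 1)).toL2 - (U k).toL2‖ ^ 2) := by gcongr
    _ = τ * (τ⁻¹ * ‖(U (k + 1)).toL2 - (U k).toL2‖ ^ 2) := by field_simp
    _ ≤ τ * B := by gcongr

theorem energy_step_le (h : IsDiscreteSolution T M R B u₀ n m U) (hT : 0 < T) {t : ℝ}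
    (ht0 : 0 ≤ t) (ht : t ≤ T) :
    (1 - 1 / ((n : ℝ) + 1)) * (∫ x in (0)..t, ‖diffQuot (T / m) U (stepIndex (T / m) x)‖ ^ 2)
      + truncEnergy n (U (stepIndex (T / m) t)) ≤ truncEnergy n u₀ := by
  have hτ := h.step_pos hT
  have h1 := h.energy_le _ (stepIndex_le hT h.pos ht)
  rw [← h.integral_norm_sq_diffQuot hT] at h1
  refine le_trans (add_le_add (mul_le_mul_of_nonneg_left ?_ ?_) le_rfl) h1
  · refine intervalIntegral.integral_mono_interval le_rfl ht0 (le_stepIndex_mul hτ t)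
      (Filter.Eventually.of_forall fun x => sq_nonneg _)
      (intervalIntegrable_comp_stepIndex (T / m) (fun k => ‖diffQuot (T / m) U k‖ ^ 2) _ _)
  · rw [sub_nonneg, div_le_one (by positivity)]
    linarith [(Nat.cast_nonneg n : (0 : ℝ) ≤ n)]

theorem inner_step_le (h : IsDiscreteSolution T M R B u₀ n m U) (hT : 0 < T) {t : ℝ}
    (ht0 : 0 < t) (ht : t ≤ T) (w : W0 Ω s p) :
    inner ℝ (truncSourceL2 n (U (stepIndex (T / m) t)) - diffQuot (T / m) U (stepIndex (T / m) t))
      (w.toL2 - (U (stepIndex (T / m) t)).toL2)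
      ≤ ‖w‖ ^ p / p - ‖U (stepIndex (T / m) t)‖ ^ p / p := by
  have hτ := h.step_pos hT
  obtain ⟨k, hk⟩ : ∃ k, stepIndex (T / m) t = k + 1 :=
    Nat.exists_eq_succ_of_ne_zero (stepIndex_pos hτ ht0).ne'
  have hkm := stepIndex_le hT h.pos ht
  rw [hk] at hkm ⊢
  exact h.inner_le k (by omega) w

end IsDiscreteSolution

end W0

/-! ### Compactness in time and the limit curve -/

/-- A compactness principle for curves with values in a compact set that are equicontinuous up to
an error tending to zero. -/
theorem exists_subseq_tendsto_of_sq_le {H : Type*} [NormedAddCommGroup H] {C : Set H}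
    (hC : IsCompact C) {T B : ℝ} (hT : 0 ≤ T) (hB : 0 ≤ B) {x : ℕ → ℝ → H} {σ : ℕ → ℝ}
    (hσ : Filter.Tendsto σ Filter.atTop (𝓝 0)) (hx : ∀ n, ∀ t ∈ Icc 0 T, x n t ∈ C)
    (hmod : ∀ n a b, 0 ≤ a → a ≤ b → b ≤ T → ‖x n b - x n a‖ ^ 2 ≤ B * (b - a + σ n)) :
    ∃ (w : ℝ → H) (φ : ℕ → ℕ), StrictMono φ ∧
      ∀ t ∈ Icc 0 T, Filter.Tendsto (fun n => x (φ n) t) Filter.atTop (𝓝 (w t)) := by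
  have hclamp : ∀ q : ℝ, max 0 (min T q) ∈ Icc 0 T := fun q =>
    ⟨le_max_left _ _, max_le hT (min_le_left _ _)⟩
  have hsym : ∀ n, ∀ a ∈ Icc 0 T, ∀ b ∈ Icc 0 T, ‖x n b - x n a‖ ^ 2 ≤ B * (|b - a| + σ n) := by
    intro n a ha b hb
    rcases le_total a b with h | h
    · rw [abs_of_nonneg (sub_nonneg.2 h)]
      exact hmod n a b ha.1 h hb.2
    · rw [abs_of_nonpos (sub_nonpos.2 h), neg_sub, norm_sub_rev]
      exact hmod n b a hb.1 h ha.2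
  -- Tychonoff over the rationals, clamped to [0, T], gives one subsequence for a dense set of
  -- times; equicontinuity up to σ extends convergence to all times.
  have hpi : IsCompact (Set.pi univ fun _ : ℚ => C) := isCompact_univ_pi fun _ => hC
  obtain ⟨y, -, φ, hφ, hy⟩ := hpi.tendsto_subseq (x := fun n (q : ℚ) => x n (max 0 (min T (q : ℝ))))
    fun n q _ => hx n _ (hclamp q)
  rw [tendsto_pi_nhds] at hy
  have hlim : ∀ t ∈ Icc 0 T, ∃ z, Filter.Tendsto (fun n => x (φ n) t) Filter.atTop (𝓝 z) := by
    intro t ht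
    suffices h : CauchySeq fun n => x (φ n) t by
      obtain ⟨z, -, hz⟩ := cauchySeq_tendsto_of_isComplete hC.isComplete (fun n => hx (φ n) t ht) h
      exact ⟨z, hz⟩
    rw [Metric.cauchySeq_iff]
    intro ε hε
    -- η bounds both the time gap and σ, so that B · 2η ≤ (ε/4)².
    set η := (ε / 4) ^ 2 / (2 * (B + 1)) with hη
    have hη0 : 0 < η := by positivity
    obtain ⟨q, hq1, hq2⟩ := exists_rat_btwn (lt_add_of_pos_right t hη0)
    set a := max 0 (min T (q : ℝ)) with ha
    have haI : a ∈ Icc 0 T := hclamp q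
    have hta : |t - a| ≤ η := by
      have h1 : t ≤ a := (le_min ht.2 hq1.le).trans (le_max_right _ _)
      have h2 : a ≤ t + η := max_le (by linarith [ht.1]) ((min_le_right _ _).trans hq2.le)
      rw [abs_le]
      constructor <;> linarith
    have hcs := (hy q).cauchySeq
    rw [Metric.cauchySeq_iff] at hcs
    obtain ⟨K₁, hK₁⟩ := hcs (ε / 4) (by positivity)
    obtain ⟨K₂, hK₂⟩ := Filter.eventually_atTop.1
      ((hσ.comp hφ.tendsto_atTop).eventually_le_const hη0)
    have hclose : ∀ k ≥ K₂, dist (x (φ k) t) (x (φ k) a) ≤ ε / 4 := by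
      intro k hk
      rw [dist_eq_norm]
      refine (sq_le_sq₀ (norm_nonneg _) (by positivity)).1 ?_
      refine (hsym (φ k) a haI t ht).trans ?_
      have h1 : |t - a| + σ (φ k) ≤ 2 * η := by
        have : σ (φ k) ≤ η := hK₂ k hk
        linarith
      calc B * (|t - a| + σ (φ k)) ≤ B * (2 * η) := mul_le_mul_of_nonneg_left h1 hB
        _ ≤ (B + 1) * (2 * η) := mul_le_mul_of_nonneg_right (by linarith) (by positivity)
        _ = (ε / 4) ^ 2 := by
          rw [hη]
          field_simp
    refine ⟨max K₁ K₂, fun k hk l hl => ?_⟩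
    have h1 := hclose k ((le_max_right _ _).trans hk)
    have h2 := hclose l ((le_max_right _ _).trans hl)
    have h3 : dist (x (φ k) a) (x (φ l) a) < ε / 4 :=
      hK₁ k ((le_max_left _ _).trans hk) l ((le_max_left _ _).trans hl)
    have h4 := dist_triangle4 (x (φ k) t) (x (φ k) a) (x (φ l) a) (x (φ l) t)
    rw [dist_comm (x (φ l) a)] at h4
    linarith
  choose! w hw using hlim
  exact ⟨w, φ, hφ, hw⟩

namespace W0

variable {N : ℕ} [NeZero N] {Ω : BoundedLipschitzDomain N} {s p : ℝ} [hp2 : Fact (2 ≤ p)]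

theorem tendsto_integral_truncPotential (hs : 0 < s) {n : ℕ → ℕ}
    (hn : Filter.Tendsto n Filter.atTop Filter.atTop) {M R : ℝ} {v : ℕ → W0 Ω s p}
    {u : W0 Ω s p} (hM : ∀ k, ‖(v k).toL2‖ ≤ M) (hR : ∀ k, ‖v k‖ ≤ R)
    (hv : Filter.Tendsto (fun k => (v k).toL2) Filter.atTop (𝓝 u.toL2)) :
    Filter.Tendsto (fun k => ∫ x in Ω.carrier, truncPotential p (n k) (v k x)) Filter.atTop
      (𝓝 (∫ x in Ω.carrier, logPotential p (u x))) := by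
  have hp := hp2.out
  obtain ⟨r, C, hr1, hr2, hC0, -, -, hC, -⟩ := exists_exponent_and_bounds N hs hp
  refine tendsto_integral_comp hs (D := 2 * C) (r := r) (by positivity) (by linarith) hr2 hM hM hR hR
    hv hv (F := fun k a _ => truncPotential p (n k) a) (F' := fun a _ => logPotential p a)
    (fun k => (continuous_truncPotential hp (n k)).comp continuous_fst) ?_ ?_
  · intro k a b
    refine (hC (n k) a).trans ?_
    have : 0 ≤ |b| ^ r := by positivity
    exact mul_le_mul_of_nonneg_left (by linarith) (by positivity)
  · intro ns hns a b a' b' ha hb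
    exact tendsto_truncPotential hp ha (hn.comp hns)

theorem tendsto_inner_truncSourceL2 (hs : 0 < s) {n : ℕ → ℕ}
    (hn : Filter.Tendsto n Filter.atTop Filter.atTop) {M R : ℝ} {v z : ℕ → W0 Ω s p}
    {u y : W0 Ω s p} (hM : ∀ k, ‖(v k).toL2‖ ≤ M) (hR : ∀ k, ‖v k‖ ≤ R)
    (hzM : ∀ k, ‖(z k).toL2‖ ≤ M) (hzR : ∀ k, ‖z k‖ ≤ R)
    (hv : Filter.Tendsto (fun k => (v k).toL2) Filter.atTop (𝓝 u.toL2))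
    (hz : Filter.Tendsto (fun k => (z k).toL2) Filter.atTop (𝓝 y.toL2)) :
    Filter.Tendsto (fun k => inner ℝ (truncSourceL2 (n k) (v k)) (z k).toL2) Filter.atTop
      (𝓝 (∫ x in Ω.carrier, logSource p (u x) * y x)) := by
  have hp := hp2.out
  obtain ⟨r, C, hr1, hr2, hC0, -, hC, -, -⟩ := exists_exponent_and_bounds N hs hp
  simp only [inner_truncSourceL2]
  refine tendsto_integral_comp hs (D := 2 * C) (r := r) (by positivity) (by linarith) hr2 hM hzM hR
    hzR hv hz (F := fun k a b => truncSource p (n k) a * b) (F' := fun a b => logSource p a * b)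
    (fun k => ((continuous_truncSource hp (n k)).comp continuous_fst).mul continuous_snd) ?_ ?_
  · exact fun k a b => growth_mul_le hC0.le (by linarith) (hC (n k) a)
  · intro ns hns a b a' b' ha hb
    exact (tendsto_truncSource hp ha (hn.comp hns)).mul hb

theorem exists_abs_inner_truncSourceL2_le (Ω : BoundedLipschitzDomain N) (hs : 0 < s) (M R : ℝ) :
    ∃ B, ∀ (n : ℕ) (u z : W0 Ω s p), ‖u.toL2‖ ≤ M → ‖z.toL2‖ ≤ M → ‖u‖ ≤ R → ‖z‖ ≤ R →
      |inner ℝ (truncSourceL2 n u) z.toL2| ≤ B := by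
  have hp := hp2.out
  obtain ⟨r, C, hr1, hr2, hC0, -, hC, -, -⟩ := exists_exponent_and_bounds N hs hp
  obtain ⟨B, hB⟩ := exists_integral_growth_bound (p := p) (D := 2 * C) (r := r) Ω hs M R
    (by positivity) (by linarith) hr2
  refine ⟨B, fun n u z hu hz huR hzR => ?_⟩
  rw [inner_truncSourceL2]
  exact (hB u z hu hz huR hzR _ (integrable_truncSource_mul n u z).1
    fun x => growth_mul_le hC0.le (by linarith) (hC n (u x))).2

theorem IsDiscreteSolution.norm_sq_toLp_le {T M R B : ℝ} {u₀ : W0 Ω s p} {n m : ℕ}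
    {U : ℕ → W0 Ω s p} (h : IsDiscreteSolution T M R B u₀ n m U) (hT : 0 < T) :
    ‖(memLp_diffQuot U (T / m) T).toLp _‖ ^ 2 ≤ B := by
  refine le_trans (le_of_eq ?_) (h.integral_norm_sq_le hT)
  rw [← real_inner_self_eq_norm_sq, L2.inner_def, intervalIntegral.integral_of_le hT.le,
    integral_Ioc_eq_integral_Ioo]
  refine integral_congr_ae ?_
  filter_upwards [(memLp_diffQuot U (T / m) T).coeFn_toLp] with t ht
  rw [ht, real_inner_self_eq_norm_sq]

/-- `u`, with time derivative `ut`, is a limit of discrete solutions along which the truncation level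
and the time step are removed. -/
structure IsLimitCurve (T M R B : ℝ) (u₀ : W0 Ω s p) (n m : ℕ → ℕ) (U : ℕ → ℕ → W0 Ω s p)
    (u : ℝ → W0 Ω s p) (ut : Lp (L2 Ω) 2 (volume.restrict (Ioo 0 T))) : Prop where
  pos : 0 < T
  tendsto_level : Filter.Tendsto n Filter.atTop Filter.atTop
  discrete : ∀ k, IsDiscreteSolution T M R B u₀ (n k) (m k) (U k)
  tendsto_toL2 : ∀ t ∈ Icc 0 T, Filter.Tendsto (fun k => (U k (stepIndex (T / m k) t)).toL2)
    Filter.atTop (𝓝 (u t).toL2)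
  norm_le : ∀ t, ‖u t‖ ≤ R
  eq_zero : ∀ t, t ∉ Icc 0 T → u t = 0
  tendsto_inner : ∀ ψ, Filter.Tendsto
    (fun k => inner ℝ ((memLp_diffQuot (U k) (T / m k) T).toLp _) ψ) Filter.atTop (𝓝 (inner ℝ ut ψ))

/-- Two extractions: strong convergence at each time, then weak convergence of the difference
quotients. Since the number of steps is at least the truncation level, a single limit removes both.
Extending u by 0 outside [0, T] keeps it measurable and bounded on the whole line. -/
theorem exists_isLimitCurve (hs : 0 < s) (u₀ : W0 Ω s p) :
    ∃ T M R B n m U u ut, IsLimitCurve T M R B u₀ n m U u ut := by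
  obtain ⟨T, M, R, B, hT, hB, hdisc⟩ := exists_isDiscreteSolution hs u₀
  choose m U hU using hdisc
  have hσ : Filter.Tendsto (fun n => T / (m n : ℝ)) Filter.atTop (𝓝 0) := by
    have hm : Filter.Tendsto m Filter.atTop Filter.atTop :=
      Filter.tendsto_atTop_mono (fun n => (hU n).le) Filter.tendsto_id
    exact (tendsto_natCast_atTop_atTop.comp hm).const_div_atTop T
  obtain ⟨w, φ, hφ, hw⟩ := exists_subseq_tendsto_of_sq_le
    (isCompact_image_toL2 (Ω := Ω) (p := p) hs M R) hT.le hB.le hσ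
    (x := fun n t => (U n (stepIndex (T / m n) t)).toL2)
    (fun n t ht => ⟨_, ⟨(hU n).norm_toL2_step_le hT ht.2, (hU n).norm_step_le hT ht.2⟩, rfl⟩)
    (fun n a b ha hab hb => (hU n).norm_sub_sq_step_le hT hB.le ha hab hb)
  have : Fact ((2 : ℝ≥0∞) ≠ ⊤) := ⟨by simp⟩
  obtain ⟨ut, ψ, hψ, hut⟩ := exists_subseq_tendsto_inner
    (x := fun k => (memLp_diffQuot (U (φ k)) (T / m (φ k)) T).toLp _) (C := Real.sqrt B)
    fun k => Real.le_sqrt_of_sq_le ((hU (φ k)).norm_sq_toLp_le hT)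
  have hlim : ∀ t, ∃ u : W0 Ω s p, ‖u‖ ≤ R ∧ (t ∈ Icc 0 T → u.toL2 = w t) ∧
      (t ∉ Icc 0 T → u = 0) := by
    intro t
    by_cases ht : t ∈ Icc 0 T
    · obtain ⟨u, hu, huR⟩ := exists_norm_le_of_tendsto hs
        (fun k => (hU (φ k)).norm_step_le hT ht.2) (hw t ht)
      exact ⟨u, huR, fun _ => hu, fun h => absurd ht h⟩
    · refine ⟨0, ?_, fun h => absurd h ht, fun _ => rfl⟩
      rw [norm_zero]
      exact (norm_nonneg _).trans ((hU 0).norm_le 0 (Nat.zero_le _))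
  choose u huR hu hu0 using hlim
  refine ⟨T, M, R, B, fun k => φ (ψ k), fun k => m (φ (ψ k)), fun k => U (φ (ψ k)), u, ut,
    hT, hφ.tendsto_atTop.comp hψ.tendsto_atTop, fun k => hU _, fun t ht => ?_, huR, hu0, hut⟩
  rw [hu t ht]
  exact (hw t ht).comp hψ.tendsto_atTop

end W0

/-! ### Weak time derivatives of primitives -/

/-- Fubini on the triangle x < t: integrating φ' over (x, T) leaves -φ(x), and the constant c drops
out because φ vanishes at both ends. -/
theorem hasWeakTimeDeriv_of_eq_integral {H : Type*} [NormedAddCommGroup H] [NormedSpace ℝ H]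
    [CompleteSpace H] {T : ℝ} {w f : ℝ → H} {c : H} (hf : IntegrableOn f (Ioo 0 T))
    (hw : ∀ t ∈ Ioo 0 T, w t = c + ∫ x in (0)..t, f x) : HasWeakTimeDeriv T w f := by
  intro φ hφ hφc hφs
  rcases le_or_gt T 0 with hT | hT
  · simp [Ioo_eq_empty (not_lt.2 hT)]
  have hout : ∀ t, t ∉ Ioo 0 T → φ t = 0 := fun t ht =>
    image_eq_zero_of_notMem_tsupport fun h => ht (hφs h)
  have hd : Continuous (deriv φ) := hφ.continuous_deriv (by simp)
  have hdi : IntegrableOn (deriv φ) (Ioo 0 T) :=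
    (hd.integrableOn_Icc (a := 0) (b := T)).mono_set Ioo_subset_Icc_self
  have hprim : ∀ a ≤ T, ∫ t in Ioo a T, deriv φ t = -φ a := by
    intro a ha
    rw [← integral_Ioc_eq_integral_Ioo, ← intervalIntegral.integral_of_le ha,
      intervalIntegral.integral_deriv_eq_sub
        (fun x _ => (hφ.differentiable (by simp)).differentiableAt) (hd.intervalIntegrable _ _),
      hout T (by simp), zero_sub]
  set μ := (volume : Measure ℝ).restrict (Ioo 0 T) with hμ
  set G : ℝ → ℝ → H := fun t x => {z : ℝ × ℝ | z.2 < z.1}.indicator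
    (fun z => deriv φ z.1 • f z.2) (t, x) with hG
  have hmeas : MeasurableSet {z : ℝ × ℝ | z.2 < z.1} := measurableSet_lt measurable_snd measurable_fst
  have hGi : Integrable (Function.uncurry G) (μ.prod μ) := (hdi.smul_prod hf).indicator hmeas
  have hin1 : ∀ t ∈ Ioo 0 T, ∫ x, G t x ∂μ = deriv φ t • ∫ x in (0)..t, f x := by
    intro t ht
    have h1 : ∀ x, G t x = (Iio t).indicator (fun x => deriv φ t • f x) x := fun x => by
      simp [hG, indicator]
    simp only [h1]
    rw [integral_indicator measurableSet_Iio, hμ, Measure.restrict_restrict measurableSet_Iio,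
      integral_smul, intervalIntegral.integral_of_le ht.1.le, integral_Ioc_eq_integral_Ioo]
    congr 3
    ext x
    simp only [mem_inter_iff, mem_Iio, mem_Ioo]
    constructor
    · rintro ⟨h1, h2, -⟩
      exact ⟨h2, h1⟩
    · rintro ⟨h1, h2⟩
      exact ⟨h2, h1, h2.trans ht.2⟩
  have hin2 : ∀ x ∈ Ioo 0 T, ∫ t, G t x ∂μ = -(φ x • f x) := by
    intro x hx
    have h1 : ∀ t, G t x = (Ioi x).indicator (fun t => deriv φ t • f x) t := fun t => by
      simp [hG, indicator]
    simp only [h1]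
    rw [integral_indicator measurableSet_Ioi, hμ, Measure.restrict_restrict measurableSet_Ioi,
      integral_smul_const, ← neg_smul, ← hprim x hx.2.le]
    congr 3
    ext t
    simp only [mem_inter_iff, mem_Ioi, mem_Ioo]
    constructor
    · rintro ⟨h1, -, h2⟩
      exact ⟨h1, h2⟩
    · rintro ⟨h1, h2⟩
      exact ⟨h1, hx.1.trans h1, h2⟩
  have h1 : ∫ t in Ioo 0 T, deriv φ t • w t = ∫ t, (deriv φ t • c + ∫ x, G t x ∂μ) ∂μ := by
    refine setIntegral_congr_fun measurableSet_Ioo fun t ht => ?_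
    simp only [hw t ht, smul_add, hin1 t ht]
  have h2 : ∫ t, deriv φ t • c ∂μ = 0 := by
    rw [integral_smul_const, hμ, hprim 0 hT.le, hout 0 (by simp)]
    simp
  have h3 : Integrable (fun t => ∫ x, G t x ∂μ) μ := hGi.integral_prod_left
  rw [h1, integral_add (hdi.smul_const c) h3, h2, zero_add,
    integral_integral_swap hGi, ← integral_neg]
  exact setIntegral_congr_fun measurableSet_Ioo hin2

/-! ### Weak-strong limits and lower semicontinuity on a measure space -/

section WeakStrong

variable {α H : Type*} [MeasurableSpace α] {μ : Measure α} [NormedAddCommGroup H]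
  [InnerProductSpace ℝ H]

theorem inner_toLp_indicator {S : Set α} (hS : MeasurableSet S) {y : α → H}
    (hy : MemLp (S.indicator y) 2 μ) (f : Lp H 2 μ) :
    inner ℝ (hy.toLp _) f = ∫ t in S, inner ℝ (y t) (f t) ∂μ := by
  rw [L2.inner_def, ← integral_indicator hS]
  refine integral_congr_ae ?_
  filter_upwards [hy.coeFn_toLp] with t ht
  rw [ht]
  by_cases h : t ∈ S <;> simp [h]

theorem norm_sq_toLp_eq_integral {y : α → H} (hy : MemLp y 2 μ) :
    ‖hy.toLp y‖ ^ 2 = ∫ t, ‖y t‖ ^ 2 ∂μ := by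
  rw [← real_inner_self_eq_norm_sq, L2.inner_def]
  refine integral_congr_ae ?_
  filter_upwards [hy.coeFn_toLp] with t ht
  rw [ht, real_inner_self_eq_norm_sq]

/-- Integrals of the inner products of a weakly and a strongly convergent sequence. -/
theorem tendsto_setIntegral_inner [IsFiniteMeasure μ] {x : ℕ → Lp H 2 μ} {x' : Lp H 2 μ} {C D : ℝ}
    (hx : ∀ ψ, Filter.Tendsto (fun k => inner ℝ (x k) ψ) Filter.atTop (𝓝 (inner ℝ x' ψ)))
    (hC : ∀ k, ‖x k‖ ≤ C) {y : ℕ → α → H} {c : H} (hy : ∀ k, AEStronglyMeasurable (y k) μ)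
    (hD : ∀ k, ∀ᵐ t ∂μ, ‖y k t‖ ≤ D)
    (hlim : ∀ᵐ t ∂μ, Filter.Tendsto (fun k => y k t) Filter.atTop (𝓝 c)) {S : Set α}
    (hS : MeasurableSet S) :
    Filter.Tendsto (fun k => ∫ t in S, inner ℝ (y k t) (x k t) ∂μ) Filter.atTop
      (𝓝 (∫ t in S, inner ℝ c (x' t) ∂μ)) := by
  have hg : ∀ k, MemLp (S.indicator (y k)) 2 μ := fun k =>
    (MemLp.of_bound (hy k) D (hD k)).indicator hS
  have hg' : ∀ k, MemLp (S.indicator fun t => y k t - c) 2 μ := fun k =>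
    ((MemLp.of_bound (hy k) D (hD k)).sub (memLp_const c)).indicator hS
  -- The strong sequence is split into its limit c, which tests the weak convergence, and a
  -- remainder that tends to 0 in L² by dominated convergence.
  have hsub : ∀ k, (hg k).toLp _ = (hg' k).toLp _ + indicatorConstLp 2 hS (measure_ne_top μ S) c := by
    intro k
    refine Lp.ext ?_
    filter_upwards [(hg k).coeFn_toLp, (hg' k).coeFn_toLp, Lp.coeFn_add ((hg' k).toLp _)
      (indicatorConstLp 2 hS (measure_ne_top μ S) c),
      indicatorConstLp_coeFn (p := 2) (hs := hS) (hμs := measure_ne_top μ S) (c := c)]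
      with t h1 h2 h3 h4
    rw [h1, h3, Pi.add_apply, h2, h4]
    by_cases h : t ∈ S <;> simp [h]
  have hnorm : Filter.Tendsto (fun k => ‖(hg' k).toLp _‖) Filter.atTop (𝓝 0) := by
    have h1 : Filter.Tendsto (fun k => ‖(hg' k).toLp _‖ ^ 2) Filter.atTop (𝓝 0) := by
      simp only [norm_sq_toLp_eq_integral]
      rw [← integral_zero α ℝ (μ := μ)]
      refine tendsto_integral_of_dominated_convergence (fun _ => (D + ‖c‖) ^ 2)
        (fun k => (hg' k).1.norm.pow 2) (integrable_const _) (fun k => ?_) ?_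
      · filter_upwards [hD k] with t ht
        rw [norm_pow, norm_norm]
        refine pow_le_pow_left₀ (norm_nonneg _) ?_ 2
        refine (norm_indicator_le_norm_self _ _).trans ((norm_sub_le _ _).trans ?_)
        linarith
      · filter_upwards [hlim] with t ht
        by_cases h : t ∈ S
        · simp only [indicator_of_mem h]
          have := ((ht.sub_const c).norm.pow 2)
          simpa using this
        · simp [h]
    have h2 := h1.sqrt
    simpa [Real.sqrt_sq (norm_nonneg _)] using h2
  have h1 : ∀ k, ∫ t in S, inner ℝ (y k t) (x k t) ∂μ = inner ℝ ((hg' k).toLp _) (x k)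
      + inner ℝ (x k) (indicatorConstLp 2 hS (measure_ne_top μ S) c) := by
    intro k
    rw [← inner_toLp_indicator hS (hg k), hsub k, inner_add_left,
      real_inner_comm (indicatorConstLp 2 hS (measure_ne_top μ S) c)]
  simp only [h1]
  rw [← L2.inner_indicatorConstLp_eq_setIntegral_inner ℝ x' hS c (measure_ne_top μ S),
    real_inner_comm, ← zero_add (inner ℝ x' _)]
  refine Filter.Tendsto.add ?_ (hx _)
  refine squeeze_zero_norm (fun k => ?_) (a := fun k => ‖(hg' k).toLp _‖ * C)
    (by simpa only [zero_mul] using hnorm.mul_const C)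
  exact (norm_inner_le_norm _ _).trans (mul_le_mul_of_nonneg_left (hC k) (norm_nonneg _))

/-- A pointwise inequality survives the passage to a dominated limit on the left and a weak limit on
the right. -/
theorem ae_le_of_tendsto_setIntegral [IsFiniteMeasure μ] {F G : ℕ → α → ℝ} {f g : α → ℝ} {C : ℝ}
    (hF : ∀ k, AEStronglyMeasurable (F k) μ) (hC : ∀ k, ∀ᵐ t ∂μ, ‖F k t‖ ≤ C)
    (hf : ∀ᵐ t ∂μ, Filter.Tendsto (fun k => F k t) Filter.atTop (𝓝 (f t)))
    (hG : ∀ k, Integrable (G k) μ) (hg : Integrable g μ) (hle : ∀ k, F k ≤ᵐ[μ] G k)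
    (hlim : ∀ S, MeasurableSet S → Filter.Tendsto (fun k => ∫ t in S, G k t ∂μ) Filter.atTop
      (𝓝 (∫ t in S, g t ∂μ))) : f ≤ᵐ[μ] g := by
  have hfm : AEStronglyMeasurable f μ := aestronglyMeasurable_of_tendsto_ae Filter.atTop hF hf
  have hfi : Integrable f μ := by
    refine Integrable.of_bound hfm C ?_
    filter_upwards [ae_all_iff.2 hC, hf] with t h1 h2
    exact le_of_tendsto h2.norm (Filter.Eventually.of_forall h1)
  refine ae_le_of_forall_setIntegral_le hfi hg fun S hS _ => ?_
  refine le_of_tendsto_of_tendsto' ?_ (hlim S hS) fun k =>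
    integral_mono_ae (Integrable.of_bound (hF k) C (hC k)).integrableOn (hG k).integrableOn
      (ae_restrict_of_ae (hle k))
  exact tendsto_integral_of_dominated_convergence (fun _ => C) (fun k => (hF k).restrict)
    (integrable_const C) (fun k => ae_restrict_of_ae (hC k)) (ae_restrict_of_ae hf)

theorem _root_.MeasureTheory.MemLp.integrable_inner_coe {y : α → H} (hy : MemLp y 2 μ)
    (f : Lp H 2 μ) : Integrable (fun t => inner ℝ (y t) (f t)) μ := by
  refine (L2.integrable_inner (𝕜 := ℝ) (hy.toLp _) f).congr ?_
  filter_upwards [hy.coeFn_toLp] with t ht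
  rw [ht]

/-- From ‖f - g‖² ≥ 0. The left side is affine in f and passes to weak limits; with g the limit
itself this is the lower semicontinuity of the dissipation. -/
theorem two_mul_inner_sub_setIntegral_le (f g : Lp H 2 μ) {S : Set α} (hS : MeasurableSet S) :
    2 * inner ℝ f (((Lp.memLp g).indicator hS).toLp _) - ∫ t in S, ‖g t‖ ^ 2 ∂μ
      ≤ ∫ t in S, ‖f t‖ ^ 2 ∂μ := by
  have hsq : ∀ f : Lp H 2 μ, Integrable (fun t => ‖f t‖ ^ 2) μ := fun f =>
    (memLp_two_iff_integrable_sq_norm (Lp.memLp f).1).1 (Lp.memLp f)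
  have h1 := (L2.integrable_inner (𝕜 := ℝ) g f).const_mul 2
  rw [real_inner_comm, inner_toLp_indicator hS ((Lp.memLp g).indicator hS), ← integral_const_mul,
    ← integral_sub h1.integrableOn (hsq g).integrableOn]
  refine integral_mono (h1.sub (hsq g)).integrableOn (hsq f).integrableOn fun t => ?_
  have := norm_sub_sq_real (g t) (f t)
  have := sq_nonneg ‖g t - f t‖
  simp only
  linarith

end WeakStrong

/-! ### Regularity in time of the limit curve -/

namespace W0

variable {N : ℕ} [NeZero N] {Ω : BoundedLipschitzDomain N} {s p : ℝ} [hp2 : Fact (2 ≤ p)]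

namespace IsLimitCurve

variable {T M R B : ℝ} {u₀ : W0 Ω s p} {n m : ℕ → ℕ} {U : ℕ → ℕ → W0 Ω s p} {u : ℝ → W0 Ω s p}
  {ut : Lp (L2 Ω) 2 (volume.restrict (Ioo 0 T))}

theorem apply_zero (h : IsLimitCurve T M R B u₀ n m U u ut) : u 0 = u₀ := by
  refine toL2_injective (tendsto_nhds_unique (h.tendsto_toL2 0 ⟨le_rfl, h.pos.le⟩) ?_)
  simp only [stepIndex_zero, (h.discrete _).zero]
  exact tendsto_const_nhds

theorem norm_toL2_le (h : IsLimitCurve T M R B u₀ n m U u ut) {t : ℝ} (ht : t ∈ Icc 0 T) :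
    ‖(u t).toL2‖ ≤ M :=
  le_of_tendsto (h.tendsto_toL2 t ht).norm
    (Filter.Eventually.of_forall fun k => (h.discrete k).norm_toL2_step_le h.pos ht.2)

theorem stronglyMeasurable_toL2 (h : IsLimitCurve T M R B u₀ n m U u ut) :
    StronglyMeasurable fun t => (u t).toL2 := by
  refine stronglyMeasurable_of_tendsto Filter.atTop (f := fun k => (Icc 0 T).indicator
    fun t => (U k (stepIndex (T / m k) t)).toL2) (fun k =>
    (stronglyMeasurable_comp_stepIndex _ fun j => (U k j).toL2).indicator measurableSet_Icc) ?_
  rw [tendsto_pi_nhds]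
  intro t
  by_cases ht : t ∈ Icc 0 T
  · simpa only [indicator_of_mem ht] using h.tendsto_toL2 t ht
  · have h0 : (0 : W0 Ω s p).toL2 = 0 := by simpa using toL2_smul (0 : ℝ) (0 : W0 Ω s p)
    simp only [indicator_of_notMem ht, h.eq_zero t ht, h0]
    exact tendsto_const_nhds

/-- Weak convergence tested with y times the indicator of (0, t) passes to the limit in the
integral, while the gap between the two interpolants vanishes with the time step. -/
theorem toL2_eq (h : IsLimitCurve T M R B u₀ n m U u ut) {t : ℝ} (ht : t ∈ Icc 0 T) :
    (u t).toL2 = u₀.toL2 + ∫ x in (0)..t, ut x := by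
  have hrestr : (volume.restrict (Ioo 0 T)).restrict (Ioo 0 t) = volume.restrict (Ioo 0 t) :=
    Measure.restrict_restrict_of_subset (Ioo_subset_Ioo_right ht.2)
  have hinner : ∀ (f : Lp (L2 Ω) 2 (volume.restrict (Ioo 0 T))) (y : L2 Ω),
      inner ℝ f (indicatorConstLp 2 measurableSet_Ioo (measure_ne_top _ (Ioo 0 t)) y)
        = inner ℝ y (∫ x in (0)..t, f x) := by
    intro f y
    rw [real_inner_comm, L2.inner_indicatorConstLp_eq_inner_setIntegral, hrestr,
      intervalIntegral.integral_of_le ht.1, integral_Ioc_eq_integral_Ioo]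
  have hδ : ∀ k, ∫ x in (0)..t, ((memLp_diffQuot (U k) (T / m k) T).toLp _ : ℝ → L2 Ω) x
      = ∫ x in (0)..t, diffQuot (T / m k) (U k) (stepIndex (T / m k) x) := by
    intro k
    rw [intervalIntegral.integral_of_le ht.1, intervalIntegral.integral_of_le ht.1,
      integral_Ioc_eq_integral_Ioo, integral_Ioc_eq_integral_Ioo, ← hrestr]
    exact integral_congr_ae (ae_restrict_of_ae (memLp_diffQuot (U k) (T / m k) T).coeFn_toLp)
  have hm : Filter.Tendsto m Filter.atTop Filter.atTop :=
    Filter.tendsto_atTop_mono (fun k => (h.discrete k).le) h.tendsto_level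
  have herr : Filter.Tendsto (fun k => (U k (stepIndex (T / m k) t)).toL2 - u₀.toL2
      - ∫ x in (0)..t, diffQuot (T / m k) (U k) (stepIndex (T / m k) x)) Filter.atTop (𝓝 0) := by
    rw [tendsto_zero_iff_norm_tendsto_zero]
    have h1 : Filter.Tendsto (fun k => T / (m k : ℝ) * B) Filter.atTop (𝓝 0) := by
      simpa using ((tendsto_natCast_atTop_atTop.comp hm).const_div_atTop T).mul_const B
    have h2 := (squeeze_zero (fun k => sq_nonneg _)
      (fun k => (h.discrete k).norm_sub_integral_sq_le h.pos ht.1 ht.2) h1).sqrt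
    simpa [Real.sqrt_sq (norm_nonneg _)] using h2
  have hzero : ∀ y : L2 Ω, inner ℝ y ((u t).toL2 - u₀.toL2 - ∫ x in (0)..t, ut x) = 0 := by
    intro y
    have h1 := (tendsto_const_nhds (x := y)).inner (𝕜 := ℝ) herr
    rw [inner_zero_right] at h1
    refine tendsto_nhds_unique ?_ h1
    have h2 := h.tendsto_inner
      (indicatorConstLp 2 measurableSet_Ioo (measure_ne_top _ (Ioo 0 t)) y)
    simp only [hinner, hδ] at h2
    simp only [inner_sub_right]
    exact (((tendsto_const_nhds (x := y)).inner (h.tendsto_toL2 t ht)).sub_const _).sub h2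
  have := inner_self_eq_zero.1 (hzero _)
  rw [sub_sub, sub_eq_zero] at this
  exact this

theorem integrableOn_deriv (_ : IsLimitCurve T M R B u₀ n m U u ut) : IntegrableOn ut (Ioo 0 T) :=
  (Lp.memLp ut).integrable one_le_two

theorem hasWeakTimeDeriv (h : IsLimitCurve T M R B u₀ n m U u ut) :
    HasWeakTimeDeriv T (fun t => (u t).toL2) ut :=
  hasWeakTimeDeriv_of_eq_integral h.integrableOn_deriv fun _ ht => h.toL2_eq (Ioo_subset_Icc_self ht)

theorem continuousOn_toL2 (h : IsLimitCurve T M R B u₀ n m U u ut) :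
    ContinuousOn (fun t => (u t).toL2) (Icc 0 T) := by
  have h1 : ContinuousOn (fun t => u₀.toL2 + ∫ x in (0)..t, ut x) (Icc 0 T) := by
    have := intervalIntegral.continuousOn_primitive_interval (a := 0) (b := T) (μ := volume)
      (f := ut) (by
        rw [uIcc_of_le h.pos.le, integrableOn_Icc_iff_integrableOn_Ioo]
        exact h.integrableOn_deriv)
    rw [uIcc_of_le h.pos.le] at this
    exact continuousOn_const.add this
  exact h1.congr fun t ht => h.toL2_eq ht

end IsLimitCurve

end W0

/-! ### Passage to the limit in the equation and in the energy -/

namespace W0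

theorem integral_mul_eq_inner {N : ℕ} {Ω : BoundedLipschitzDomain N} {s p : ℝ} [Fact (2 ≤ p)]
    (f : L2 Ω) (v : W0 Ω s p) :
    ∫ x in Ω.carrier, f x * v x = inner ℝ f v.toL2 := by
  rw [L2.inner_def]
  refine integral_congr_ae ?_
  filter_upwards [coe_toL2 v] with x h1
  rw [h1]
  simp [mul_comm]

variable {N : ℕ} [NeZero N] {Ω : BoundedLipschitzDomain N} {s p : ℝ} [hp2 : Fact (2 ≤ p)]

/-- Integrability over `Ω` of functions of subcritical growth. -/
theorem integrable_of_growth (hs : 0 < s) {D r : ℝ} (hD : 0 ≤ D) (hr : 0 < r)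
    (hrq : r < sobExp N s p) (u v : W0 Ω s p) {F : ℝ → ℝ → ℝ} (hF : Continuous F.uncurry)
    (hb : ∀ a b, |F a b| ≤ D * (1 + |a| ^ r + |b| ^ r)) :
    Integrable (fun x => F (u x) (v x)) (volume.restrict Ω.carrier) := by
  obtain ⟨B, hB⟩ := exists_integral_growth_bound (p := p) Ω hs (max ‖u.toL2‖ ‖v.toL2‖)
    (max ‖u‖ ‖v‖) hD hr hrq
  exact (hB u v (le_max_left _ _) (le_max_right _ _) (le_max_left _ _) (le_max_right _ _) _
    (hF.measurable.comp ((measurable_coe u).prodMk (measurable_coe v))).aestronglyMeasurable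
    fun x => hb _ _).1

theorem integrable_logSource_mul (hs : 0 < s) (u v : W0 Ω s p) :
    Integrable (fun x => logSource p (u x) * v x) (volume.restrict Ω.carrier) := by
  have hp := hp2.out
  obtain ⟨r, C, hr1, hr2, hC0, hC, -, -, -⟩ := exists_exponent_and_bounds N hs hp
  exact integrable_of_growth hs (D := 2 * C) (by positivity) (by linarith) hr2 u v
    (F := fun a b => logSource p a * b)
    (((continuous_logSource hp).comp continuous_fst).mul continuous_snd)
    fun a b => growth_mul_le hC0.le (by linarith) (hC a)

theorem integrable_rpow_mul_mul (hs : 0 < s) (u v : W0 Ω s p) :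
    Integrable (fun x => |u x| ^ (p - 2) * u x * v x) (volume.restrict Ω.carrier) := by
  have hp := hp2.out
  refine integrable_of_growth hs (D := 2 * 1) (by positivity) (by linarith)
    (lt_sobExp hs (by linarith)) u v (F := fun a b => |a| ^ (p - 2) * a * b)
    (((continuous_fst.abs.rpow_const fun _ => Or.inr (by linarith)).mul continuous_fst).mul
      continuous_snd) fun a b => growth_mul_le zero_le_one (by linarith) ?_
  rw [abs_mul, abs_of_nonneg (Real.rpow_nonneg (abs_nonneg a) _)]
  rcases eq_or_ne a 0 with rfl | ha
  · rw [abs_zero, mul_zero]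
    positivity
  · rw [← Real.rpow_add_one (abs_pos.2 ha).ne', show p - 2 + 1 = p - 1 by ring]
    linarith

theorem integrable_logPotential (hs : 0 < s) (u : W0 Ω s p) :
    Integrable (fun x => logPotential p (u x)) (volume.restrict Ω.carrier) := by
  have hp := hp2.out
  obtain ⟨r, C, hr1, hr2, hC0, -, -, -, hC⟩ := exists_exponent_and_bounds N hs hp
  refine integrable_of_growth hs (D := 2 * C) (by positivity) (by linarith) hr2 u u
    (F := fun a _ => logPotential p a) ((continuous_logPotential hp).comp continuous_fst)
    fun a b => (hC a).trans (mul_le_mul_of_nonneg_left ?_ (by positivity))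
  have : 0 ≤ |b| ^ r := by positivity
  linarith

theorem integrable_rpow (hs : 0 < s) (u : W0 Ω s p) :
    Integrable (fun x => |u x| ^ p) (volume.restrict Ω.carrier) := by
  refine (integrable_rpow_mul_mul hs u u).congr (Filter.Eventually.of_forall fun x => ?_)
  have hp := hp2.out
  rcases eq_or_ne (u x) 0 with h | h
  · simp [h, Real.zero_rpow (by linarith : p ≠ 0)]
  · have h1 : |u x| ^ p = |u x| ^ (p - 2) * |u x| ^ 2 := by
      rw [← Real.rpow_natCast, ← Real.rpow_add (abs_pos.2 h)]
      norm_num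
    simp only
    rw [h1, sq_abs]
    ring

theorem energy_eq (hs : 0 < s) (u : W0 Ω s p) :
    energy u = ‖u‖ ^ p / p - ∫ x in Ω.carrier, logPotential p (u x) := by
  have hp := hp2.out
  have hp0 : p ≠ 0 := by linarith
  have h1 := integrable_rpow hs u
  have h2 : Integrable (fun x => |u x| ^ p * Real.log |u x|) (volume.restrict Ω.carrier) := by
    refine (((integrable_logPotential hs u).const_mul p).add
      (h1.const_mul (1 / p + 1))).congr (Filter.Eventually.of_forall fun x => ?_)
    simp only [Pi.add_apply, logPotential_eq hp]
    field_simp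
    ring
  simp only [energy, logPotential_eq hp]
  have h3 : Integrable (fun x => 1 / p * (|u x| ^ p * Real.log |u x|) - 1 / p ^ 2 * |u x| ^ p)
      (volume.restrict Ω.carrier) := (h2.const_mul _).sub (h1.const_mul _)
  rw [integral_sub h3 (h1.const_mul _), integral_sub (h2.const_mul _) (h1.const_mul _), integral_const_mul, integral_const_mul,
    integral_const_mul, norm_rpow_eq]
  ring

/-- Capping at the expected limit turns lower semicontinuity into true, bounded convergence, to
which dominated convergence in time applies. -/
theorem tendsto_min_norm_rpow_div (hs : 0 < s) {v : ℕ → W0 Ω s p} {u : W0 Ω s p}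
    (hv : Filter.Tendsto (fun k => (v k).toL2) Filter.atTop (𝓝 u.toL2)) :
    Filter.Tendsto (fun k => min (‖v k‖ ^ p / p) (‖u‖ ^ p / p)) Filter.atTop
      (𝓝 (‖u‖ ^ p / p)) := by
  refine tendsto_order.2 ⟨fun a ha => ?_, fun a ha => ?_⟩
  · by_contra hcon
    obtain ⟨φ, hφ, hφ'⟩ := Filter.extraction_of_frequently_atTop (Filter.not_eventually.1 hcon)
    have h1 := norm_rpow_div_le_of_tendsto hs (hv.comp hφ.tendsto_atTop) (a := fun _ => a)
      (Filter.Eventually.of_forall fun k => ?_) tendsto_const_nhds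
    · linarith
    · by_contra hlt
      exact hφ' k (lt_min (not_le.1 hlt) ha)
  · exact Filter.Eventually.of_forall fun k => (min_le_right _ _).trans_lt ha

namespace IsLimitCurve

variable {T M R B : ℝ} {u₀ : W0 Ω s p} {n m : ℕ → ℕ} {U : ℕ → ℕ → W0 Ω s p} {u : ℝ → W0 Ω s p}
  {ut : Lp (L2 Ω) 2 (volume.restrict (Ioo 0 T))}

set_option maxHeartbeats 800000 in
/-- The evolution variational inequality satisfied by limits of discrete solutions. -/
theorem ae_integral_sub_inner_le (hs : 0 < s) (h : IsLimitCurve T M R B u₀ n m U u ut)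
    (v : W0 Ω s p) : ∀ᵐ t ∂(volume.restrict (Ioo 0 T)),
      (∫ x in Ω.carrier, logSource p (u t x) * v x) - inner ℝ v.toL2 (ut t)
        ≤ ‖u t + v‖ ^ p / p - ‖u t‖ ^ p / p := by
  have hp := hp2.out
  have hp0 : 0 < p := by linarith
  have hR0 : 0 ≤ R := (norm_nonneg _).trans (h.norm_le 0)
  have hM0 : 0 ≤ M := (norm_nonneg _).trans (h.norm_toL2_le ⟨le_rfl, h.pos.le⟩)
  set q : ℕ → ℝ → W0 Ω s p := fun k t => U k (stepIndex (T / m k) t) with hq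
  -- Testing with u(t) + v makes z converge strongly in L² to the constant v, so its product with
  -- the weakly convergent difference quotients has a limit.
  set z : ℕ → ℝ → W0 Ω s p := fun k t => u t + v - q k t with hz
  set M' := 2 * M + ‖v.toL2‖ with hM'
  set R' := 2 * R + ‖v‖ with hR'
  have hqM : ∀ k, ∀ t ∈ Ioo 0 T, ‖(q k t).toL2‖ ≤ M := fun k t ht =>
    (h.discrete k).norm_toL2_step_le h.pos ht.2.le
  have hqR : ∀ k, ∀ t ∈ Ioo 0 T, ‖q k t‖ ≤ R := fun k t ht =>
    (h.discrete k).norm_step_le h.pos ht.2.le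
  have hzL : ∀ k t, (z k t).toL2 = (u t).toL2 + v.toL2 - (q k t).toL2 := fun k t => by
    rw [hz, toL2_sub, toL2_add]
  have hzM : ∀ k, ∀ t ∈ Ioo 0 T, ‖(z k t).toL2‖ ≤ M' := by
    intro k t ht
    rw [hzL]
    have h1 := norm_sub_le ((u t).toL2 + v.toL2) (q k t).toL2
    have h2 := norm_add_le (u t).toL2 v.toL2
    linarith [hqM k t ht, h.norm_toL2_le (Ioo_subset_Icc_self ht)]
  have hzR : ∀ k, ∀ t ∈ Ioo 0 T, ‖z k t‖ ≤ R' := by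
    intro k t ht
    have h1 := norm_sub_le (u t + v) (q k t)
    have h2 := norm_add_le (u t) v
    linarith [hqR k t ht, h.norm_le t]
  have hqlim : ∀ t ∈ Ioo 0 T, Filter.Tendsto (fun k => (q k t).toL2) Filter.atTop
      (𝓝 (u t).toL2) := fun t ht => h.tendsto_toL2 t (Ioo_subset_Icc_self ht)
  have hzlim : ∀ t ∈ Ioo 0 T, Filter.Tendsto (fun k => (z k t).toL2) Filter.atTop
      (𝓝 v.toL2) := by
    intro t ht
    simp only [hzL]
    simpa using (hqlim t ht).const_sub ((u t).toL2 + v.toL2)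
  have huL := h.stronglyMeasurable_toL2
  have hu := stronglyMeasurable_of_toL2 hs huL
  have hzm : ∀ k, StronglyMeasurable fun t => (z k t).toL2 := by
    intro k
    simp only [hzL]
    exact (huL.add stronglyMeasurable_const).sub
      (stronglyMeasurable_comp_stepIndex _ fun j => (U k j).toL2)
  obtain ⟨A, hA⟩ := exists_abs_inner_truncSourceL2_le (p := p) Ω hs M' R'
  have hmem : ∀ᵐ t ∂(volume.restrict (Ioo 0 T)), t ∈ Ioo 0 T := ae_restrict_mem measurableSet_Ioo
  set δ := fun k => (memLp_diffQuot (U k) (T / m k) T).toLp _ with hδ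
  have hnn : ∀ w : W0 Ω s p, 0 ≤ ‖w‖ ^ p / p := fun w => by positivity
  have hbd : ∀ (w : W0 Ω s p) (r : ℝ), ‖w‖ ≤ r → ‖w‖ ^ p / p ≤ r ^ p / p := fun w r hw =>
    div_le_div_of_nonneg_right (Real.rpow_le_rpow (norm_nonneg _) hw hp0.le) hp0.le
  have hmul : ∀ w : ℝ → W0 Ω s p, StronglyMeasurable w →
      StronglyMeasurable fun t => ‖w t‖ ^ p / p := fun w hw =>
    ((hw.norm.measurable.pow_const p).div_const p).stronglyMeasurable
  have key := ae_le_of_tendsto_setIntegral (μ := volume.restrict (Ioo 0 T))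
    (F := fun k t => inner ℝ (truncSourceL2 (n k) (q k t)) (z k t).toL2
      - (‖u t + v‖ ^ p / p - min (‖q k t‖ ^ p / p) (‖u t‖ ^ p / p)))
    (G := fun k t => inner ℝ (z k t).toL2 (δ k t))
    (f := fun t => (∫ x in Ω.carrier, logSource p (u t x) * v x)
      - (‖u t + v‖ ^ p / p - ‖u t‖ ^ p / p))
    (g := fun t => inner ℝ v.toL2 (ut t)) (C := A + ((R + ‖v‖) ^ p / p + R ^ p / p))
    ?_ ?_ ?_ ?_ ?_ ?_ ?_
  · filter_upwards [key] with t ht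
    linarith
  · intro k
    have h1 : StronglyMeasurable fun t => truncSourceL2 (n k) (q k t) :=
      stronglyMeasurable_comp_stepIndex _ fun j => truncSourceL2 (n k) (U k j)
    exact ((h1.inner (hzm k)).sub ((hmul _ (hu.add stronglyMeasurable_const)).sub
      ((hmul _ (stronglyMeasurable_comp_stepIndex _ (U k))).inf (hmul _ hu)))).aestronglyMeasurable
  · intro k
    filter_upwards [hmem] with t ht
    have h1 : |inner ℝ (truncSourceL2 (n k) (q k t)) (z k t).toL2| ≤ A :=
      hA _ _ _ ((hqM k t ht).trans (by linarith [norm_nonneg v.toL2])) (hzM k t ht)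
        ((hqR k t ht).trans (by linarith [norm_nonneg v])) (hzR k t ht)
    have h2 := hbd (u t + v) (R + ‖v‖) ((norm_add_le _ _).trans (by linarith [h.norm_le t]))
    have h3 := hbd (u t) R (h.norm_le t)
    have h4 : 0 ≤ min (‖q k t‖ ^ p / p) (‖u t‖ ^ p / p) := le_min (hnn _) (hnn _)
    have h5 := min_le_right (‖q k t‖ ^ p / p) (‖u t‖ ^ p / p)
    rw [Real.norm_eq_abs]
    refine (abs_sub _ _).trans (add_le_add h1 ?_)
    rw [abs_le]
    constructor <;> linarith [hnn (u t + v), hnn (u t)]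
  · filter_upwards [hmem] with t ht
    refine Filter.Tendsto.sub ?_ (Filter.Tendsto.const_sub _ ?_)
    · exact tendsto_inner_truncSourceL2 hs h.tendsto_level (M := M') (R := R')
        (fun k => (hqM k t ht).trans (by linarith [norm_nonneg v.toL2]))
        (fun k => (hqR k t ht).trans (by linarith [norm_nonneg v]))
        (fun k => hzM k t ht) (fun k => hzR k t ht) (hqlim t ht) (hzlim t ht)
    · exact tendsto_min_norm_rpow_div hs (hqlim t ht)
  · refine fun k => (MemLp.of_bound (hzm k).aestronglyMeasurable M' ?_).integrable_inner_coe _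
    filter_upwards [hmem] with t ht using hzM k t ht
  · exact (memLp_const v.toL2).integrable_inner_coe ut
  · intro k
    filter_upwards [hmem, (memLp_diffQuot (U k) (T / m k) T).coeFn_toLp] with t ht ht'
    have h1 := (h.discrete k).inner_step_le h.pos ht.1 ht.2.le (u t + v)
    rw [toL2_add, ← hzL, inner_sub_left, ← ht', real_inner_comm (z k t).toL2 (δ k t)] at h1
    -- Replacing `‖q‖^p / p` by the minimum decreases the left side, so the inequality is kept.
    have h2 := min_le_left (‖q k t‖ ^ p / p) (‖u t‖ ^ p / p)
    simp only [hq, hδ] at h1 h2 ⊢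
    linarith
  · intro S hS
    refine tendsto_setIntegral_inner h.tendsto_inner (C := Real.sqrt B) (D := M') (fun k => ?_)
      (fun k => (hzm k).aestronglyMeasurable) (fun k => ?_) ?_ hS
    · exact Real.le_sqrt_of_sq_le ((h.discrete k).norm_sq_toLp_le h.pos)
    · filter_upwards [hmem] with t ht using hzM k t ht
    · filter_upwards [hmem] with t ht using hzlim t ht

/-- Only the countably many multiples v / (j + 1) are tested, so one null set of times serves them
all. -/
theorem ae_integral_sub_inner_le_K (hs : 0 < s) (h : IsLimitCurve T M R B u₀ n m U u ut)
    (v : W0 Ω s p) : ∀ᵐ t ∂(volume.restrict (Ioo 0 T)),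
      (∫ x in Ω.carrier, logSource p (u t x) * v x) - inner ℝ v.toL2 (ut t) ≤ K s p (u t) v := by
  filter_upwards [ae_all_iff.2 fun j : ℕ =>
    h.ae_integral_sub_inner_le hs ((1 / ((j : ℝ) + 1)) • v)] with t ht
  refine le_K_of_forall_le fun j => ?_
  refine le_trans (le_of_eq ?_) (ht j)
  rw [toL2_smul, real_inner_smul_left, mul_sub, ← integral_const_mul]
  congr 1
  refine integral_congr_ae ?_
  filter_upwards [ae_restrict_of_ae (coe_smul (1 / ((j : ℝ) + 1)) v)] with x hx
  rw [hx, Pi.smul_apply, smul_eq_mul]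
  ring

/-- Apart from K(u, v), equality needs only the one-sided inequality for v and for -v, because every
term is odd in v. -/
theorem ae_weakForm (hs : 0 < s) (h : IsLimitCurve T M R B u₀ n m U u ut) (v : W0 Ω s p) :
    ∀ᵐ t ∂(volume.restrict (Ioo 0 T)),
      inner ℝ v.toL2 (ut t) + K s p (u t) v = ∫ x in Ω.carrier, logSource p (u t x) * v x := by
  filter_upwards [h.ae_integral_sub_inner_le_K hs v, h.ae_integral_sub_inner_le_K hs (-v)]
    with t h1 h2
  have h3 : (-v).toL2 = -v.toL2 := by
    rw [← neg_one_smul ℝ v, toL2_smul, neg_one_smul]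
  have h4 : ∫ x in Ω.carrier, logSource p (u t x) * (-v : W0 Ω s p) x
      = -∫ x in Ω.carrier, logSource p (u t x) * v x := by
    rw [← integral_neg]
    refine integral_congr_ae ?_
    filter_upwards [ae_restrict_of_ae (coe_smul (-1) v)] with x hx
    rw [neg_one_smul] at hx
    rw [hx, Pi.smul_apply, smul_eq_mul]
    ring
  rw [K_neg, h3, h4, inner_neg_left] at h2
  linarith

set_option maxHeartbeats 800000 in
theorem energy_inequality (hs : 0 < s) (h : IsLimitCurve T M R B u₀ n m U u ut) {t : ℝ}
    (ht : t ∈ Icc 0 T) : (∫ τ in (0)..t, ‖ut τ‖ ^ 2) + energy (u t) ≤ energy u₀ := by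
  have hrestr : (volume.restrict (Ioo 0 T)).restrict (Ioo 0 t) = volume.restrict (Ioo 0 t) :=
    Measure.restrict_restrict_of_subset (Ioo_subset_Ioo_right ht.2)
  set q : ℕ → W0 Ω s p := fun k => U k (stepIndex (T / m k) t) with hq
  set δ := fun k => (memLp_diffQuot (U k) (T / m k) T).toLp _ with hδ
  have hX : MemLp ((Ioo 0 t).indicator ut) 2 (volume.restrict (Ioo 0 T)) :=
    (Lp.memLp ut).indicator measurableSet_Ioo
  set X := hX.toLp _ with hXdef
  set J := ∫ τ in (0)..t, ‖ut τ‖ ^ 2 with hJ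
  have hJ' : J = ∫ τ in Ioo 0 t, ‖ut τ‖ ^ 2 ∂(volume.restrict (Ioo 0 T)) := by
    rw [hrestr, hJ, intervalIntegral.integral_of_le ht.1, integral_Ioc_eq_integral_Ioo]
  have hXJ : inner ℝ ut X = J := by
    rw [real_inner_comm, inner_toLp_indicator measurableSet_Ioo hX, hJ']
    simp only [real_inner_self_eq_norm_sq]
  have hlow : ∀ k, 2 * inner ℝ (δ k) X - J
      ≤ ∫ τ in (0)..t, ‖diffQuot (T / m k) (U k) (stepIndex (T / m k) τ)‖ ^ 2 := by
    intro k
    have h1 : ∫ τ in (0)..t, ‖diffQuot (T / m k) (U k) (stepIndex (T / m k) τ)‖ ^ 2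
        = ∫ τ in Ioo 0 t, ‖δ k τ‖ ^ 2 ∂(volume.restrict (Ioo 0 T)) := by
      rw [intervalIntegral.integral_of_le ht.1, integral_Ioc_eq_integral_Ioo, ← hrestr]
      refine integral_congr_ae (ae_restrict_of_ae ?_)
      filter_upwards [(memLp_diffQuot (U k) (T / m k) T).coeFn_toLp] with τ hτ
      rw [hδ, hτ]
    rw [h1, hJ']
    exact two_mul_inner_sub_setIntegral_le (δ k) ut measurableSet_Ioo
  have hθ : Filter.Tendsto (fun k => 1 - 1 / ((n k : ℝ) + 1)) Filter.atTop (𝓝 1) := by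
    simpa using (tendsto_one_div_add_atTop_nhds_zero_nat.comp h.tendsto_level).const_sub (1 : ℝ)
  have hpot := tendsto_integral_truncPotential hs h.tendsto_level
    (fun k => (h.discrete k).norm_toL2_step_le h.pos ht.2)
    (fun k => (h.discrete k).norm_step_le h.pos ht.2) (h.tendsto_toL2 t ht)
  have hpot₀ := tendsto_integral_truncPotential hs h.tendsto_level (v := fun _ => u₀)
    (fun _ => le_rfl) (fun _ => le_rfl) tendsto_const_nhds
  -- Everything except `‖u(t)‖^p / p` is put in the convergent bound, the dissipation being first
  -- replaced by its affine minorant; the limit of that minorant is 2J - J = J.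
  have hfin := norm_rpow_div_le_of_tendsto hs (h.tendsto_toL2 t ht)
    (a := fun k => (‖u₀‖ ^ p / p - ∫ x in Ω.carrier, truncPotential p (n k) (u₀ x))
      + (∫ x in Ω.carrier, truncPotential p (n k) (q k x))
      - (1 - 1 / ((n k : ℝ) + 1)) * (2 * inner ℝ (δ k) X - J))
    (Filter.Eventually.of_forall fun k => ?_)
    (((hpot₀.const_sub _).add hpot).sub
      (hθ.mul (((h.tendsto_inner X).const_mul 2).sub_const J)))
  · rw [hXJ] at hfin
    rw [energy_eq hs, energy_eq hs]
    linarith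
  · have h1 := (h.discrete k).energy_step_le h.pos ht.1 ht.2
    have h2 : 0 ≤ 1 - 1 / ((n k : ℝ) + 1) := by
      rw [sub_nonneg, div_le_one (by positivity)]
      linarith [(Nat.cast_nonneg (n k) : (0 : ℝ) ≤ n k)]
    have h3 := mul_le_mul_of_nonneg_left (hlow k) h2
    simp only [truncEnergy] at h1
    linarith

theorem isWeakSolution (hs : 0 < s) (h : IsLimitCurve T M R B u₀ n m U u ut) :
    IsWeakSolution T u₀ u ut where
  memLp := memLp_top_of_bound
    (stronglyMeasurable_of_toL2 hs h.stronglyMeasurable_toL2).aestronglyMeasurable R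
    (Filter.Eventually.of_forall h.norm_le)
  memLp_deriv := Lp.memLp ut
  weakDeriv := h.hasWeakTimeDeriv
  initial := ⟨fun t => (u t).toL2, h.continuousOn_toL2, Filter.Eventually.of_forall fun _ => rfl,
    congrArg toL2 h.apply_zero⟩
  weakForm := by
    intro v
    filter_upwards [h.ae_weakForm hs v] with t ht
    -- `logSource` already contains the term `-|u|^(p-2) u`; splitting it off requires both parts to
    -- be integrable.
    have h1 : ∫ x in Ω.carrier, |u t x| ^ (p - 2) * u t x * Real.log |u t x| * v x
        = (∫ x in Ω.carrier, logSource p (u t x) * v x)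
          + ∫ x in Ω.carrier, |u t x| ^ (p - 2) * u t x * v x := by
      rw [← integral_add (integrable_logSource_mul hs _ _) (integrable_rpow_mul_mul hs _ _)]
      refine integral_congr_ae (Filter.Eventually.of_forall fun x => ?_)
      simp only [logSource, Real.log_abs]
      ring
    rw [h1, integral_mul_eq_inner, real_inner_comm, ht]

end IsLimitCurve

end W0

end FracPLog

end

theorem theorem1p1 {N : ℕ} [NeZero N] (Ω : FracPLog.BoundedLipschitzDomain N) (s p : ℝ)
    [Fact (2 ≤ p)] (hs0 : 0 < s) (hs1 : s < 1) (hN : s * p < N)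
    (u₀ : FracPLog.W0 Ω s p) (hu₀ : u₀ ≠ 0) :
    ∃ T : ℝ, 0 < T ∧ ∃ (u : ℝ → FracPLog.W0 Ω s p) (ut : ℝ → FracPLog.L2 Ω),
      FracPLog.IsWeakSolution T u₀ u ut ∧
      ∀ᵐ t ∂(volume.restrict (Icc 0 T)),
        (∫ τ in (0)..t, ‖ut τ‖ ^ 2) + FracPLog.energy (u t) ≤ FracPLog.energy u₀ := by
  obtain ⟨T, M, R, B, n, m, U, u, ut, h⟩ := FracPLog.W0.exists_isLimitCurve hs0 u₀
  refine ⟨T, h.pos, u, ut, h.isWeakSolution hs0, ?_⟩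
  filter_upwards [ae_restrict_mem measurableSet_Icc] with t ht
  exact h.energy_inequality hs0 ht
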